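/- Let $V\in L^1_{\mathrm{loc}}(\mathbb R)$ be real-valued, $\mathcal A=-\frac{d^2}{dx^2}+V$, and let $-\infty<a_-<a_+<\infty$, $I=(a_-,a_+)$, $I_-=(-\infty,a_-]$, $I_+=[a_+,\infty)$. All functions are complex-valued, and a solution of $\mathcal A u=\lambda u$ on an interval is a function $u$ such that $u$ and $u'$ are locally absolutely continuous there and the equation holds almost everywhere. Assume: (H1) $\mathcal A$ is in the limit point case at $\pm\infty$, i.e. both defect numbers of the minimal operator of $\mathcal A$ in $L^2(I_+)$ and of the one in $L^2(I_-)$ equal $1$: for $\lambda=i$ and $\lambda=-i$ the solutions of $\mathcal A u=\lambda u$ on $I_\pm$ lying in $L^2(I_\pm)$ form a one-dimensional space. (H2) The self-adjoint operator $H$ generated by $\mathcal A$ in $L^2(\mathbb R)$, with domain the set of all $\psi\in L^2(\mathbb R)$ such that $\psi,\psi'$ are locally absolutely continuous and $\mathcal A\psi\in L^2(\mathbb R)$, has discrete spectrum (its spectrum consists of isolated eigenvalues of finite multiplicity). For $\lambda\in\mathbb C\setminus\mathbb R$ let $c_\pm(\lambda,\cdot)$, $s_\pm(\lambda,\cdot)$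 be the solutions of $\mathcal A f=\lambda f$ on $I_\pm$ with $c_\pm(\lambda,a_\pm)=s_\pm'(\lambda,a_\pm)=1$ and $c_\pm'(\lambda,a_\pm)=s_\pm(\lambda,a_\pm)=0$. The Weyl--Titchmarsh coefficient $m_\pm(\lambda)$ is the number with $c_\pm(\lambda,\cdot)\pm m_\pm(\lambda)s_\pm(\lambda,\cdot)\in L^2(I_\pm)$; values at other points are those of the meromorphic extension. Then $m_-$ and $m_+$ extend to meromorphic functions on $\mathbb C$, they are Herglotz--Nevanlinna functions (holomorphic on $\mathbb C\setminus\mathbb R$, $m(\overline\lambda)=\overline{m(\lambda)}$, and $\operatorname{Im}m(\lambda)\ge 0$ for $\operatorname{Im}\lambda>0$), and the energy-dependent boundary conditions $$\varphi'(E,a_-)+m_-(E)\varphi(E,a_-)=0,\qquad \varphi'(E,a_+)-m_+(E)\varphi(E,a_+)=0$$ are transparent for $\mathcal A$ on $I$. Here boundary values at $a_\pm$ are one-sided limits from inside $I$, the first (second) condition is read as $\varphi(E,a_-)=0$ (as $\varphi(E,a_+)=0$) if $E$ is a pole of $m_-$ (of $m_+$), and an eigenfunction of the interval problem with eigenvalue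 $E\in\mathbb R$ is a nontrivial solution $\varphi\in L^2(I)$ of $\mathcal A\varphi=E\varphi$ on $I$ satisfying both conditions. Transparent means: 1. for every $E\in\mathbb R$ and every nontrivial solution $\psi\in L^2(\mathbb R)$ of $\mathcal A\psi=E\psi$ on $\mathbb R$, the restriction $\psi|_I$ is an eigenfunction of the interval problem with eigenvalue $E$; 2. every eigenfunction $\varphi$ of the interval problem with eigenvalue $E$ is the restriction to $I$ of a nontrivial solution $\psi\in L^2(\mathbb R)$ of $\mathcal A\psi=E\psi$ on $\mathbb R$; 3. the set of eigenvalues of the interval problem coincides with the spectrum of $H$. -/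

import Mathlib

open MeasureTheory Set Filter Topology

noncomputable section

namespace TBC

/-! ### The differential expression `𝒜 = -d²/dx² + V` on an interval `S ⊆ ℝ`

Derivatives are taken within `S`, so they are the ordinary derivatives at interior points of `S`
and the one-sided derivatives at the endpoints of `S` that belong to `S`. -/

/-- `u` is locally absolutely continuous on the interval `S`: it is absolutely continuous on every
compact subinterval of `S`. -/
def LocAC (S : Set ℝ) (u : ℝ → ℂ) : Prop :=
  ∀ x ∈ S, ∀ y ∈ S, AbsolutelyContinuousOnInterval u x y

/-- `u` and `u'` exist and are locally absolutely continuous on `S`. -/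
structure IsRegular (S : Set ℝ) (u : ℝ → ℂ) : Prop where
  differentiableOn : DifferentiableOn ℝ u S
  locAC : LocAC S u
  locAC_deriv : LocAC S (derivWithin u S)

/-- The differential expression `𝒜 u = -u'' + V u` on `S`. -/
def expr (V : ℝ → ℝ) (S : Set ℝ) (u : ℝ → ℂ) (x : ℝ) : ℂ :=
  -derivWithin (derivWithin u S) S x + (V x : ℂ) * u x

/-- `u` is a solution of `𝒜 u = l u` on the interval `S`. -/
structure IsSolution (V : ℝ → ℝ) (S : Set ℝ) (l : ℂ) (u : ℝ → ℂ) : Prop where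
  regular : IsRegular S u
  eqn : ∀ᵐ x ∂(volume.restrict S), expr V S u x = l * u x

/-- `u` is square-integrable on `S`. -/
def SqInt (S : Set ℝ) (u : ℝ → ℂ) : Prop := MemLp u 2 (volume.restrict S)

/-- The complex Hilbert space `L²(S)`. -/
abbrev L2 (S : Set ℝ) := Lp ℂ 2 (volume.restrict S)

/-! ### The maximal operator generated by `𝒜` in `L²(S)` -/

theorem LocAC.ae_differentiableWithinAt {S : Set ℝ} [hS : S.OrdConnected] {u : ℝ → ℂ}
    (h : LocAC S u) : ∀ᵐ x ∂(volume.restrict S), DifferentiableWithinAt ℝ u S x := by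
  refine LocallyBoundedVariationOn.ae_differentiableWithinAt ?_ hS.measurableSet
  intro a b ha hb
  exact (h a ha b hb).boundedVariationOn.mono (inter_subset_right.trans Icc_subset_uIcc)

theorem LocAC.congr {S : Set ℝ} [hS : S.OrdConnected] {u v : ℝ → ℂ} (h : LocAC S u)
    (huv : EqOn u v S) : LocAC S v := by
  intro x hx y hy
  have h1 := h x hx y hy
  rw [absolutelyContinuousOnInterval_iff] at h1 ⊢
  intro ε hε
  obtain ⟨δ, hδ, H⟩ := h1 ε hε
  refine ⟨δ, hδ, fun E hE hlt => ?_⟩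
  have h2 := H E hE hlt
  have hsub := hS.uIcc_subset hx hy
  refine lt_of_eq_of_lt (Finset.sum_congr rfl fun i hi => ?_) h2
  rw [huv (hsub (hE.1 i hi).1), huv (hsub (hE.1 i hi).2)]

theorem IsRegular.add {S : Set ℝ} [S.OrdConnected] {u v : ℝ → ℂ} (hu : IsRegular S u)
    (hv : IsRegular S v) : IsRegular S (u + v) where
  differentiableOn := hu.differentiableOn.add hv.differentiableOn
  locAC := fun x hx y hy => (hu.locAC x hx y hy).add (hv.locAC x hx y hy)
  locAC_deriv := by
    have h : LocAC S (derivWithin u S + derivWithin v S) :=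
      fun x hx y hy => (hu.locAC_deriv x hx y hy).add (hv.locAC_deriv x hx y hy)
    exact h.congr fun x hx =>
      (derivWithin_add (hu.differentiableOn x hx) (hv.differentiableOn x hx)).symm

theorem IsRegular.const_smul {S : Set ℝ} [S.OrdConnected] {u : ℝ → ℂ} (c : ℂ)
    (hu : IsRegular S u) : IsRegular S (c • u) where
  differentiableOn := hu.differentiableOn.const_smul c
  locAC := fun x hx y hy => (hu.locAC x hx y hy).const_smul c
  locAC_deriv := by
    have h : LocAC S (c • derivWithin u S) :=
      fun x hx y hy => (hu.locAC_deriv x hx y hy).const_smul c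
    exact h.congr fun x hx => (derivWithin_const_smul c (hu.differentiableOn x hx)).symm

theorem expr_add {V : ℝ → ℝ} {S : Set ℝ} [hS : S.OrdConnected] {u v : ℝ → ℂ}
    (hu : IsRegular S u) (hv : IsRegular S v) :
    expr V S (u + v) =ᵐ[volume.restrict S] expr V S u + expr V S v := by
  filter_upwards [hu.locAC_deriv.ae_differentiableWithinAt,
    hv.locAC_deriv.ae_differentiableWithinAt, ae_restrict_mem hS.measurableSet] with x h1 h2 hx
  have h : EqOn (derivWithin (u + v) S) (derivWithin u S + derivWithin v S) S := fun y hy =>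
    derivWithin_add (hu.differentiableOn y hy) (hv.differentiableOn y hy)
  simp only [expr, Pi.add_apply]
  rw [derivWithin_congr h (h hx), derivWithin_add h1 h2]
  ring

theorem expr_const_smul {V : ℝ → ℝ} {S : Set ℝ} [hS : S.OrdConnected] {u : ℝ → ℂ} (c : ℂ)
    (hu : IsRegular S u) :
    expr V S (c • u) =ᵐ[volume.restrict S] c • expr V S u := by
  filter_upwards [hu.locAC_deriv.ae_differentiableWithinAt,
    ae_restrict_mem hS.measurableSet] with x h1 hx
  have h : EqOn (derivWithin (c • u) S) (c • derivWithin u S) S := fun y hy =>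
    derivWithin_const_smul c (hu.differentiableOn y hy)
  simp only [expr, Pi.smul_apply, smul_eq_mul]
  rw [derivWithin_congr h (h hx), derivWithin_const_smul c h1]
  simp only [smul_eq_mul]
  ring

/-- The graph of the maximal operator: all pairs `(u, 𝒜 u)` in `L²(S) × L²(S)` such that `u` and
`u'` are locally absolutely continuous on `S`. -/
def maxGraph (V : ℝ → ℝ) (S : Set ℝ) [S.OrdConnected] : Submodule ℂ (L2 S × L2 S) where
  carrier := {p | ∃ u : ℝ → ℂ, IsRegular S u ∧ p.1 =ᵐ[volume.restrict S] u ∧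
    p.2 =ᵐ[volume.restrict S] expr V S u}
  zero_mem' := by
    refine ⟨(0 : ℂ) • (0 : ℝ → ℂ), ⟨?_, ?_, ?_⟩, ?_, ?_⟩
    · rw [zero_smul]; exact differentiableOn_const (0 : ℂ)
    · rw [zero_smul]
      intro x _ y _
      simp [absolutelyContinuousOnInterval_iff]
      exact fun ε hε => ⟨1, one_pos, fun _ _ _ _ => hε⟩
    · have h : derivWithin ((0 : ℂ) • (0 : ℝ → ℂ)) S = fun _ => 0 := by
        rw [zero_smul]; exact derivWithin_const S (0 : ℂ)
      rw [h]
      intro x _ y _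
      simp [absolutelyContinuousOnInterval_iff]
      exact fun ε hε => ⟨1, one_pos, fun _ _ _ _ => hε⟩
    · rw [zero_smul]; exact Lp.coeFn_zero _ _ _
    · refine (Lp.coeFn_zero _ _ _).trans (Eventually.of_forall fun x => ?_)
      have h : derivWithin (0 : ℝ → ℂ) S = fun _ => 0 := by
        exact derivWithin_const S (0 : ℂ)
      rw [zero_smul]
      simp [expr, h]
  add_mem' := by
    rintro p q ⟨u, hu, hu1, hu2⟩ ⟨v, hv, hv1, hv2⟩
    exact ⟨u + v, hu.add hv, (Lp.coeFn_add _ _).trans (hu1.add hv1),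
      (Lp.coeFn_add _ _).trans ((hu2.add hv2).trans (expr_add hu hv).symm)⟩
  smul_mem' := by
    rintro c p ⟨u, hu, hu1, hu2⟩
    exact ⟨c • u, hu.const_smul c, (Lp.coeFn_smul _ _).trans (hu1.const_smul c),
      (Lp.coeFn_smul _ _).trans ((hu2.const_smul c).trans (expr_const_smul c hu).symm)⟩

/-- The maximal operator generated by `𝒜` in `L²(S)`. Its domain consists of all `u ∈ L²(S)` such
that `u`, `u'` are locally absolutely continuous on `S` and `𝒜 u ∈ L²(S)`. For `S = ℝ` this is
the operator `H`, for a closed half-line it is the adjoint of the minimal operator. -/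
def maxOp (V : ℝ → ℝ) (S : Set ℝ) [S.OrdConnected] : L2 S →ₗ.[ℂ] L2 S :=
  (maxGraph V S).toLinearPMap

/-- On intervals with nonempty interior, `maxGraph` is the graph of `maxOp`. -/
theorem maxOp_graph (V : ℝ → ℝ) (S : Set ℝ) [hS : S.OrdConnected]
    (hcl : S ⊆ closure (interior S)) : (maxOp V S).graph = maxGraph V S := by
  refine Submodule.toLinearPMap_graph_eq _ ?_
  rintro ⟨f, g⟩ ⟨u, hu, hu1, hu2⟩ hf
  dsimp only at hf hu1 hu2 ⊢
  have h0 : u =ᵐ[volume.restrict S] fun _ => 0 := by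
    rw [hf] at hu1
    exact hu1.symm.trans (Lp.coeFn_zero _ _ _)
  have h1 : EqOn u (fun _ => 0) S :=
    Measure.eqOn_of_ae_eq h0 hu.differentiableOn.continuousOn continuousOn_const hcl
  have h2 : EqOn (derivWithin u S) (fun _ => 0) S := fun x hx => by
    rw [derivWithin_congr h1 (h1 hx)]; exact congrFun (derivWithin_const S (0 : ℂ)) x
  refine Lp.ext ?_
  filter_upwards [hu2, ae_restrict_mem hS.measurableSet,
    Lp.coeFn_zero ℂ 2 (volume.restrict S)] with x hx hxS hz
  rw [hx, hz, expr, derivWithin_congr h2 (h2 hxS), h1 hxS]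
  simp

/-! ### Spectral notions for unbounded operators -/

section Spectral

variable {E : Type*} [NormedAddCommGroup E] [NormedSpace ℂ E]

/-- The kernel of `T - l`, a subspace of the domain of `T`. -/
def eigenspace (T : E →ₗ.[ℂ] E) (l : ℂ) : Submodule ℂ T.domain :=
  LinearMap.ker (T.toFun - l • T.domain.subtype)

/-- The resolvent set: `T - l` is a bijection from the domain of `T` onto the whole space, with a
bounded inverse `R`. -/
def resolventSet (T : E →ₗ.[ℂ] E) : Set ℂ :=
  {l | ∃ R : E →L[ℂ] E, (∀ f : T.domain, R (T f - l • (f : E)) = f) ∧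
    ∀ g : E, ∃ f : T.domain, (f : E) = R g ∧ T f - l • (f : E) = g}

/-- The spectrum of `T`. -/
def spec (T : E →ₗ.[ℂ] E) : Set ℂ := (resolventSet T)ᶜ

/-- The spectrum is discrete: it consists of isolated eigenvalues of finite multiplicity. -/
def HasDiscreteSpectrum (T : E →ₗ.[ℂ] E) : Prop :=
  ∀ l ∈ spec T, (∀ᶠ z in 𝓝[≠] l, z ∉ spec T) ∧ eigenspace T l ≠ ⊥ ∧
    FiniteDimensional ℂ (eigenspace T l)

end Spectral

/-! ### Limit point case and Weyl–Titchmarsh coefficients -/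

/-- The expression `𝒜` on the closed half-line `S` is in the limit point case at the infinite end
of `S`: both defect numbers of the minimal operator in `L²(S)` are equal to one. -/
def IsLimitPoint (V : ℝ → ℝ) (S : Set ℝ) [S.OrdConnected] : Prop :=
  Module.finrank ℂ (eigenspace (maxOp V S) Complex.I) = 1 ∧
    Module.finrank ℂ (eigenspace (maxOp V S) (-Complex.I)) = 1

/-- `m` is a Herglotz–Nevanlinna function: it is holomorphic off the real line, symmetric with
respect to the real line, and has nonnegative imaginary part on the upper half-plane. -/
structure IsHerglotz (m : ℂ → ℂ) : Prop where
  holomorphic : DifferentiableOn ℂ m {z | z.im ≠ 0}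
  symm : ∀ z : ℂ, z.im ≠ 0 → m (starRingEnd ℂ z) = starRingEnd ℂ (m z)
  im_nonneg : ∀ z : ℂ, 0 < z.im → 0 ≤ (m z).im

/-- `m` takes the value of the Weyl–Titchmarsh coefficient at `l`, on the closed half-line `S` with
endpoint `a` and with the sign `σ`: the function `c + σ m(l) s` is square-integrable on `S`, where
`c`, `s` are the solutions of `𝒜 f = l f` on `S` with `c(a) = s'(a) = 1`, `c'(a) = s(a) = 0`. -/
def IsWeylValue (V : ℝ → ℝ) (S : Set ℝ) (a : ℝ) (σ : ℂ) (l m : ℂ) : Prop :=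
  ∃ c s : ℝ → ℂ, IsSolution V S l c ∧ IsSolution V S l s ∧
    c a = 1 ∧ derivWithin c S a = 0 ∧ s a = 0 ∧ derivWithin s S a = 1 ∧
    SqInt S (fun x => c x + σ * m * s x)

/-- `m` is the Weyl–Titchmarsh coefficient of the half-line `S`, extended from the non-real numbers
to a meromorphic function on `ℂ`. The extension is in normal form, i.e. it has no removable
singularities: it is analytic at every point that is not a pole (at poles it has the value `0`,
which is never used). -/
structure IsWeylCoefficient (V : ℝ → ℝ) (S : Set ℝ) (a : ℝ) (σ : ℂ) (m : ℂ → ℂ) : Prop where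
  meromorphic : MeromorphicNFOn m univ
  weyl : ∀ l : ℂ, l.im ≠ 0 → IsWeylValue V S a σ l (m l)

/-- The Weyl–Titchmarsh coefficient `m₊` of the half-line `[a, ∞)`. -/
def IsWeylPlus (V : ℝ → ℝ) (a : ℝ) (m : ℂ → ℂ) : Prop := IsWeylCoefficient V (Ici a) a 1 m

/-- The Weyl–Titchmarsh coefficient `m₋` of the half-line `(-∞, a]`. -/
def IsWeylMinus (V : ℝ → ℝ) (a : ℝ) (m : ℂ → ℂ) : Prop := IsWeylCoefficient V (Iic a) a (-1) m

/-! ### The two eigenvalue problems and transparency -/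

/-- `(ψ, E)` is a nontrivial solution of `-ψ'' + V ψ = E ψ` on `ℝ` with `ψ ∈ L²(ℝ)`. -/
structure IsLineSolution (V : ℝ → ℝ) (E : ℝ) (ψ : ℝ → ℂ) : Prop where
  sol : IsSolution V univ (E : ℂ) ψ
  sqInt : SqInt univ ψ
  nontrivial : ∃ x, ψ x ≠ 0

/-- `E` is a pole of the meromorphic function `τ`. -/
def IsPole (τ : ℂ → ℂ) (E : ℂ) : Prop := meromorphicOrderAt τ E < 0

/-- `φ` is an eigenfunction, for `E ∈ ℝ`, of `𝒜 φ = E φ` on the open interval `I = (a, b)` with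
`φ'(a) + τ₋(E) φ(a) = 0` and `φ'(b) - τ₊(E) φ(b) = 0`, to be read as Dirichlet conditions at poles
of `τ₋`, `τ₊`. Boundary values are one-sided limits from inside `I`. -/
structure IsEigenfunction (V : ℝ → ℝ) (a b : ℝ) (τm τp : ℂ → ℂ) (E : ℝ) (φ : ℝ → ℂ) :
    Prop where
  sol : IsSolution V (Ioo a b) (E : ℂ) φ
  sqInt : SqInt (Ioo a b) φ
  nontrivial : ∃ x ∈ Ioo a b, φ x ≠ 0
  left : ¬ IsPole τm E →
    Tendsto (fun x => derivWithin φ (Ioo a b) x + τm E * φ x) (𝓝[>] a) (𝓝 0)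
  left_pole : IsPole τm E → Tendsto φ (𝓝[>] a) (𝓝 0)
  right : ¬ IsPole τp E →
    Tendsto (fun x => derivWithin φ (Ioo a b) x - τp E * φ x) (𝓝[<] b) (𝓝 0)
  right_pole : IsPole τp E → Tendsto φ (𝓝[<] b) (𝓝 0)

/-- The boundary conditions given by `τ₋`, `τ₊` are transparent for `𝒜` on `(a, b)`. -/
structure IsTransparent (V : ℝ → ℝ) (a b : ℝ) (τm τp : ℂ → ℂ) : Prop where
  restrict : ∀ (E : ℝ) (ψ : ℝ → ℂ), IsLineSolution V E ψ → IsEigenfunction V a b τm τp E ψ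
  extend : ∀ (E : ℝ) (φ : ℝ → ℂ), IsEigenfunction V a b τm τp E φ →
    ∃ ψ : ℝ → ℂ, IsLineSolution V E ψ ∧ EqOn ψ φ (Ioo a b)
  spectrum_eq : {l : ℂ | ∃ (E : ℝ) (φ : ℝ → ℂ), l = E ∧ IsEigenfunction V a b τm τp E φ} =
    spec (maxOp V univ)

end TBC

end

/-! Everything is drawn from the resolvent R(z) of H, which exists off a discrete set of eigenvalues
and yields the unique L² solution of (𝒜 - z)u = f on ℝ (`HasResolvent`).

R(z) is symmetric for the bilinear form ∫ f g (`HasResolvent.integral_symm`): the defect of symmetry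
is a bounded functional represented by a weak solution of 𝒜y = zy, weak solutions are classical
(`exists_ae_eq_solution_of_weak`), and no nonzero solution lies in L². Hence Wronskians receive no
contribution from infinity (`HasResolvent.green`). So, for each z, any two solutions that are
square-integrable at +∞ are proportional, and Im(u'(b) ū(b)) = Im z ∫_b^∞ |u|². A nonzero one exists
(`HasResolvent.exists_plusSol`), for otherwise every solution would be square-integrable at -∞,
against the same uniqueness there.

For non-real z the solution normalized by u(b) = 1 has u'(b) = m(z), and the identity for imaginary
parts gives the Herglotz property. Locally m = Q/P, where P, Q are Cauchy data at b of R(z)f₀ with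
f₀ vanishing to the right of b (`HasResolvent.exists_data`). These are holomorphic off the spectrum,
and ‖R(z)‖ ≤ 1/|Im z| leaves only poles as singularities (`meromorphicAt_of_abs_im_mul_le`).

For real E and a solution u that is square-integrable at +∞, Green's formula against the normalized
solution at z = E + iε, with Cauchy–Schwarz, gives |u'(b) - m(z)u(b)|² ≤ ε |m(z)| ∫_b^∞ |u|². As ε →
0 this is the boundary condition; divided by |m(z)|² it is the Dirichlet condition at a pole
(`WeylFn.boundary`). Conversely, the condition cuts out a line of Cauchy data, already occupied by
the square-integrable solution (`WeylFn.plusSol_of_boundary`). The left endpoint is the right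
endpoint for V(-x). -/

namespace TBC

/-! ### Primitives of locally integrable functions -/

/-- `F` is an indefinite integral of the locally integrable function `f`. -/
structure IsPrim (F f : ℝ → ℂ) : Prop where
  locInt : LocallyIntegrable f volume
  sub_eq : ∀ x y, F y - F x = ∫ t in x..y, f t

theorem locallyIntegrable_intervalIntegrable {E : Type*} [NormedAddCommGroup E] {f : ℝ → E}
    (hf : LocallyIntegrable f volume) (x y : ℝ) : IntervalIntegrable f volume x y :=
  (hf.integrableOn_isCompact isCompact_uIcc).intervalIntegrable

theorem absolutelyContinuousOnInterval_congr {E : Type*} [PseudoMetricSpace E] {G H : ℝ → E}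
    {a b : ℝ} (hGH : EqOn G H (uIcc a b)) (h : AbsolutelyContinuousOnInterval G a b) :
    AbsolutelyContinuousOnInterval H a b := by
  rw [absolutelyContinuousOnInterval_iff] at h ⊢
  intro ε hε
  obtain ⟨δ, hδ, h⟩ := h ε hε
  refine ⟨δ, hδ, fun E hE hlt => lt_of_eq_of_lt (Finset.sum_congr rfl fun i hi => ?_)
    (h E hE hlt)⟩
  rw [hGH (hE.1 i hi).1, hGH (hE.1 i hi).2]

theorem absolutelyContinuousOnInterval_complex {F : ℝ → ℂ} {a b : ℝ}
    (h1 : AbsolutelyContinuousOnInterval (fun x => (F x).re) a b)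
    (h2 : AbsolutelyContinuousOnInterval (fun x => (F x).im) a b) :
    AbsolutelyContinuousOnInterval F a b := by
  have hc : ∀ c : ℂ, AbsolutelyContinuousOnInterval (fun _ : ℝ => c) a b := fun c =>
    (contDiff_const (n := 1) (c := c)).contDiffOn.absolutelyContinuousOnInterval
  refine absolutelyContinuousOnInterval_congr (fun x _ => ?_)
    ((h1.fun_smul (hc 1)).add (h2.fun_smul (hc Complex.I)))
  simp only [Pi.add_apply, Complex.real_smul, mul_one]
  exact Complex.re_add_im _

theorem absolutelyContinuousOnInterval_intervalIntegral {f : ℝ → ℂ} {a b c : ℝ}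
    (hf : IntervalIntegrable f volume a b) (hc : c ∈ uIcc a b) :
    AbsolutelyContinuousOnInterval (fun x => ∫ t in c..x, f t) a b := by
  have hint : ∀ x ∈ uIcc a b, IntervalIntegrable f volume c x := fun x hx =>
    hf.mono_set (uIcc_subset_uIcc hc hx)
  refine absolutelyContinuousOnInterval_complex ?_ ?_
  · refine absolutelyContinuousOnInterval_congr (fun x hx => ?_)
      (IntervalIntegrable.absolutelyContinuousOnInterval_intervalIntegral
      (f := fun t => (f t).re) ⟨hf.1.re, hf.2.re⟩ hc)
    exact (Complex.reCLM.intervalIntegral_comp_comm (hint x hx))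
  · refine absolutelyContinuousOnInterval_congr (fun x hx => ?_)
      (IntervalIntegrable.absolutelyContinuousOnInterval_intervalIntegral
      (f := fun t => (f t).im) ⟨hf.1.im, hf.2.im⟩ hc)
    exact (Complex.imCLM.intervalIntegral_comp_comm (hint x hx))

/-- Fundamental theorem of calculus for complex-valued absolutely continuous functions. -/
theorem sub_eq_integral_of_absolutelyContinuousOnInterval {F f : ℝ → ℂ} {a b : ℝ}
    (hF : AbsolutelyContinuousOnInterval F a b) (hf : IntervalIntegrable f volume a b)
    (h : ∀ᵐ x, x ∈ uIcc a b → HasDerivAt F (f x) x) : F b - F a = ∫ t in a..b, f t := by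
  have hg := hF.sub (absolutelyContinuousOnInterval_intervalIntegral hf left_mem_uIcc)
  obtain ⟨C, hC⟩ := hg.const_of_ae_hasDerivAt_zero (by
    filter_upwards [h, hf.ae_hasDerivAt_integral] with x hx₁ hx₂ hx₃
    simpa using (hx₁ hx₃).sub (hx₂ hx₃ a (by simp)))
  have h1 := hC a left_mem_uIcc
  have h2 := hC b right_mem_uIcc
  simp only [Pi.sub_apply, intervalIntegral.integral_same, sub_zero] at h1 h2
  rw [h1, ← h2]; ring

theorem intervalIntegrable_deriv_of_absolutelyContinuousOnInterval {F : ℝ → ℂ} {a b : ℝ}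
    (hF : AbsolutelyContinuousOnInterval F a b) :
    IntervalIntegrable (deriv F) volume a b := by
  have hre : AbsolutelyContinuousOnInterval (fun x => (F x).re) a b := by
    rw [absolutelyContinuousOnInterval_iff] at hF ⊢
    intro ε hε
    obtain ⟨δ, hδ, h⟩ := hF ε hε
    refine ⟨δ, hδ, fun E hE hlt => lt_of_le_of_lt (Finset.sum_le_sum fun i hi => ?_) (h E hE hlt)⟩
    rw [dist_eq_norm, dist_eq_norm, ← Complex.sub_re]
    exact Complex.abs_re_le_norm _
  have him : AbsolutelyContinuousOnInterval (fun x => (F x).im) a b := by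
    rw [absolutelyContinuousOnInterval_iff] at hF ⊢
    intro ε hε
    obtain ⟨δ, hδ, h⟩ := hF ε hε
    refine ⟨δ, hδ, fun E hE hlt => lt_of_le_of_lt (Finset.sum_le_sum fun i hi => ?_) (h E hE hlt)⟩
    rw [dist_eq_norm, dist_eq_norm, ← Complex.sub_im]
    exact Complex.abs_im_le_norm _
  have hd : ∀ᵐ x, x ∈ uIcc a b → deriv F x = ((deriv (fun x => (F x).re) x : ℝ) : ℂ) +
      ((deriv (fun x => (F x).im) x : ℝ) : ℂ) * Complex.I := by
    filter_upwards [hF.boundedVariationOn.ae_differentiableAt_of_mem_uIcc] with x hx hxm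
    have h := (hx hxm).hasDerivAt
    have h1 := (Complex.reCLM.hasFDerivAt.comp_hasDerivAt x h).deriv
    have h2 := (Complex.imCLM.hasFDerivAt.comp_hasDerivAt x h).deriv
    simp only [Function.comp_def, Complex.reCLM_apply, Complex.imCLM_apply] at h1 h2
    rw [h1, h2, Complex.re_add_im]
  have hi : IntervalIntegrable (fun x => ((deriv (fun x => (F x).re) x : ℝ) : ℂ) +
      ((deriv (fun x => (F x).im) x : ℝ) : ℂ) * Complex.I) volume a b := by
    have h1 := hre.intervalIntegrable_deriv
    have h2 := him.intervalIntegrable_deriv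
    exact IntervalIntegrable.add ⟨h1.1.ofReal, h1.2.ofReal⟩
      (IntervalIntegrable.mul_const ⟨h2.1.ofReal, h2.2.ofReal⟩ _)
  refine hi.congr_ae ?_
  rw [EventuallyEq, ae_restrict_iff' measurableSet_uIoc]
  filter_upwards [hd] with x hx hxm
  exact (hx (uIoc_subset_uIcc hxm)).symm

namespace IsPrim

variable {F f G g : ℝ → ℂ}

theorem eq_add (h : IsPrim F f) (x y : ℝ) : F y = F x + ∫ t in x..y, f t := by
  rw [← h.sub_eq]; ring

theorem continuous (h : IsPrim F f) : Continuous F := by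
  have : F = fun y => F 0 + ∫ t in (0 : ℝ)..y, f t := funext fun y => h.eq_add 0 y
  rw [this]
  exact continuous_const.add
    (intervalIntegral.continuous_primitive (locallyIntegrable_intervalIntegrable h.locInt) 0)

theorem absolutelyContinuous (h : IsPrim F f) (a b : ℝ) :
    AbsolutelyContinuousOnInterval F a b := by
  have hc : AbsolutelyContinuousOnInterval (fun _ : ℝ => F a) a b :=
    (contDiff_const (n := 1)).contDiffOn.absolutelyContinuousOnInterval
  have h1 := hc.add (absolutelyContinuousOnInterval_intervalIntegral
    (locallyIntegrable_intervalIntegrable h.locInt a b) left_mem_uIcc)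
  exact absolutelyContinuousOnInterval_congr (fun y _ => (h.eq_add a y).symm) h1

theorem ae_hasDerivAt (h : IsPrim F f) : ∀ᵐ x, HasDerivAt F (f x) x := by
  filter_upwards [LocallyIntegrable.ae_hasDerivAt_integral h.locInt] with x hx
  have : F = fun y => F 0 + ∫ t in (0 : ℝ)..y, f t := funext fun y => h.eq_add 0 y
  rw [this]
  exact (hx 0).const_add _

theorem of_absolutelyContinuous (hF : ∀ a b, AbsolutelyContinuousOnInterval F a b)
    (hf : LocallyIntegrable f volume) (h : ∀ᵐ x, HasDerivAt F (f x) x) : IsPrim F f :=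
  ⟨hf, fun x y => sub_eq_integral_of_absolutelyContinuousOnInterval (hF x y)
    (locallyIntegrable_intervalIntegrable hf x y) (h.mono fun _ h _ => h)⟩

theorem congr_ae (h : IsPrim F f) (hfg : f =ᵐ[volume] g) : IsPrim F g where
  locInt := h.locInt.congr hfg
  sub_eq x y := by
    rw [h.sub_eq]
    exact intervalIntegral.integral_congr_ae (hfg.mono fun _ h _ => h)

theorem of_hasDerivAt (h : ∀ x, HasDerivAt F (f x) x) (hf : Continuous f) : IsPrim F f :=
  ⟨hf.locallyIntegrable, fun x y => (intervalIntegral.integral_eq_sub_of_hasDerivAt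
    (fun x _ => h x) (hf.intervalIntegrable x y)).symm⟩

theorem hasDerivAt (h : IsPrim F f) (hf : Continuous f) (x : ℝ) : HasDerivAt F (f x) x := by
  have : F = fun y => F 0 + ∫ t in (0 : ℝ)..y, f t := funext fun y => h.eq_add 0 y
  rw [this]
  exact (intervalIntegral.integral_hasDerivAt_right (hf.intervalIntegrable 0 x)
    hf.stronglyMeasurable.stronglyMeasurableAtFilter hf.continuousAt).const_add _

theorem add (hF : IsPrim F f) (hG : IsPrim G g) : IsPrim (F + G) (f + g) where
  locInt := hF.locInt.add hG.locInt
  sub_eq x y := by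
    have := intervalIntegral.integral_add (locallyIntegrable_intervalIntegrable hF.locInt x y)
      (locallyIntegrable_intervalIntegrable hG.locInt x y)
    simp only [Pi.add_apply]
    rw [this, ← hF.sub_eq, ← hG.sub_eq]; ring

theorem const_smul (c : ℂ) (hF : IsPrim F f) : IsPrim (c • F) (c • f) where
  locInt := hF.locInt.smul c
  sub_eq x y := by
    simp only [Pi.smul_apply, smul_eq_mul]
    rw [intervalIntegral.integral_const_mul, ← hF.sub_eq]; ring

theorem sub (hF : IsPrim F f) (hG : IsPrim G g) : IsPrim (F - G) (f - g) := by
  have h := hF.add (hG.const_smul (-1))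
  simpa [sub_eq_add_neg] using h

theorem mul (hF : IsPrim F f) (hG : IsPrim G g) : IsPrim (F * G) (f * G + F * g) := by
  refine of_absolutelyContinuous
    (fun a b => by simpa using (hF.absolutelyContinuous a b).smul (hG.absolutelyContinuous a b))
    ?_ ?_
  · exact (hF.locInt.mul_continuous hG.continuous).add
      (hG.locInt.continuous_mul hF.continuous)
  · filter_upwards [hF.ae_hasDerivAt, hG.ae_hasDerivAt] with x h1 h2
    exact h1.mul h2

theorem conj (hF : IsPrim F f) :
    IsPrim (fun x => starRingEnd ℂ (F x)) (fun x => starRingEnd ℂ (f x)) where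
  locInt := fun x => by
    obtain ⟨s, hs, h⟩ := hF.locInt x
    exact ⟨s, hs, (Complex.conjCLE.toContinuousLinearMap.integrable_comp h)⟩
  sub_eq x y := by
    rw [← map_sub, hF.sub_eq]
    exact (Complex.conjCLE.toContinuousLinearMap.intervalIntegral_comp_comm
      (locallyIntegrable_intervalIntegrable hF.locInt x y)).symm

theorem comp_neg (hF : IsPrim F f) : IsPrim (fun x => F (-x)) (fun x => -f (-x)) where
  locInt := by
    rw [locallyIntegrable_iff]
    intro k hk
    have h := hF.locInt.integrableOn_isCompact (hk.neg)
    rw [← (Measure.measurePreserving_neg volume).integrableOn_comp_preimage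
      (Homeomorph.neg ℝ).measurableEmbedding] at h
    have h2 := h.neg
    rw [show Neg.neg ⁻¹' (-k) = k from neg_neg k] at h2
    exact h2
  sub_eq x y := by
    rw [hF.sub_eq, intervalIntegral.integral_neg, intervalIntegral.integral_comp_neg,
      intervalIntegral.integral_symm (-y)]

end IsPrim

/-! ### Linear systems `u' = v`, `v' = q u - g` with locally integrable coefficients -/

theorem locallyIntegrable_norm {f : ℝ → ℂ} (hf : LocallyIntegrable f volume) :
    LocallyIntegrable (fun x => ‖f x‖) volume := fun x =>
  let ⟨s, hs, h⟩ := hf x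
  ⟨s, hs, h.norm⟩

/-- The exponential is Lipschitz on the bounded range of the primitive, so the composition is
absolutely continuous and the fundamental theorem applies, although the chain rule is available only
almost everywhere. -/
theorem integral_mul_exp_primitive {k : ℝ → ℝ} (hk : LocallyIntegrable k volume) (c x₀ y : ℝ) :
    ∫ t in x₀..y, c * k t * Real.exp (c * ∫ s in x₀..t, k s) =
      Real.exp (c * ∫ s in x₀..y, k s) - 1 := by
  have hki := locallyIntegrable_intervalIntegrable hk
  have hK := (hki x₀ y).absolutelyContinuousOnInterval_intervalIntegral (c := x₀) left_mem_uIcc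
  obtain ⟨M, hM⟩ := hK.exists_bound
  obtain ⟨C, hC⟩ := ContDiffOn.exists_lipschitzOnWith (f := fun x => Real.exp (c * x)) (n := 1)
    (s := Icc (-M) M) (by fun_prop) one_ne_zero (convex_Icc _ _) isCompact_Icc
  have hE : AbsolutelyContinuousOnInterval (fun x => Real.exp (c * ∫ s in x₀..x, k s)) x₀ y := by
    rw [absolutelyContinuousOnInterval_iff] at hK ⊢
    intro ε hε
    obtain ⟨δ, hδ, h⟩ := hK (ε / (C + 1)) (by positivity)
    refine ⟨δ, hδ, fun E hE' hlt => ?_⟩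
    have h1 := h E hE' hlt
    have hmem : ∀ x ∈ uIcc x₀ y, (∫ s in x₀..x, k s) ∈ Icc (-M) M := fun x hx =>
      abs_le.1 (hM x hx)
    calc _ ≤ ∑ i ∈ Finset.range E.1, (C + 1 : ℝ) *
          dist (∫ s in x₀..(E.2 i).1, k s) (∫ s in x₀..(E.2 i).2, k s) := by
          refine Finset.sum_le_sum fun i hi => ?_
          refine (hC.dist_le_mul _ (hmem _ (hE'.1 i hi).1) _ (hmem _ (hE'.1 i hi).2)).trans ?_
          gcongr
          linarith
      _ < ε := by
          rw [← Finset.mul_sum]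
          rwa [lt_div_iff₀' (by positivity)] at h1
  have h := hE.integral_deriv_eq_sub
  simp only [intervalIntegral.integral_same, mul_zero, Real.exp_zero] at h
  rw [← h]
  refine intervalIntegral.integral_congr_ae ?_
  filter_upwards [LocallyIntegrable.ae_hasDerivAt_integral hk] with x hx _
  rw [((hx x₀).const_mul c).exp.deriv]
  ring

/-- Bielecki's weight: in the sup norm weighted by exp(-2|K|), where K is the primitive of k from
x₀, integration against k has norm at most 1/2. The 2 in the exponent produces the 1/2. To the left
of x₀ the sign of K changes, hence the two cases. -/
theorem abs_integral_mul_exp_le {k : ℝ → ℝ} (hk : LocallyIntegrable k volume) (hk0 : ∀ x, 0 ≤ k x)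
    (x₀ y : ℝ) : |∫ t in x₀..y, k t * Real.exp (2 * |∫ s in x₀..t, k s|)| ≤
      Real.exp (2 * |∫ s in x₀..y, k s|) / 2 := by
  rcases le_total x₀ y with h | h
  · have hK : ∀ t ∈ uIcc x₀ y, |∫ s in x₀..t, k s| = ∫ s in x₀..t, k s := fun t ht => by
      rw [uIcc_of_le h] at ht
      exact abs_of_nonneg (intervalIntegral.integral_nonneg ht.1 fun s _ => hk0 s)
    have h1 := integral_mul_exp_primitive hk 2 x₀ y
    have h2 : ∫ t in x₀..y, 2 * k t * Real.exp (2 * ∫ s in x₀..t, k s) =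
        2 * ∫ t in x₀..y, k t * Real.exp (2 * |∫ s in x₀..t, k s|) := by
      rw [← intervalIntegral.integral_const_mul]
      refine intervalIntegral.integral_congr fun t ht => ?_
      simp only [hK t ht]; ring
    rw [hK y right_mem_uIcc, abs_of_nonneg
      (intervalIntegral.integral_nonneg h fun s _ => mul_nonneg (hk0 s) (Real.exp_pos _).le)]
    linarith
  · have hK : ∀ t ∈ uIcc x₀ y, |∫ s in x₀..t, k s| = -∫ s in x₀..t, k s := fun t ht => by
      rw [uIcc_of_ge h] at ht
      rw [intervalIntegral.integral_symm, abs_neg, neg_neg]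
      exact abs_of_nonneg (intervalIntegral.integral_nonneg ht.2 fun s _ => hk0 s)
    have h1 := integral_mul_exp_primitive hk (-2) x₀ y
    have h2 : ∫ t in x₀..y, (-2) * k t * Real.exp ((-2) * ∫ s in x₀..t, k s) =
        (-2) * ∫ t in x₀..y, k t * Real.exp (2 * |∫ s in x₀..t, k s|) := by
      rw [← intervalIntegral.integral_const_mul]
      refine intervalIntegral.integral_congr fun t ht => ?_
      simp only [hK t ht]; ring_nf
    have h3 : 0 ≤ ∫ t in y..x₀, k t * Real.exp (2 * |∫ s in x₀..t, k s|) :=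
      intervalIntegral.integral_nonneg h fun s _ => mul_nonneg (hk0 s) (Real.exp_pos _).le
    rw [intervalIntegral.integral_symm, abs_neg, abs_of_nonneg h3]
    rw [hK y right_mem_uIcc]
    have h4 : Real.exp (2 * -∫ s in x₀..y, k s) = Real.exp (-2 * ∫ s in x₀..y, k s) := by ring_nf
    have h5 := intervalIntegral.integral_symm (μ := volume) x₀ y
      (f := fun t => k t * Real.exp (2 * |∫ s in x₀..t, k s|))
    rw [h4]
    linarith

theorem norm_integral_le_of_weight {k : ℝ → ℝ} (hk : LocallyIntegrable k volume)
    (hk0 : ∀ x, 0 ≤ k x) {x₀ y M : ℝ} (hM : 0 ≤ M) {f : ℝ → ℂ}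
    (hf : ∀ t ∈ uIoc x₀ y, ‖f t‖ ≤ M * (k t * Real.exp (2 * |∫ s in x₀..t, k s|))) :
    ‖∫ t in x₀..y, f t‖ ≤ M * (Real.exp (2 * |∫ s in x₀..y, k s|) / 2) := by
  have hKc : Continuous fun t => Real.exp (2 * |∫ s in x₀..t, k s|) := by
    have := intervalIntegral.continuous_primitive (locallyIntegrable_intervalIntegrable hk) x₀
    fun_prop
  have hi : IntervalIntegrable (fun t => M * (k t * Real.exp (2 * |∫ s in x₀..t, k s|)))
      volume x₀ y :=
    ((locallyIntegrable_intervalIntegrable hk x₀ y).mul_continuousOn hKc.continuousOn).const_mul _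
  have h1 := intervalIntegral.norm_integral_le_abs_of_norm_le
    (by filter_upwards [ae_restrict_mem measurableSet_uIoc] with t ht using hf t ht) hi
  rw [intervalIntegral.integral_const_mul, abs_mul] at h1
  rw [abs_of_nonneg hM] at h1
  exact h1.trans (mul_le_mul_of_nonneg_left (abs_integral_mul_exp_le hk hk0 x₀ y) hM)

theorem continuous_weight {k : ℝ → ℝ} (hk : LocallyIntegrable k volume) (x₀ : ℝ) :
    Continuous fun t => Real.exp (2 * |∫ s in x₀..t, k s|) := by
  have := intervalIntegral.continuous_primitive (locallyIntegrable_intervalIntegrable hk) x₀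
  fun_prop

/-- In the weighted norm the integral system halves lengths: the maximum M of max(‖d‖, ‖e‖)/w
satisfies M ≤ M/2. -/
theorem system_unique {q : ℝ → ℂ} (hq : LocallyIntegrable q volume) {x₀ y : ℝ} {d e : ℝ → ℂ}
    (hd : ContinuousOn d (uIcc x₀ y)) (he : ContinuousOn e (uIcc x₀ y))
    (h1 : ∀ t ∈ uIcc x₀ y, d t = ∫ s in x₀..t, e s)
    (h2 : ∀ t ∈ uIcc x₀ y, e t = ∫ s in x₀..t, q s * d s) :
    ∀ t ∈ uIcc x₀ y, d t = 0 ∧ e t = 0 := by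
  set k : ℝ → ℝ := fun t => 1 + ‖q t‖ with hkdef
  have hk : LocallyIntegrable k volume := (locallyIntegrable_const 1).add (locallyIntegrable_norm hq)
  have hk0 : ∀ x, 0 ≤ k x := fun x => by positivity
  set w : ℝ → ℝ := fun t => Real.exp (2 * |∫ s in x₀..t, k s|) with hw
  have hwc : Continuous w := continuous_weight hk x₀
  have hw0 : ∀ t, 0 < w t := fun t => Real.exp_pos _
  obtain ⟨t₁, ht₁, hmax⟩ := isCompact_uIcc.exists_isMaxOn (nonempty_uIcc (a := x₀) (b := y))
    (f := fun t => (w t)⁻¹ * max ‖d t‖ ‖e t‖)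
    ((hwc.continuousOn.inv₀ fun t _ => (hw0 t).ne').mul (hd.norm.sup he.norm))
  set M := (w t₁)⁻¹ * max ‖d t₁‖ ‖e t₁‖ with hMdef
  have hM : 0 ≤ M := by positivity
  have hbd : ∀ t ∈ uIcc x₀ y, max ‖d t‖ ‖e t‖ ≤ M * w t := fun t ht => by
    have := hmax ht
    simp only [mem_ofPred_eq] at this
    rw [← hMdef] at this
    rwa [inv_mul_le_iff₀ (hw0 t), mul_comm] at this
  have hsub : uIoc x₀ t₁ ⊆ uIcc x₀ y :=
    uIoc_subset_uIcc.trans (uIcc_subset_uIcc left_mem_uIcc ht₁)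
  have e1 : ‖d t₁‖ ≤ M * (w t₁ / 2) := by
    rw [h1 t₁ ht₁]
    refine norm_integral_le_of_weight hk hk0 hM fun t ht => ?_
    calc ‖e t‖ ≤ M * w t := (le_max_right _ _).trans (hbd t (hsub ht))
      _ ≤ M * (k t * w t) := by
        gcongr
        exact le_mul_of_one_le_left (hw0 t).le (by simp [hkdef])
  have e2 : ‖e t₁‖ ≤ M * (w t₁ / 2) := by
    rw [h2 t₁ ht₁]
    refine norm_integral_le_of_weight hk hk0 hM fun t ht => ?_
    rw [norm_mul]
    calc ‖q t‖ * ‖d t‖ ≤ k t * (M * w t) := by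
          gcongr
          · simp [hkdef]
          · exact (le_max_left _ _).trans (hbd t (hsub ht))
      _ = M * (k t * w t) := by ring
  have e3 : max ‖d t₁‖ ‖e t₁‖ = M * w t₁ := by
    rw [hMdef]; field_simp [(hw0 t₁).ne']
  have e4 : M * w t₁ ≤ M * (w t₁ / 2) := e3 ▸ max_le e1 e2
  have hM0 : M = 0 := by
    by_contra hne
    have := mul_pos (lt_of_le_of_ne hM (Ne.symm hne)) (hw0 t₁)
    linarith
  intro t ht
  have h := hbd t ht
  rw [hM0, zero_mul, max_le_iff] at h
  exact ⟨norm_le_zero_iff.1 h.1, norm_le_zero_iff.1 h.2⟩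

-- Picard's fixed point argument on the whole line at once: after division by the weight w the
-- unknowns are bounded continuous functions and the integral operator is a 1/2-contraction, so no
-- local solutions have to be glued.
open BoundedContinuousFunction in
theorem system_exists {q g : ℝ → ℂ} (hq : LocallyIntegrable q volume)
    (hg : LocallyIntegrable g volume) (x₀ : ℝ) (p r : ℂ) :
    ∃ u v : ℝ → ℂ, Continuous u ∧ Continuous v ∧ (∀ x, u x = p + ∫ t in x₀..x, v t) ∧
      ∀ x, v x = r + ∫ t in x₀..x, (q t * u t - g t) := by
  -- The summand ‖g‖ makes the forcing term dominated by k w as well; the summand 1 serves the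
  -- equation u' = v.
  set k : ℝ → ℝ := fun t => 1 + ‖q t‖ + ‖g t‖ with hkdef
  have hk : LocallyIntegrable k volume := ((locallyIntegrable_const 1).add (locallyIntegrable_norm hq)).add (locallyIntegrable_norm hg)
  have hk0 : ∀ x, 0 ≤ k x := fun x => by positivity
  set w : ℝ → ℝ := fun t => Real.exp (2 * |∫ s in x₀..t, k s|) with hw
  have hwc : Continuous w := continuous_weight hk x₀
  have hw0 : ∀ t, 0 < w t := fun t => Real.exp_pos _
  have hw1 : ∀ t, 1 ≤ w t := fun t => Real.one_le_exp (by positivity)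
  have hk1 : ∀ t, w t ≤ k t * w t := fun t =>
    le_mul_of_one_le_left (hw0 t).le (by simp only [hkdef]; linarith [norm_nonneg (q t), norm_nonneg (g t)])
  have hwC : Continuous fun t => (w t : ℂ) := by fun_prop
  have hcont : ∀ (c : ℂ) {f : ℝ → ℂ}, LocallyIntegrable f volume →
      Continuous fun x => ((w x : ℂ))⁻¹ * (c + ∫ t in x₀..x, f t) := fun c f hf =>
    (hwC.inv₀ fun t => by exact_mod_cast (hw0 t).ne').mul (continuous_const.add
      (intervalIntegral.continuous_primitive (locallyIntegrable_intervalIntegrable hf) x₀))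
  have hbound : ∀ (c : ℂ) {f : ℝ → ℂ} {M : ℝ}, 0 ≤ M → (∀ t, ‖f t‖ ≤ M * (k t * w t)) →
      ∀ x, ‖((w x : ℂ))⁻¹ * (c + ∫ t in x₀..x, f t)‖ ≤ ‖c‖ + M / 2 := by
    intro c f M hM hf x
    rw [norm_mul, norm_inv, Complex.norm_of_nonneg (hw0 x).le, inv_mul_le_iff₀ (hw0 x)]
    have h1 := norm_integral_le_of_weight hk hk0 hM (x₀ := x₀) (y := x) fun t _ => hf t
    calc _ ≤ ‖c‖ + ‖∫ t in x₀..x, f t‖ := norm_add_le _ _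
      _ ≤ w x * ‖c‖ + M * (w x / 2) :=
        add_le_add (le_mul_of_one_le_left (norm_nonneg _) (hw1 x)) h1
      _ = _ := by ring
  have hL1 : ∀ W : ℝ →ᵇ ℂ, LocallyIntegrable (fun t => (w t : ℂ) * W t) volume := fun W =>
    (hwC.mul W.continuous).locallyIntegrable
  have hL2 : ∀ U : ℝ →ᵇ ℂ, LocallyIntegrable (fun t => q t * (w t * U t) - g t) volume := fun U =>
    (hq.mul_continuous (hwC.mul U.continuous)).sub hg
  have hB1 : ∀ (W : ℝ →ᵇ ℂ) t, ‖(w t : ℂ) * W t‖ ≤ ‖W‖ * (k t * w t) := fun W t => by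
    rw [norm_mul, Complex.norm_of_nonneg (hw0 t).le, mul_comm]
    exact mul_le_mul (W.norm_coe_le_norm t) (hk1 t) (hw0 t).le (norm_nonneg _)
  have hB2 : ∀ (U : ℝ →ᵇ ℂ) t, ‖q t * (w t * U t)‖ ≤ ‖U‖ * (‖q t‖ * w t) := fun U t => by
    rw [norm_mul, norm_mul, Complex.norm_of_nonneg (hw0 t).le]
    have := mul_le_mul_of_nonneg_left (U.norm_coe_le_norm t)
      (mul_nonneg (norm_nonneg (q t)) (hw0 t).le)
    linarith
  have hB3 : ∀ (U : ℝ →ᵇ ℂ) t, ‖q t * (w t * U t) - g t‖ ≤ (‖U‖ + 1) * (k t * w t) := fun U t => by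
    have h1 := norm_sub_le (q t * (w t * U t)) (g t)
    have h2 := hB2 U t
    have h3 : ‖g t‖ ≤ ‖g t‖ * w t := le_mul_of_one_le_right (norm_nonneg _) (hw1 t)
    have h4 : 0 ≤ ‖U‖ * ((1 + ‖g t‖) * w t) := by have := hw0 t; positivity
    have h5 : 0 ≤ (1 + ‖q t‖) * w t := by have := hw0 t; positivity
    simp only [hkdef]
    nlinarith
  let T : (ℝ →ᵇ ℂ) × (ℝ →ᵇ ℂ) → (ℝ →ᵇ ℂ) × (ℝ →ᵇ ℂ) := fun P =>
    (ofNormedAddCommGroup _ (hcont p (hL1 P.2)) _ (hbound p (norm_nonneg P.2) (hB1 P.2)),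
      ofNormedAddCommGroup _ (hcont r (hL2 P.1)) _ (hbound r (by positivity) (hB3 P.1)))
  have hT : ContractingWith (1 / 2) T := by
    refine ⟨by rw [← NNReal.coe_lt_coe]; norm_num, LipschitzWith.of_dist_le_mul fun P Q => ?_⟩
    have hPQ : ‖P.1 - Q.1‖ ≤ ‖P - Q‖ ∧ ‖P.2 - Q.2‖ ≤ ‖P - Q‖ :=
      ⟨norm_fst_le (P - Q), norm_snd_le (P - Q)⟩
    rw [Prod.dist_eq]
    refine max_le ?_ ?_
    · refine (dist_le (by positivity)).2 fun x => ?_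
      simp only [T, coe_ofNormedAddCommGroup, dist_eq_norm]
      rw [← mul_sub, add_sub_add_left_eq_sub, ← intervalIntegral.integral_sub
        (locallyIntegrable_intervalIntegrable (hL1 _) _ _)
        (locallyIntegrable_intervalIntegrable (hL1 _) _ _)]
      have := hbound 0 (norm_nonneg (P.2 - Q.2)) (hB1 (P.2 - Q.2)) x
      simp only [zero_add, norm_zero] at this
      have hcg : ∀ t, (w t : ℂ) * P.2 t - w t * Q.2 t = w t * (P.2 - Q.2) t := fun t => by
        simp only [coe_sub, Pi.sub_apply]; ring
      simp only [hcg]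
      refine this.trans ?_
      rw [NNReal.coe_div, NNReal.coe_one, NNReal.coe_ofNat]
      linarith [hPQ.2]
    · refine (dist_le (by positivity)).2 fun x => ?_
      simp only [T, coe_ofNormedAddCommGroup, dist_eq_norm]
      rw [← mul_sub, add_sub_add_left_eq_sub, ← intervalIntegral.integral_sub
        (locallyIntegrable_intervalIntegrable (hL2 _) _ _)
        (locallyIntegrable_intervalIntegrable (hL2 _) _ _)]
      have := hbound 0 (norm_nonneg (P.1 - Q.1)) (f := fun t => q t * (w t * (P.1 - Q.1) t))
        (fun t => (hB2 (P.1 - Q.1) t).trans (by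
          gcongr
          simp only [hkdef]; linarith [norm_nonneg (g t)])) x
      simp only [zero_add, norm_zero] at this
      have hcg : ∀ t, (q t * (w t * P.1 t) - g t - (q t * (w t * Q.1 t) - g t)) =
          q t * (w t * (P.1 - Q.1) t) := fun t => by simp only [coe_sub, Pi.sub_apply]; ring
      simp only [hcg]
      refine this.trans ?_
      rw [NNReal.coe_div, NNReal.coe_one, NNReal.coe_ofNat]
      linarith [hPQ.1]
  obtain ⟨P, hP⟩ : ∃ P, T P = P := ⟨_, hT.fixedPoint_isFixedPt⟩
  have h1 : ∀ x, ((w x : ℂ))⁻¹ * (p + ∫ t in x₀..x, (w t : ℂ) * P.2 t) = P.1 x := fun x =>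
    DFunLike.congr_fun (congrArg Prod.fst hP) x
  have h2 : ∀ x, ((w x : ℂ))⁻¹ * (r + ∫ t in x₀..x, (q t * (w t * P.1 t) - g t)) = P.2 x :=
    fun x => DFunLike.congr_fun (congrArg Prod.snd hP) x
  have hwC0 : ∀ x, (w x : ℂ) ≠ 0 := fun x => by exact_mod_cast (hw0 x).ne'
  refine ⟨fun x => w x * P.1 x, fun x => w x * P.2 x, hwC.mul P.1.continuous,
    hwC.mul P.2.continuous, fun x => ?_, fun x => ?_⟩
  · beta_reduce
    rw [← h1 x, mul_inv_cancel_left₀ (hwC0 x)]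
  · beta_reduce
    rw [← h2 x, mul_inv_cancel_left₀ (hwC0 x)]

/-! ### The equation `𝒜 u = g` on the real line -/

/-- `u` and `u' = v` are locally absolutely continuous on `ℝ`, and `𝒜 u = g`. -/
structure IsRep (V : ℝ → ℝ) (u v g : ℝ → ℂ) : Prop where
  prim : IsPrim u v
  prim_deriv : IsPrim v (fun x => V x * u x - g x)

namespace IsRep

variable {V : ℝ → ℝ} {u v g u₁ v₁ g₁ : ℝ → ℂ}

theorem continuous (h : IsRep V u v g) : Continuous u := h.prim.continuous

theorem continuous_deriv (h : IsRep V u v g) : Continuous v := h.prim_deriv.continuous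

theorem hasDerivAt (h : IsRep V u v g) (x : ℝ) : HasDerivAt u (v x) x :=
  h.prim.hasDerivAt h.continuous_deriv x

theorem congr_ae (h : IsRep V u v g) (hg : g =ᵐ[volume] g₁) : IsRep V u v g₁ :=
  ⟨h.prim, h.prim_deriv.congr_ae (hg.mono fun x hx => by simp only [hx])⟩

theorem add (h : IsRep V u v g) (h₁ : IsRep V u₁ v₁ g₁) :
    IsRep V (u + u₁) (v + v₁) (g + g₁) := by
  refine ⟨h.prim.add h₁.prim, ?_⟩
  convert h.prim_deriv.add h₁.prim_deriv using 1
  ext x; simp only [Pi.add_apply]; ring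

theorem const_smul (c : ℂ) (h : IsRep V u v g) : IsRep V (c • u) (c • v) (c • g) := by
  refine ⟨h.prim.const_smul c, ?_⟩
  convert h.prim_deriv.const_smul c using 1
  ext x; simp only [Pi.smul_apply, smul_eq_mul]; ring

theorem sub (h : IsRep V u v g) (h₁ : IsRep V u₁ v₁ g₁) :
    IsRep V (u - u₁) (v - v₁) (g - g₁) := by
  simpa [sub_eq_add_neg] using h.add (h₁.const_smul (-1))

theorem conj (h : IsRep V u v g) : IsRep V (fun x => starRingEnd ℂ (u x))
    (fun x => starRingEnd ℂ (v x)) (fun x => starRingEnd ℂ (g x)) := by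
  refine ⟨h.prim.conj, ?_⟩
  convert h.prim_deriv.conj using 1
  ext x; simp

theorem comp_neg (h : IsRep V u v g) : IsRep (fun x => V (-x)) (fun x => u (-x))
    (fun x => -v (-x)) (fun x => g (-x)) := by
  refine ⟨h.prim.comp_neg, ?_⟩
  convert h.prim_deriv.comp_neg.const_smul (-1) using 1
  · ext x; simp
  · ext x; simp

/-- Lagrange's identity: the Wronskian of `u` and `u₁` is a primitive of `g u₁ - u g₁`. -/
theorem wronskian (h : IsRep V u v g) (h₁ : IsRep V u₁ v₁ g₁) :
    IsPrim (fun x => u x * v₁ x - v x * u₁ x) (fun x => g x * u₁ x - u x * g₁ x) := by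
  convert (h.prim.mul h₁.prim_deriv).sub (h.prim_deriv.mul h₁.prim) using 1
  all_goals
    ext x; simp only [Pi.sub_apply, Pi.add_apply, Pi.mul_apply]; try ring

/-- Multiplication by a cutoff function. -/
theorem cutoff {χ χ₁ χ₂ : ℝ → ℂ} (h : IsRep V u v g) (h1 : ∀ x, HasDerivAt χ (χ₁ x) x)
    (h2 : ∀ x, HasDerivAt χ₁ (χ₂ x) x) (hc : Continuous χ₂) :
    IsRep V (fun x => χ x * u x) (fun x => χ₁ x * u x + χ x * v x)
      (fun x => χ x * g x - 2 * χ₁ x * v x - χ₂ x * u x) := by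
  have hc1 : Continuous χ₁ := continuous_iff_continuousAt.2 fun x => (h2 x).continuousAt
  have p1 : IsPrim χ χ₁ := IsPrim.of_hasDerivAt h1 hc1
  have p2 : IsPrim χ₁ χ₂ := IsPrim.of_hasDerivAt h2 hc
  refine ⟨p1.mul h.prim, ?_⟩
  convert (p2.mul h.prim).add (p1.mul h.prim_deriv) using 1
  all_goals
    ext x; simp only [Pi.add_apply, Pi.mul_apply]; try ring

end IsRep

variable {V : ℝ → ℝ}

theorem locallyIntegrable_ofReal_sub (hV : LocallyIntegrable V volume) (z : ℂ) :
    LocallyIntegrable (fun x => (V x : ℂ) - z) volume := by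
  have : LocallyIntegrable (fun x => (V x : ℂ)) volume := fun x =>
    let ⟨s, hs, h⟩ := hV x; ⟨s, hs, h.ofReal⟩
  exact this.sub (locallyIntegrable_const z)

theorem exists_isRep (hV : LocallyIntegrable V volume) (z : ℂ) {f : ℝ → ℂ}
    (hf : LocallyIntegrable f volume) (x₀ : ℝ) (p r : ℂ) :
    ∃ u v, IsRep V u v (fun x => z * u x + f x) ∧ u x₀ = p ∧ v x₀ = r := by
  have hq := locallyIntegrable_ofReal_sub hV z
  obtain ⟨u, v, hu, hv, h1, h2⟩ := system_exists hq hf x₀ p r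
  have hi : LocallyIntegrable (fun t => ((V t : ℂ) - z) * u t - f t) volume :=
    (hq.mul_continuous hu).sub hf
  refine ⟨u, v, ⟨⟨hv.locallyIntegrable, fun x y => ?_⟩, ?_⟩, by simp [h1 x₀], by simp [h2 x₀]⟩
  · rw [h1, h1 x, add_sub_add_left_eq_sub, intervalIntegral.integral_interval_sub_left] <;>
      exact hv.intervalIntegrable _ _
  · have : IsPrim v (fun t => ((V t : ℂ) - z) * u t - f t) := by
      refine ⟨hi, fun x y => ?_⟩
      rw [h2, h2 x, add_sub_add_left_eq_sub, intervalIntegral.integral_interval_sub_left] <;>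
        exact locallyIntegrable_intervalIntegrable hi _ _
    convert this using 2
    ring

theorem exists_solution (hV : LocallyIntegrable V volume) (z : ℂ) (x₀ : ℝ) (p r : ℂ) :
    ∃ u v, IsRep V u v (fun x => z * u x) ∧ u x₀ = p ∧ v x₀ = r := by
  simpa using exists_isRep hV z (f := fun _ => 0) (locallyIntegrable_const 0) x₀ p r

/-- The homogeneous equation is required only between x₀ and y, so zero Cauchy data can be
propagated through any region where an inhomogeneity vanishes. -/
theorem IsRep.eq_zero_of_ae (hV : LocallyIntegrable V volume) {z : ℂ} {u v g : ℝ → ℂ}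
    (h : IsRep V u v g) {x₀ y : ℝ} (hu : u x₀ = 0) (hv : v x₀ = 0)
    (hg : ∀ᵐ t, t ∈ uIcc x₀ y → g t = z * u t) : u y = 0 ∧ v y = 0 := by
  refine system_unique (x₀ := x₀) (locallyIntegrable_ofReal_sub hV z) (d := u) (e := v)
    h.continuous.continuousOn h.continuous_deriv.continuousOn (fun t _ => ?_) (fun t ht => ?_) y
    right_mem_uIcc
  · rw [h.prim.eq_add x₀, hu, zero_add]
  · rw [h.prim_deriv.eq_add x₀, hv, zero_add]
    refine intervalIntegral.integral_congr_ae (hg.mono fun s hs hst => ?_)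
    rw [hs (uIcc_subset_uIcc left_mem_uIcc ht (uIoc_subset_uIcc hst))]
    ring

theorem IsRep.eq_zero (hV : LocallyIntegrable V volume) {z : ℂ} {u v : ℝ → ℂ}
    (h : IsRep V u v (fun x => z * u x)) {x₀ : ℝ} (hu : u x₀ = 0) (hv : v x₀ = 0) :
    u = 0 ∧ v = 0 :=
  ⟨funext fun y => (h.eq_zero_of_ae hV (z := z) (y := y) hu hv (by simp)).1,
    funext fun y => (h.eq_zero_of_ae hV (z := z) (y := y) hu hv (by simp)).2⟩

/-- The Wronskian of two solutions for the same spectral parameter is constant. -/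
theorem IsRep.wronskian_const {z : ℂ} {u v u₁ v₁ : ℝ → ℂ} (h : IsRep V u v (fun x => z * u x))
    (h₁ : IsRep V u₁ v₁ (fun x => z * u₁ x)) (x y : ℝ) :
    u x * v₁ x - v x * u₁ x = u y * v₁ y - v y * u₁ y := by
  have := (h.wronskian h₁).sub_eq y x
  rw [sub_eq_iff_eq_add.1 this]
  have h0 : ∀ t, z * u t * u₁ t - u t * (z * u₁ t) = 0 := fun t => by ring
  simp [h0]

/-- A linear combination of solutions. -/
theorem IsRep.lin_comb {z : ℂ} {u v u₁ v₁ : ℝ → ℂ} (h : IsRep V u v (fun x => z * u x))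
    (h₁ : IsRep V u₁ v₁ (fun x => z * u₁ x)) (α β : ℂ) :
    IsRep V (fun x => α * u x + β * u₁ x) (fun x => α * v x + β * v₁ x)
      (fun x => z * (α * u x + β * u₁ x)) := by
  convert (h.const_smul α).add (h₁.const_smul β) using 1
  all_goals
    ext x; simp only [Pi.add_apply, Pi.smul_apply, smul_eq_mul]; try ring

/-- Two solutions with equal Cauchy data coincide. -/
theorem IsRep.unique (hV : LocallyIntegrable V volume) {z : ℂ} {u v u₁ v₁ : ℝ → ℂ}
    (h : IsRep V u v (fun x => z * u x)) (h₁ : IsRep V u₁ v₁ (fun x => z * u₁ x)) {x₀ : ℝ}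
    (hu : u x₀ = u₁ x₀) (hv : v x₀ = v₁ x₀) : u = u₁ ∧ v = v₁ := by
  have h2 := h.lin_comb h₁ 1 (-1)
  obtain ⟨h3, h4⟩ := h2.eq_zero hV (x₀ := x₀) (by simp [hu]) (by simp [hv])
  constructor
  · ext x; have := congrFun h3 x; simp only [Pi.zero_apply] at this; linear_combination this
  · ext x; have := congrFun h4 x; simp only [Pi.zero_apply] at this; linear_combination this

/-! ### Cutoff functions -/

theorem exists_cutoff {α β : ℝ} (hαβ : α < β) : ∃ χ χ₁ χ₂ : ℝ → ℂ,
    (∀ x, HasDerivAt χ (χ₁ x) x) ∧ (∀ x, HasDerivAt χ₁ (χ₂ x) x) ∧ Continuous χ₂ ∧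
    (∀ x ≤ α, χ x = 1) ∧ (∀ x, β ≤ x → χ x = 0) ∧ (∀ x ∉ Icc α β, χ₁ x = 0 ∧ χ₂ x = 0) ∧
    ∀ x, ‖χ x‖ ≤ 1 := by
  set f : ℝ → ℂ := fun x => (Real.smoothTransition ((β - x) / (β - α)) : ℂ) with hf
  have hs : ContDiff ℝ 2 f := by
    have h1 : ContDiff ℝ 2 fun x : ℝ => Real.smoothTransition ((β - x) / (β - α)) :=
      Real.smoothTransition.contDiff.comp (by fun_prop)
    exact Complex.ofRealCLM.contDiff.comp h1
  have hs1 : ContDiff ℝ 1 (deriv f) := by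
    have : ContDiff ℝ (1 + 1) f := by simpa [one_add_one_eq_two] using hs
    exact (contDiff_succ_iff_deriv.1 this).2.2
  have hleft : ∀ x ≤ α, f x = 1 := fun x hx => by
    simp only [hf]
    rw [Real.smoothTransition.one_of_one_le]
    · simp
    · rw [le_div_iff₀ (by linarith)]; linarith
  have hright : ∀ x, β ≤ x → f x = 0 := fun x hx => by
    simp only [hf]
    rw [Real.smoothTransition.zero_of_nonpos]
    · simp
    · exact div_nonpos_of_nonpos_of_nonneg (by linarith) (by linarith)
  have hd1 : ∀ x ∉ Icc α β, deriv f x = 0 := fun x hx => by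
    rcases lt_or_ge x α with h | h
    · have : f =ᶠ[𝓝 x] fun _ => 1 := by
        filter_upwards [Iio_mem_nhds h] with y hy using hleft y (le_of_lt hy)
      rw [this.deriv_eq]; simp
    · have h' : β < x := by by_contra hc; exact hx ⟨h, not_lt.1 hc⟩
      have : f =ᶠ[𝓝 x] fun _ => 0 := by
        filter_upwards [Ioi_mem_nhds h'] with y hy using hright y (le_of_lt hy)
      rw [this.deriv_eq]; simp
  refine ⟨f, deriv f, deriv (deriv f),
    fun x => (hs.differentiable (by norm_num) x).hasDerivAt,
    fun x => (hs1.differentiable (by norm_num) x).hasDerivAt,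
    hs1.continuous_deriv le_rfl, hleft, hright, fun x hx => ⟨hd1 x hx, ?_⟩, fun x => ?_⟩
  · have : deriv f =ᶠ[𝓝 x] fun _ => 0 := by
      filter_upwards [isClosed_Icc.isOpen_compl.mem_nhds hx] with y hy using hd1 y hy
    rw [this.deriv_eq]; simp
  · simp only [hf, Complex.norm_real, Real.norm_eq_abs]
    rw [abs_of_nonneg (Real.smoothTransition.nonneg _)]
    exact Real.smoothTransition.le_one _

/-- A continuous function vanishing outside a compact interval is square-integrable. -/
theorem memLp_of_continuous_of_eq_zero {f : ℝ → ℂ} (hf : Continuous f) {α β : ℝ}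
    (h : ∀ x ∉ Icc α β, f x = 0) : MemLp f 2 volume :=
  hf.memLp_of_hasCompactSupport (HasCompactSupport.intro isCompact_Icc h)

/-! ### Solutions on intervals are restrictions of solutions on the line -/

section Interval

variable {S : Set ℝ} {u v g : ℝ → ℂ}

theorem IsRep.eqOn_derivWithin (h : IsRep V u v g) (hu : UniqueDiffOn ℝ S) :
    EqOn (derivWithin u S) v S := fun x hx =>
  (h.hasDerivAt x).hasDerivWithinAt.derivWithin (hu x hx)

variable [hS : S.OrdConnected]

theorem IsRep.isRegular (h : IsRep V u v g) (hu : UniqueDiffOn ℝ S) : IsRegular S u where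
  differentiableOn := fun x _ => (h.hasDerivAt x).differentiableAt.differentiableWithinAt
  locAC := fun x _ y _ => h.prim.absolutelyContinuous x y
  locAC_deriv := LocAC.congr (fun x _ y _ => h.prim_deriv.absolutelyContinuous x y)
    (h.eqOn_derivWithin hu).symm

theorem IsRep.expr_ae (h : IsRep V u v g) (hu : UniqueDiffOn ℝ S) :
    expr V S u =ᵐ[volume.restrict S] g := by
  filter_upwards [ae_restrict_mem hS.measurableSet,
    ae_restrict_of_ae h.prim_deriv.ae_hasDerivAt] with x hx hd
  rw [expr, derivWithin_congr (h.eqOn_derivWithin hu) (h.eqOn_derivWithin hu hx),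
    hd.hasDerivWithinAt.derivWithin (hu x hx)]
  ring

theorem IsRep.isSolution {z : ℂ} (h : IsRep V u v (fun x => z * u x)) (hu : UniqueDiffOn ℝ S) :
    IsSolution V S z u :=
  ⟨h.isRegular hu, h.expr_ae hu⟩

/-- Endpoints are negligible; only at interior points does `derivWithin` have to be the ordinary
derivative. -/
theorem ae_mem_uIcc_imp {x y : ℝ} {p : ℝ → Prop} (h : ∀ᵐ t, t ∈ Ioo (min x y) (max x y) → p t) :
    ∀ᵐ t, t ∈ uIcc x y → p t := by
  have h1 : ∀ c : ℝ, ∀ᵐ t, t ≠ c := fun c => by simp [ae_iff]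
  filter_upwards [h, h1 (min x y), h1 (max x y)] with t ht h2 h3 h4
  exact ht ⟨lt_of_le_of_ne h4.1 (Ne.symm h2), lt_of_le_of_ne h4.2 h3⟩

theorem mem_nhds_of_mem_Ioo_uIcc {x y t : ℝ} (hx : x ∈ S) (hy : y ∈ S)
    (ht : t ∈ Ioo (min x y) (max x y)) : S ∈ 𝓝 t :=
  mem_of_superset (Icc_mem_nhds ht.1 ht.2) (hS.uIcc_subset hx hy)

theorem IsRegular.sub_eq_integral (h : IsRegular S u) {x y : ℝ} (hx : x ∈ S) (hy : y ∈ S) :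
    u y - u x = ∫ t in x..y, derivWithin u S t := by
  have hsub := hS.uIcc_subset hx hy
  refine sub_eq_integral_of_absolutelyContinuousOnInterval (h.locAC x hx y hy)
    (h.locAC_deriv x hx y hy).continuousOn.intervalIntegrable
    (ae_mem_uIcc_imp (Eventually.of_forall fun t ht => ?_))
  have hn := mem_nhds_of_mem_Ioo_uIcc hx hy ht
  exact (h.differentiableOn t (mem_of_mem_nhds hn)).hasDerivWithinAt.hasDerivAt hn

theorem IsRegular.integrable_and_sub_eq_integral (h : IsRegular S u) {x y : ℝ} (hx : x ∈ S)
    (hy : y ∈ S) (hg : expr V S u =ᵐ[volume.restrict S] g) :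
    IntervalIntegrable (fun t => V t * u t - g t) volume x y ∧
    derivWithin u S y - derivWithin u S x = ∫ t in x..y, (V t * u t - g t) := by
  have hac := h.locAC_deriv x hx y hy
  rw [EventuallyEq, ae_restrict_iff' hS.measurableSet] at hg
  have hd : ∀ᵐ t, t ∈ uIcc x y → HasDerivAt (derivWithin u S) (V t * u t - g t) t := by
    refine ae_mem_uIcc_imp ?_
    filter_upwards [hac.boundedVariationOn.ae_differentiableAt_of_mem_uIcc, hg] with t h1 h2 ht
    have hn := mem_nhds_of_mem_Ioo_uIcc hx hy ht
    have h3 := (h1 ⟨ht.1.le, ht.2.le⟩).hasDerivAt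
    rw [← derivWithin_of_mem_nhds hn] at h3
    have h4 := h2 (mem_of_mem_nhds hn)
    rw [expr] at h4
    rwa [show (V t : ℂ) * u t - g t = derivWithin (derivWithin u S) S t by rw [← h4]; ring]
  have hi : IntervalIntegrable (fun t => V t * u t - g t) volume x y := by
    refine (intervalIntegrable_deriv_of_absolutelyContinuousOnInterval hac).congr_ae ?_
    rw [EventuallyEq, ae_restrict_iff' measurableSet_uIoc]
    exact hd.mono fun t ht htm => (ht (uIoc_subset_uIcc htm)).deriv
  exact ⟨hi, sub_eq_integral_of_absolutelyContinuousOnInterval hac hi hd⟩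

/-- The initial value problem with the Cauchy data of u at x₀ is solved on all of ℝ, and the
difference satisfies the homogeneous integral system on S. This removes one-sided derivatives from
the later arguments: every solution is the restriction of a global one. -/
theorem IsSolution.exists_isRep (hV : LocallyIntegrable V volume) {z : ℂ}
    (h : IsSolution V S z u) {x₀ : ℝ} (hx₀ : x₀ ∈ S) :
    ∃ U W, IsRep V U W (fun x => z * U x) ∧ EqOn u U S ∧ EqOn (derivWithin u S) W S := by
  obtain ⟨U, W, hU, h0, h1⟩ := exists_solution hV z x₀ (u x₀) (derivWithin u S x₀)
  have key : ∀ y ∈ S, u y - U y = 0 ∧ derivWithin u S y - W y = 0 := by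
    intro y hy
    have hsub := hS.uIcc_subset hx₀ hy
    have hc1 := h.regular.differentiableOn.continuousOn.mono hsub
    have hc2 := (h.regular.locAC_deriv x₀ hx₀ y hy).continuousOn
    refine system_unique (locallyIntegrable_ofReal_sub hV z) (x₀ := x₀)
      (d := fun t => u t - U t) (e := fun t => derivWithin u S t - W t)
      (hc1.sub hU.continuous.continuousOn) (hc2.sub hU.continuous_deriv.continuousOn)
      (fun t ht => ?_) (fun t ht => ?_) y right_mem_uIcc
    · have ht' := uIcc_subset_uIcc (left_mem_uIcc (a := x₀) (b := y)) ht
      rw [intervalIntegral.integral_sub ((hc2.mono ht').intervalIntegrable)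
        (hU.continuous_deriv.intervalIntegrable _ _),
        ← h.regular.sub_eq_integral hx₀ (hsub ht), ← hU.prim.sub_eq, h0]
      ring
    · obtain ⟨hi, he⟩ := h.regular.integrable_and_sub_eq_integral hx₀ (hsub ht) h.eqn
      have he2 := hU.prim_deriv.sub_eq x₀ t
      have hi2 := locallyIntegrable_intervalIntegrable hU.prim_deriv.locInt x₀ t
      have : ∀ s, ((V s : ℂ) - z) * (u s - U s) =
          (V s * u s - z * u s) - (V s * U s - z * U s) := fun s => by ring
      simp only [this]
      rw [intervalIntegral.integral_sub hi hi2, ← he, ← he2, h1]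
      ring
  exact ⟨U, W, hU, fun y hy => sub_eq_zero.1 (key y hy).1, fun y hy => sub_eq_zero.1 (key y hy).2⟩

end Interval

theorem IsRegular.isRep {u g : ℝ → ℂ} (h : IsRegular univ u)
    (hg : expr V univ u =ᵐ[volume.restrict univ] g) : IsRep V u (deriv u) g := by
  have hd : derivWithin u univ = deriv u := derivWithin_univ
  refine ⟨⟨?_, fun x y => ?_⟩, ⟨?_, fun x y => ?_⟩⟩
  · refine Continuous.locallyIntegrable (continuous_iff_continuousAt.2 fun x => ?_)
    have h1 := (h.locAC_deriv (x - 1) (mem_univ _) (x + 1) (mem_univ _)).continuousOn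
    rw [hd, uIcc_of_le (by linarith)] at h1
    exact h1.continuousAt (Icc_mem_nhds (by linarith) (by linarith))
  · rw [h.sub_eq_integral (mem_univ x) (mem_univ y), hd]
  · rw [locallyIntegrable_iff]
    intro k hk
    obtain ⟨M, hM⟩ := hk.isBounded.subset_closedBall 0
    have hi := (h.integrable_and_sub_eq_integral (x := -M) (y := M) (mem_univ _) (mem_univ _)
      hg).1
    rcases k.eq_empty_or_nonempty with rfl | ⟨x, hx⟩
    · simp
    · have hM0 : 0 ≤ M := dist_nonneg.trans (hM hx)
      rw [Real.closedBall_eq_Icc, zero_sub, zero_add] at hM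
      exact ((intervalIntegrable_iff_integrableOn_Icc_of_le (by linarith)).1 hi).mono_set hM
  · rw [← (h.integrable_and_sub_eq_integral (mem_univ x) (mem_univ y) hg).2, hd]

theorem IsSolution.isRep_univ {u : ℝ → ℂ} {z : ℂ} (h : IsSolution V univ z u) :
    IsRep V u (deriv u) (fun x => z * u x) :=
  h.regular.isRep h.eqn

/-! ### Weak solutions -/

theorem integral_inner_toLp {μ : Measure ℝ} {f g : ℝ → ℂ} (hf : MemLp f 2 μ) (hg : MemLp g 2 μ) :
    inner ℂ (hf.toLp f) (hg.toLp g) = ∫ x, starRingEnd ℂ (f x) * g x ∂μ := by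
  rw [L2.inner_def]
  refine integral_congr_ae ?_
  filter_upwards [hf.coeFn_toLp, hg.coeFn_toLp] with x h1 h2
  rw [h1, h2, RCLike.inner_apply, mul_comm]

theorem memLp_conj {μ : Measure ℝ} {f : ℝ → ℂ} (hf : MemLp f 2 μ) :
    MemLp (fun x => starRingEnd ℂ (f x)) 2 μ :=
  MemLp.of_le hf (Complex.continuous_conj.comp_aestronglyMeasurable hf.1)
    (Eventually.of_forall fun x => by simp)

theorem memLp_restrict_Icc {f : ℝ → ℂ} (hf : Continuous f) (a b : ℝ) :
    MemLp f 2 (volume.restrict (Icc a b)) := by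
  obtain ⟨C, hC⟩ := isCompact_Icc.exists_bound_of_continuousOn (hf.continuousOn (s := Icc a b))
  refine MemLp.of_bound hf.aestronglyMeasurable C ?_
  filter_upwards [ae_restrict_mem measurableSet_Icc] with x hx using hC x hx

/-- A rep with compactly supported data and zero data at the left end vanishes outside the
support of the right-hand side if the latter is orthogonal to all solutions. -/
theorem IsRep.eq_zero_of_orthogonal (hV : LocallyIntegrable V volume) {z : ℂ} {N : ℝ} (hN : 0 < N)
    {u v f c c' s s' : ℝ → ℂ} (h : IsRep V u v (fun x => z * u x + f x))
    (hf : ∀ x ∉ Icc (-N) N, f x = 0)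
    (hc : IsRep V c c' (fun x => z * c x)) (hs : IsRep V s s' (fun x => z * s x))
    (hW : c N * s' N - c' N * s N = 1) (hu : u (-N) = 0) (hv : v (-N) = 0)
    (hfc : ∫ x in Icc (-N) N, f x * c x = 0) (hfs : ∫ x in Icc (-N) N, f x * s x = 0) :
    ∀ x ∉ Icc (-N) N, u x = 0 := by
  -- By Lagrange's identity on [-N, N] the Wronskian of u and w at N equals ∫ f w = 0. Since c and s
  -- have Wronskian 1, both Cauchy data of u at N vanish.
  have key : ∀ w w' : ℝ → ℂ, IsRep V w w' (fun x => z * w x) →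
      ∫ x in Icc (-N) N, f x * w x = 0 → u N * w' N - v N * w N = 0 := by
    intro w w' hw hfw
    have h1 := (h.wronskian hw).sub_eq (-N) N
    simp only [hu, hv, zero_mul, sub_zero] at h1
    rw [h1, intervalIntegral.integral_of_le (by linarith), ← integral_Icc_eq_integral_Ioc, ← hfw]
    congr 1; ext x; ring
  have k1 := key c c' hc hfc
  have k2 := key s s' hs hfs
  have huN : u N = 0 := by linear_combination (-(u N)) * hW - s N * k1 + c N * k2
  have hvN : v N = 0 := by linear_combination (-(v N)) * hW - s' N * k1 + c' N * k2
  have hne : ∀ a : ℝ, ∀ᵐ t : ℝ, t ≠ a := fun a => by simp [ae_iff]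
  intro x hx
  by_cases hx1 : x < -N
  · refine (h.eq_zero_of_ae hV (z := z) hu hv ?_).1
    filter_upwards [hne (-N)] with t ht htm
    rw [uIcc_of_ge hx1.le] at htm
    rw [hf t fun hm => ht (le_antisymm htm.2 hm.1), add_zero]
  · have hx2 : N < x := by by_contra hc; exact hx ⟨not_lt.1 hx1, not_lt.1 hc⟩
    refine (h.eq_zero_of_ae hV (z := z) huN hvN ?_).1
    filter_upwards [hne N] with t ht htm
    rw [uIcc_of_le hx2.le] at htm
    rw [hf t fun hm => ht (le_antisymm hm.2 htm.1), add_zero]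

/-- A du Bois-Reymond argument. On [-N, N] split G = k + g with k in the span of the solutions c, s
and g orthogonal to it. Then f = ḡ, extended by zero, is the inhomogeneity of a compactly supported
u, so the hypothesis gives ⟨g, G⟩ = 0, that is ‖g‖² = 0. -/
theorem exists_ae_eq_solution_of_weak (hV : LocallyIntegrable V volume) {z : ℂ} {G : ℝ → ℂ}
    (hG : MemLp G 2 volume) (H : ∀ (N : ℝ) (u v f : ℝ → ℂ),
      IsRep V u v (fun x => z * u x + f x) → (∀ x ∉ Icc (-N) N, u x = 0 ∧ f x = 0) →
      MemLp f 2 volume → ∫ x, G x * f x = 0) :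
    ∃ U W, IsRep V U W (fun x => z * U x) ∧ G =ᵐ[volume] U := by
  obtain ⟨c, c', hc, hc0, hc0'⟩ := exists_solution hV z 0 1 0
  obtain ⟨s, s', hs, hs0, hs0'⟩ := exists_solution hV z 0 0 1
  have hW : ∀ x, c x * s' x - c' x * s x = 1 := fun x => by
    rw [hc.wronskian_const hs x 0, hc0, hc0', hs0, hs0']; simp
  have key : ∀ N : ℝ, 0 < N → ∃ α β : ℂ,
      G =ᵐ[volume.restrict (Icc (-N) N)] fun x => α * c x + β * s x := by
    intro N hN
    set μ := volume.restrict (Icc (-N) N) with hμ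
    have mc : MemLp c 2 μ := memLp_restrict_Icc hc.continuous _ _
    have ms : MemLp s 2 μ := memLp_restrict_Icc hs.continuous _ _
    have mG : MemLp G 2 μ := hG.restrict _
    have : FiniteDimensional ℂ (Submodule.span ℂ {mc.toLp c, ms.toLp s}) :=
      FiniteDimensional.span_of_finite ℂ (Set.toFinite _)
    obtain ⟨k, hk, g, hg, hkg⟩ := Submodule.exists_add_mem_mem_orthogonal
      (K := Submodule.span ℂ {mc.toLp c, ms.toLp s}) (mG.toLp G)
    obtain ⟨α, β, rfl⟩ := Submodule.mem_span_pair.1 hk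
    have mg : MemLp g 2 μ := Lp.memLp g
    have hgto : mg.toLp g = g := Lp.toLp_coeFn g mg
    have horth : ∀ (w : ℝ → ℂ) (mw : MemLp w 2 μ),
        mw.toLp w ∈ Submodule.span ℂ {mc.toLp c, ms.toLp s} →
        ∫ x in Icc (-N) N, starRingEnd ℂ (g x) * w x = 0 := by
      intro w mw hw
      rw [← integral_inner_toLp mg mw, hgto]
      exact (Submodule.mem_orthogonal' _ _).1 hg _ hw
    set f : ℝ → ℂ := indicator (Icc (-N) N) fun x => starRingEnd ℂ (g x) with hf
    have mf : MemLp f 2 volume :=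
      (memLp_indicator_iff_restrict measurableSet_Icc).2 (memLp_conj mg)
    have hf0 : ∀ x ∉ Icc (-N) N, f x = 0 := fun x hx => indicator_of_notMem hx _
    have hfI : ∀ w : ℝ → ℂ, ∫ x in Icc (-N) N, f x * w x =
        ∫ x in Icc (-N) N, starRingEnd ℂ (g x) * w x := fun w =>
      setIntegral_congr_fun measurableSet_Icc fun x hx => by
        simp only [hf, indicator_of_mem hx]
    obtain ⟨u, v, huv, hu, hv⟩ := exists_isRep hV z (mf.locallyIntegrable (by norm_num)) (-N) 0 0
    have hu0 := huv.eq_zero_of_orthogonal hV hN hf0 hc hs (hW N) hu hv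
      ((hfI c).trans (horth c mc (Submodule.subset_span (by simp))))
      ((hfI s).trans (horth s ms (Submodule.subset_span (by simp))))
    have h0 := H N u v f huv (fun x hx => ⟨hu0 x hx, hf0 x hx⟩) mf
    have h1 : inner ℂ g (mG.toLp G) = 0 := by
      rw [← hgto, integral_inner_toLp mg mG, ← h0]
      refine (integral_indicator measurableSet_Icc).symm.trans
        (integral_congr_ae (Eventually.of_forall fun x => ?_))
      by_cases hx : x ∈ Icc (-N) N
      · simp [hf, hx, mul_comm]
      · simp [hf, hx]
    have h2 : inner ℂ g (α • mc.toLp c + β • ms.toLp s) = 0 :=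
      (Submodule.mem_orthogonal' _ _).1 hg _ hk
    rw [hkg, inner_add_right, h2, zero_add, inner_self_eq_zero] at h1
    rw [h1, add_zero] at hkg
    refine ⟨α, β, ?_⟩
    have h3 := mG.coeFn_toLp
    rw [hkg] at h3
    refine h3.symm.trans ?_
    filter_upwards [Lp.coeFn_add (α • mc.toLp c) (β • ms.toLp s), Lp.coeFn_smul α (mc.toLp c),
      Lp.coeFn_smul β (ms.toLp s), mc.coeFn_toLp, ms.coeFn_toLp] with x e1 e2 e3 e4 e5
    rw [e1, Pi.add_apply, e2, e3, Pi.smul_apply, Pi.smul_apply, e4, e5, smul_eq_mul, smul_eq_mul]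
  obtain ⟨α, β, h1⟩ := key 1 one_pos
  refine ⟨_, _, hc.lin_comb hs α β, ?_⟩
  have hall : ∀ n : ℕ, ∀ᵐ x, x ∈ Icc (-((n : ℝ) + 1)) ((n : ℝ) + 1) →
      G x = α * c x + β * s x := by
    intro n
    obtain ⟨α', β', h2⟩ := key (n + 1) (by positivity)
    have hsub : Icc (-1 : ℝ) 1 ⊆ Icc (-((n : ℝ) + 1)) ((n : ℝ) + 1) := by
      have : (0 : ℝ) ≤ n := Nat.cast_nonneg n
      exact Icc_subset_Icc (by linarith) (by linarith)
    have h3 : (fun x => α * c x + β * s x) =ᵐ[volume.restrict (Icc (-1 : ℝ) 1)]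
        fun x => α' * c x + β' * s x :=
      h1.symm.trans (ae_restrict_of_ae_restrict_of_subset hsub h2)
    have hA := hc.lin_comb hs α β
    have hB := hc.lin_comb hs α' β'
    have h4 := Measure.eqOn_of_ae_eq h3 hA.continuous.continuousOn hB.continuous.continuousOn
      (by rw [interior_Icc, closure_Ioo (by norm_num)])
    -- The coefficients do not depend on N: the representations agree on [-1, 1], and value and
    -- derivative at 0 determine them.
    have e0 : α = α' := by simpa [hc0, hs0] using h4 (x := 0) (by norm_num)
    have e1 : β = β' := by
      have hev : (fun x => α * c x + β * s x) =ᶠ[𝓝 0] fun x => α' * c x + β' * s x := by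
        filter_upwards [Icc_mem_nhds (a := (-1 : ℝ)) (b := 1) (by norm_num) (by norm_num)]
          with x hx using h4 hx
      have := hev.deriv_eq
      rw [(hA.hasDerivAt 0).deriv, (hB.hasDerivAt 0).deriv] at this
      simpa [hc0', hs0'] using this
    rw [e0, e1]
    rwa [EventuallyEq, ae_restrict_iff' measurableSet_Icc] at h2
  filter_upwards [ae_all_iff.2 hall] with x hx
  obtain ⟨n, hn⟩ := exists_nat_ge |x|
  exact hx n (abs_le.1 (by linarith))

/-! ### The resolvent and symmetry -/

/-- A family of resolvents for `𝒜` on the line, in terms of functions: `ρ` is open with discrete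
complement, consisting of eigenvalues, and for `z ∈ ρ` the function `u = R z f` is the unique
square-integrable solution of `𝒜 u = z u + f`. -/
structure HasResolvent (μ : Measure ℝ) (V : ℝ → ℝ) (ρ : Set ℂ)
    (R : ℂ → Lp ℂ 2 μ →L[ℂ] Lp ℂ 2 μ) : Prop where
  isOpen : IsOpen ρ
  punctured : ∀ z, ∀ᶠ w in 𝓝[≠] z, w ∈ ρ
  diff : DifferentiableOn ℂ R ρ
  solve : ∀ z ∈ ρ, ∀ f, ∃ u v, IsRep V u v (fun x => z * u x + f x) ∧ R z f =ᵐ[μ] u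
  inj : ∀ z ∈ ρ, ∀ u v, IsRep V u v (fun x => z * u x) → MemLp u 2 μ → u = 0
  eig : ∀ z ∉ ρ, ∃ u v, IsRep V u v (fun x => z * u x) ∧ MemLp u 2 μ ∧ u ≠ 0

theorem integrable_mul_of_memLp {μ : Measure ℝ} {f g : ℝ → ℂ} (hf : MemLp f 2 μ)
    (hg : MemLp g 2 μ) : Integrable (fun x => f x * g x) μ :=
  hf.integrable_mul hg

/-- The integral of the derivative of a Wronskian, if one of the functions has compact support. -/
theorem IsRep.integral_wronskian_eq_zero {u v g u₁ v₁ g₁ : ℝ → ℂ} (h : IsRep V u v g)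
    (h₁ : IsRep V u₁ v₁ g₁) {N : ℝ} (hu : ∀ x ∉ Icc (-N) N, u x = 0)
    (hg : ∀ x ∉ Icc (-N) N, g x = 0) : ∫ x, (g x * u₁ x - u x * g₁ x) = 0 := by
  have hv : ∀ x ∉ Icc (-N) N, v x = 0 := fun x hx => by
    have : u =ᶠ[𝓝 x] fun _ => 0 := by
      filter_upwards [isClosed_Icc.isOpen_compl.mem_nhds hx] with y hy using hu y hy
    rw [← (h.hasDerivAt x).deriv, this.deriv_eq]; simp
  set M := |N| + 1
  have hN : N < M := by have := le_abs_self N; simp only [M]; linarith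
  have hM : 0 < M := by positivity
  have hM1 : M ∉ Icc (-N) N := fun hm => by linarith [hm.2]
  have hM2 : -M ∉ Icc (-N) N := fun hm => by linarith [hm.1]
  have h1 := (h.wronskian h₁).sub_eq (-M) M
  simp only [hu _ hM1, hu _ hM2, hv _ hM1, hv _ hM2, zero_mul, sub_zero] at h1
  rw [h1, intervalIntegral.integral_of_le (by linarith)]
  refine (setIntegral_eq_integral_of_forall_compl_eq_zero fun x hx => ?_).symm
  have hx' : x ∉ Icc (-N) N := fun hm => hx ⟨by linarith [hm.1], by linarith [hm.2]⟩
  rw [hu x hx', hg x hx']; ring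

namespace HasResolvent

variable {ρ : Set ℂ} {R : ℂ → Lp ℂ 2 (volume : Measure ℝ) →L[ℂ] Lp ℂ 2 (volume : Measure ℝ)}

theorem eq_of_isRep (h : HasResolvent volume V ρ R) {z : ℂ} (hz : z ∈ ρ)
    {f : Lp ℂ 2 (volume : Measure ℝ)} {u v g : ℝ → ℂ} (hu : IsRep V u v g)
    (hg : g =ᵐ[volume] fun x => z * u x + f x) (hu2 : MemLp u 2 volume) :
    R z f =ᵐ[volume] u := by
  obtain ⟨u₁, v₁, h₁, he⟩ := h.solve z hz f
  have hm : MemLp u₁ 2 volume := (memLp_congr_ae he).1 (Lp.memLp _)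
  have h2 := h.inj z hz (u - u₁) (v - v₁) (((hu.congr_ae hg).sub h₁).congr_ae
    (Eventually.of_forall fun x => by simp only [Pi.sub_apply]; ring)) (hu2.sub hm)
  rw [sub_eq_zero.1 h2]
  exact he

/-- The difference of the two sides, as a functional L of f, is represented by some Y in L². L
vanishes on every f = (𝒜 - z)u with u compactly supported, so the conjugate of Y is a weak solution
of 𝒜y = zy; being in L², it is zero. -/
theorem integral_symm (h : HasResolvent volume V ρ R) (hV : LocallyIntegrable V volume) {z : ℂ}
    (hz : z ∈ ρ) (f g : Lp ℂ 2 (volume : Measure ℝ)) :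
    ∫ x, R z f x * g x = ∫ x, f x * R z g x := by
  have mcg := memLp_conj (Lp.memLp g)
  have mcRg := memLp_conj (Lp.memLp (R z g))
  let L : Lp ℂ 2 (volume : Measure ℝ) →L[ℂ] ℂ :=
    (innerSL ℂ (mcg.toLp _)).comp (R z) - innerSL ℂ (mcRg.toLp _)
  have hL : ∀ f : Lp ℂ 2 (volume : Measure ℝ),
      L f = (∫ x, R z f x * g x) - ∫ x, f x * R z g x := by
    intro f
    simp only [L, sub_apply, ContinuousLinearMap.comp_apply, innerSL_apply_apply]
    congr 1
    · conv_lhs => rw [← Lp.toLp_coeFn (R z f) (Lp.memLp _)]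
      rw [integral_inner_toLp mcg (Lp.memLp _)]
      simp only [Complex.conj_conj, mul_comm]
    · conv_lhs => rw [← Lp.toLp_coeFn f (Lp.memLp _)]
      rw [integral_inner_toLp mcRg (Lp.memLp _)]
      simp only [Complex.conj_conj, mul_comm]
  suffices L = 0 by
    have h0 := hL f
    rw [this, zero_apply] at h0
    exact (sub_eq_zero.1 h0.symm)
  set Y := (InnerProductSpace.toDual ℂ (Lp ℂ 2 (volume : Measure ℝ))).symm L with hY
  have hLY : ∀ f, inner ℂ Y f = L f := fun f => InnerProductSpace.toDual_symm_apply
  have mY := memLp_conj (Lp.memLp Y)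
  -- For compactly supported u uniqueness gives R(z)f = u, and L f is then, up to sign, the integral
  -- of the derivative of a compactly supported Wronskian.
  obtain ⟨U, W, hU, hGU⟩ := exists_ae_eq_solution_of_weak hV (z := z) mY (by
    intro N u v f huv hz0 mf
    have hmu : MemLp u 2 volume :=
      memLp_of_continuous_of_eq_zero huv.continuous fun x hx => (hz0 x hx).1
    have hRf : R z (mf.toLp f) =ᵐ[volume] u := h.eq_of_isRep hz huv (by
      filter_upwards [mf.coeFn_toLp] with x hx
      rw [hx]) hmu
    obtain ⟨w, w', hw, hRw⟩ := h.solve z hz g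
    have e1 := huv.integral_wronskian_eq_zero hw (fun x hx => (hz0 x hx).1)
      (fun x hx => by simp [(hz0 x hx).1, (hz0 x hx).2])
    have e2 : ∫ x, starRingEnd ℂ (Y x) * f x = L (mf.toLp f) := by
      rw [← hLY, ← integral_inner_toLp (Lp.memLp Y) mf, Lp.toLp_coeFn]
    rw [e2, hL, ← integral_sub (integrable_mul_of_memLp (Lp.memLp _) (Lp.memLp _))
      (integrable_mul_of_memLp (Lp.memLp _) (Lp.memLp _)), ← neg_eq_zero, ← integral_neg, ← e1]
    refine integral_congr_ae ?_
    filter_upwards [hRf, mf.coeFn_toLp, hRw] with x h1 h2 h3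
    rw [h1, h2, h3]; ring)
  have hU0 := h.inj z hz U W hU ((memLp_congr_ae hGU).1 mY)
  have hY0 : Y = 0 := by
    refine Lp.ext ?_
    filter_upwards [hGU, Lp.coeFn_zero ℂ 2 (volume : Measure ℝ)] with x h1 h2
    rw [h2]
    simpa [hU0] using h1
  ext f
  rw [← hLY, hY0]; simp

/-- The operator generated by `𝒜` in `L²(ℝ)` is symmetric, in the bilinear form. -/
theorem integral_wronskian_eq_zero (h : HasResolvent volume V ρ R)
    (hV : LocallyIntegrable V volume) {u v g u₁ v₁ g₁ : ℝ → ℂ} (hu : IsRep V u v g)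
    (hu₁ : IsRep V u₁ v₁ g₁) (mu : MemLp u 2 volume) (mg : MemLp g 2 volume)
    (mu₁ : MemLp u₁ 2 volume) (mg₁ : MemLp g₁ 2 volume) :
    ∫ x, (g x * u₁ x - u x * g₁ x) = 0 := by
  -- One point of ρ suffices: u = R(z)f with f = g - zu, and the terms containing z cancel in the
  -- Wronskian expression.
  obtain ⟨z, hz⟩ := (h.punctured 0).exists
  have key : ∀ {u v g : ℝ → ℂ}, IsRep V u v g → MemLp u 2 volume → MemLp g 2 volume →
      ∃ f : Lp ℂ 2 (volume : Measure ℝ), R z f =ᵐ[volume] u ∧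
        f =ᵐ[volume] fun x => g x - z * u x := by
    intro u v g hu mu mg
    have mf : MemLp (fun x => g x - z * u x) 2 volume := mg.sub (mu.const_mul z)
    refine ⟨mf.toLp _, h.eq_of_isRep hz hu ?_ mu, mf.coeFn_toLp⟩
    filter_upwards [mf.coeFn_toLp] with x hx
    rw [hx]; ring
  obtain ⟨f, hf1, hf2⟩ := key hu mu mg
  obtain ⟨f₁, hf3, hf4⟩ := key hu₁ mu₁ mg₁
  have e := h.integral_symm hV hz f f₁
  rw [eq_comm, ← sub_eq_zero, ← integral_sub (integrable_mul_of_memLp (Lp.memLp _) (Lp.memLp _))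
    (integrable_mul_of_memLp (Lp.memLp _) (Lp.memLp _))] at e
  rw [← e]
  refine integral_congr_ae ?_
  filter_upwards [hf1, hf2, hf3, hf4] with x h1 h2 h3 h4
  rw [h1, h2, h3, h4]; ring

end HasResolvent

/-! ### Localization at a half-line and Green's formula -/

theorem memLp_mul_of_bounded {μ : Measure ℝ} {χ f : ℝ → ℂ} (hχ : Continuous χ) {C : ℝ}
    (hC : ∀ x, ‖χ x‖ ≤ C) (hf : MemLp f 2 μ) : MemLp (fun x => χ x * f x) 2 μ :=
  MemLp.of_le_mul hf (hχ.aestronglyMeasurable.mul hf.1) (c := C) (Eventually.of_forall fun x => by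
    rw [norm_mul]; exact mul_le_mul_of_nonneg_right (hC x) (norm_nonneg _))

/-- Cutting off a function at the left, without changing it to the right of `b`. -/
theorem IsRep.exists_cutoff_left {u v g : ℝ → ℂ} (h : IsRep V u v g) {c b : ℝ} (hcb : c < b)
    (mu : MemLp u 2 (volume.restrict (Ici c))) (mg : MemLp g 2 (volume.restrict (Ici c))) :
    ∃ u₁ v₁ g₁, IsRep V u₁ v₁ g₁ ∧ MemLp u₁ 2 volume ∧ MemLp g₁ 2 volume ∧
      (∀ x, b ≤ x → u₁ x = u x ∧ v₁ x = v x ∧ g₁ x = g x) ∧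
      ∀ x, x < c → u₁ x = 0 ∧ v₁ x = 0 ∧ g₁ x = 0 := by
  obtain ⟨χ, χ₁, χ₂, h1, h2, hc2, hl, hr, h0, hb⟩ := exists_cutoff (α := c) (β := (c + b) / 2)
    (by linarith)
  have hcχ : Continuous χ := continuous_iff_continuousAt.2 fun x => (h1 x).continuousAt
  have hcχ₁ : Continuous χ₁ := continuous_iff_continuousAt.2 fun x => (h2 x).continuousAt
  have hcut := h.cutoff (χ := fun x => 1 - χ x) (χ₁ := fun x => -χ₁ x) (χ₂ := fun x => -χ₂ x)
    (fun x => (h1 x).const_sub 1) (fun x => (h2 x).neg) hc2.neg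
  have hbd : ∀ x, ‖1 - χ x‖ ≤ 2 := fun x => (norm_sub_le _ _).trans (by
    rw [norm_one]; linarith [hb x])
  have hmem : ∀ {f : ℝ → ℂ}, MemLp f 2 (volume.restrict (Ici c)) →
      MemLp (fun x => (1 - χ x) * f x) 2 volume := by
    intro f hf
    have h3 := memLp_mul_of_bounded (continuous_const.sub hcχ) hbd
      ((memLp_indicator_iff_restrict (measurableSet_Ici (a := c))).2 hf)
    refine (memLp_congr_ae (Eventually.of_forall fun x => ?_)).1 h3
    by_cases hx : x ∈ Ici c
    · simp [hx]
    · simp [hx, hl x (not_le.1 hx).le]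
  refine ⟨_, _, _, hcut, hmem mu, ?_, fun x hx => ?_, fun x hx => ?_⟩
  · have m1 : MemLp (fun x => 2 * χ₁ x * v x + χ₂ x * u x) 2 volume :=
      memLp_of_continuous_of_eq_zero (α := c) (β := (c + b) / 2)
        (by have := h.continuous; have := h.continuous_deriv; fun_prop)
        fun x hx => by rw [(h0 x hx).1, (h0 x hx).2]; ring
    refine (memLp_congr_ae (Eventually.of_forall fun x => ?_)).1 ((hmem mg).add m1)
    simp only [Pi.add_apply]; ring
  · have e1 := hr x (by linarith)
    have e2 := h0 x fun hm => by linarith [hm.2]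
    simp [e1, e2.1, e2.2]
  · have e1 := hl x hx.le
    have e2 := h0 x fun hm => by linarith [hm.1]
    simp [e1, e2.1, e2.2]

/-- Green's formula on a half-line, without boundary term at infinity. -/
theorem HasResolvent.green {ρ : Set ℂ}
    {R : ℂ → Lp ℂ 2 (volume : Measure ℝ) →L[ℂ] Lp ℂ 2 (volume : Measure ℝ)}
    (h : HasResolvent volume V ρ R) (hV : LocallyIntegrable V volume)
    {u v g u₁ v₁ g₁ : ℝ → ℂ} (hu : IsRep V u v g) (hu₁ : IsRep V u₁ v₁ g₁) {c b : ℝ} (hcb : c < b)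
    (mu : MemLp u 2 (volume.restrict (Ici c))) (mg : MemLp g 2 (volume.restrict (Ici c)))
    (mu₁ : MemLp u₁ 2 (volume.restrict (Ici c))) (mg₁ : MemLp g₁ 2 (volume.restrict (Ici c))) :
    v b * u₁ b - u b * v₁ b = ∫ x in Ioi b, (g x * u₁ x - u x * g₁ x) := by
  obtain ⟨p, p', q, hp, mp, mq, e1, e2⟩ := hu.exists_cutoff_left hcb mu mg
  obtain ⟨p₁, p₁', q₁, hp₁, mp₁, mq₁, e3, e4⟩ := hu₁.exists_cutoff_left hcb mu₁ mg₁
  -- The cut-off functions are globally in L² together with their images under 𝒜, so the integral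
  -- over ℝ is zero. Its part to the left of b is the increment of the Wronskian from c - 1, where
  -- it vanishes, to b.
  have h0 := h.integral_wronskian_eq_zero hV hp hp₁ mp mq mp₁ mq₁
  have hi : Integrable (fun x => q x * p₁ x - p x * q₁ x) volume :=
    (integrable_mul_of_memLp mq mp₁).sub (integrable_mul_of_memLp mp mq₁)
  rw [← intervalIntegral.integral_Iic_add_Ioi (b := b) hi.integrableOn hi.integrableOn] at h0
  have h1 : ∫ x in Iic b, (q x * p₁ x - p x * q₁ x) = u b * v₁ b - v b * u₁ b := by
    have h2 := (hp.wronskian hp₁).sub_eq (c - 1) b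
    have h3 := e2 (c - 1) (by linarith)
    rw [h3.1, h3.2.1, (e1 b le_rfl).1, (e1 b le_rfl).2.1, (e3 b le_rfl).1, (e3 b le_rfl).2.1,
      intervalIntegral.integral_of_le (by linarith)] at h2
    rw [setIntegral_eq_of_subset_of_forall_sdiff_eq_zero measurableSet_Iic
      (Ioc_subset_Iic_self (a := c - 1)) fun x hx => ?_, ← h2]
    · ring
    · have hxc : x < c := by
        by_contra hc
        exact hx.2 ⟨by linarith, hx.1⟩
      rw [(e2 x hxc).1, (e2 x hxc).2.2]; ring
  have h4 : ∫ x in Ioi b, (q x * p₁ x - p x * q₁ x) = ∫ x in Ioi b, (g x * u₁ x - u x * g₁ x) :=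
    setIntegral_congr_fun measurableSet_Ioi fun x hx => by
      simp only [(e1 x (le_of_lt hx)).1, (e1 x (le_of_lt hx)).2.2, (e3 x (le_of_lt hx)).1,
        (e3 x (le_of_lt hx)).2.2]
  rw [h1, h4] at h0
  linear_combination -h0

/-! ### Solutions that are square-integrable at `+∞` -/

/-- `u` is a solution of `𝒜 u = z u` on `ℝ` with `u' = v`, square-integrable at `+∞`. -/
structure PlusSol (V : ℝ → ℝ) (z : ℂ) (u v : ℝ → ℂ) : Prop where
  isRep : IsRep V u v (fun x => z * u x)
  memLp : ∀ c, MemLp u 2 (volume.restrict (Ici c))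

theorem memLp_restrict_Ici {u : ℝ → ℂ} (hu : Continuous u) {b : ℝ}
    (h : MemLp u 2 (volume.restrict (Ici b))) (c : ℝ) : MemLp u 2 (volume.restrict (Ici c)) := by
  have h1 := (memLp_indicator_iff_restrict measurableSet_Icc).2 (memLp_restrict_Icc hu c b)
  have h2 := (memLp_indicator_iff_restrict measurableSet_Ici).2 h
  refine MemLp.of_le (((h1.norm.add h2.norm)).restrict (Ici c)) hu.aestronglyMeasurable ?_
  filter_upwards [ae_restrict_mem measurableSet_Ici] with x hx
  simp only [Pi.add_apply, Real.norm_eq_abs]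
  rw [abs_of_nonneg (by positivity)]
  by_cases hxb : b ≤ x
  · rw [indicator_of_mem (s := Ici b) hxb]
    linarith [norm_nonneg ((Icc c b).indicator u x)]
  · rw [indicator_of_mem (s := Icc c b) ⟨hx, (not_le.1 hxb).le⟩]
    linarith [norm_nonneg ((Ici b).indicator u x)]

theorem IsRep.plusSol {z : ℂ} {u v : ℝ → ℂ} (h : IsRep V u v (fun x => z * u x)) {b : ℝ}
    (hm : MemLp u 2 (volume.restrict (Ici b))) : PlusSol V z u v :=
  ⟨h, memLp_restrict_Ici h.continuous hm⟩

theorem PlusSol.conj {z : ℂ} {u v : ℝ → ℂ} (h : PlusSol V z u v) :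
    PlusSol V (starRingEnd ℂ z) (fun x => starRingEnd ℂ (u x)) (fun x => starRingEnd ℂ (v x)) := by
  refine ⟨?_, fun c => memLp_conj (h.memLp c)⟩
  convert h.isRep.conj using 2
  simp

theorem PlusSol.const_smul {z : ℂ} {u v : ℝ → ℂ} (c : ℂ) (h : PlusSol V z u v) :
    PlusSol V z (c • u) (c • v) := by
  refine ⟨?_, fun d => (h.memLp d).const_smul c⟩
  convert h.isRep.const_smul c using 1
  ext x; simp only [Pi.smul_apply, smul_eq_mul]; ring

theorem PlusSol.integrable_sq {z : ℂ} {u v : ℝ → ℂ} (h : PlusSol V z u v) (b : ℝ) :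
    IntegrableOn (fun x => ‖u x‖ ^ 2) (Ioi b) :=
  ((h.memLp b).integrable_norm_pow (by norm_num)).mono_measure
    (Measure.restrict_mono Ioi_subset_Ici_self le_rfl)

/-- A nonzero solution has nonzero Cauchy data. -/
theorem IsRep.data_ne_zero (hV : LocallyIntegrable V volume) {z : ℂ} {u v : ℝ → ℂ}
    (h : IsRep V u v (fun x => z * u x)) (hu : u ≠ 0) (b : ℝ) : u b ≠ 0 ∨ v b ≠ 0 := by
  by_contra! hc
  exact hu (h.eq_zero hV hc.1 hc.2).1

theorem locallyIntegrable_comp_neg (hV : LocallyIntegrable V volume) :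
    LocallyIntegrable (fun x => V (-x)) volume := by
  rw [locallyIntegrable_iff]
  intro k hk
  have h1 := hV.integrableOn_isCompact (hk.neg)
  rw [← (Measure.measurePreserving_neg volume).integrableOn_comp_preimage
    (Homeomorph.neg ℝ).measurableEmbedding] at h1
  rw [show Neg.neg ⁻¹' (-k) = k from neg_neg k] at h1
  exact h1

namespace HasResolvent

variable {ρ : Set ℂ} {R : ℂ → Lp ℂ 2 (volume : Measure ℝ) →L[ℂ] Lp ℂ 2 (volume : Measure ℝ)}

theorem green_plusSol (h : HasResolvent volume V ρ R) (hV : LocallyIntegrable V volume)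
    {z z₁ : ℂ} {u v u₁ v₁ : ℝ → ℂ} (hu : PlusSol V z u v) (hu₁ : PlusSol V z₁ u₁ v₁) (b : ℝ) :
    v b * u₁ b - u b * v₁ b = (z - z₁) * ∫ x in Ioi b, u x * u₁ x := by
  rw [h.green hV hu.isRep hu₁.isRep (c := b - 1) (by linarith) (hu.memLp _)
    ((hu.memLp _).const_mul z) (hu₁.memLp _) ((hu₁.memLp _).const_mul z₁),
    ← integral_const_mul]
  congr 1; ext x; ring

/-- Two solutions for the same parameter that are square-integrable at `+∞` are proportional. -/
theorem plusSol_unique (h : HasResolvent volume V ρ R) (hV : LocallyIntegrable V volume)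
    {z : ℂ} {u v u₁ v₁ : ℝ → ℂ} (hu : PlusSol V z u v) (hu₁ : PlusSol V z u₁ v₁) (b : ℝ) :
    v b * u₁ b = u b * v₁ b := by
  have := h.green_plusSol hV hu hu₁ b
  rw [sub_self, zero_mul] at this
  exact sub_eq_zero.1 this

/-- Green's formula for u and ū; the latter solves the equation for z̄ because V is real. This
yields both u(b) ≠ 0 for non-real z and the sign of Im m. -/
theorem im_data (h : HasResolvent volume V ρ R) (hV : LocallyIntegrable V volume)
    {z : ℂ} {u v : ℝ → ℂ} (hu : PlusSol V z u v) (b : ℝ) :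
    (v b * starRingEnd ℂ (u b)).im = z.im * ∫ x in Ioi b, ‖u x‖ ^ 2 := by
  have h1 := h.green_plusSol hV hu hu.conj b
  have h2 : ∀ x, u x * starRingEnd ℂ (u x) = ((‖u x‖ ^ 2 : ℝ) : ℂ) := fun x => by
    rw [Complex.mul_conj, Complex.normSq_eq_norm_sq]
  simp only [h2] at h1
  rw [integral_complex_ofReal] at h1
  have h3 := congrArg Complex.im h1
  simp only [Complex.sub_im, Complex.mul_im, Complex.conj_re, Complex.conj_im, Complex.sub_re,
    Complex.ofReal_re, Complex.ofReal_im] at h3 ⊢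
  linarith

/-- If u(b) = 0, then `im_data` forces ∫_b^∞ |u|² = 0, so u vanishes on (b, ∞) and therefore
everywhere. -/
theorem plusSol_data_ne_zero (h : HasResolvent volume V ρ R) (hV : LocallyIntegrable V volume)
    {z : ℂ} (hz : z.im ≠ 0) {u v : ℝ → ℂ} (hu : PlusSol V z u v) (h0 : u ≠ 0) (b : ℝ) :
    u b ≠ 0 := by
  intro hb
  have h1 := h.im_data hV hu b
  rw [hb, map_zero, mul_zero, Complex.zero_im, eq_comm, mul_eq_zero, or_iff_right hz,
    setIntegral_eq_zero_iff_of_nonneg_ae (Eventually.of_forall fun x => by positivity)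
      (hu.integrable_sq b)] at h1
  have h2 : EqOn u (fun _ => 0) (Ioi b) := by
    refine Measure.eqOn_of_ae_eq (μ := volume) ?_ hu.isRep.continuous.continuousOn continuousOn_const
      (by rw [interior_Ioi]; exact subset_closure)
    filter_upwards [h1] with x hx
    simpa using hx
  have hv : v (b + 1) = 0 := by
    have : u =ᶠ[𝓝 (b + 1)] fun _ => 0 := by
      filter_upwards [Ioi_mem_nhds (show b < b + 1 by linarith)] with x hx using h2 hx
    rw [← (hu.isRep.hasDerivAt _).deriv, this.deriv_eq]; simp
  exact h0 (hu.isRep.eq_zero hV (h2 (show b < b + 1 by linarith)) hv).1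

/-! ### Reflection -/

/-- R is conjugated with the reflection x ↦ -x, which leaves ρ unchanged. Statements at -∞ thereby
reduce to statements at +∞. -/
theorem comp_neg (h : HasResolvent volume V ρ R) :
    ∃ R', HasResolvent volume (fun x => V (-x)) ρ R' := by
  have hmp := Measure.measurePreserving_neg (volume : Measure ℝ)
  let J : Lp ℂ 2 (volume : Measure ℝ) →L[ℂ] Lp ℂ 2 (volume : Measure ℝ) :=
    (Lp.compMeasurePreservingₗᵢ ℂ Neg.neg hmp).toContinuousLinearMap
  have hJ : ∀ f, J f =ᵐ[volume] fun x => f (-x) := fun f => Lp.coeFn_compMeasurePreserving f hmp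
  have hcomp : ∀ {f g : ℝ → ℂ}, f =ᵐ[volume] g → (fun x => f (-x)) =ᵐ[volume] fun x => g (-x) :=
    fun hfg => hmp.quasiMeasurePreserving.ae_eq_comp hfg
  have hmem : ∀ {f : ℝ → ℂ}, MemLp f 2 volume → MemLp (fun x => f (-x)) 2 volume :=
    fun hf => hf.comp_measurePreserving hmp
  refine ⟨fun z => J ∘L R z ∘L J, h.isOpen, h.punctured, ?_, fun z hz f => ?_,
    fun z hz u v hu hm => ?_, fun z hz => ?_⟩
  · exact (differentiableOn_const J).clm_comp (h.diff.clm_comp (differentiableOn_const J))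
  · obtain ⟨u, v, hu, he⟩ := h.solve z hz (J f)
    refine ⟨_, _, hu.comp_neg.congr_ae ?_, (hJ _).trans (hcomp he)⟩
    filter_upwards [hcomp (hJ f)] with x hx
    rw [hx, neg_neg]
  · have h1 := hu.comp_neg
    simp only [neg_neg] at h1
    have h2 := h.inj z hz _ _ h1 (hmem hm)
    ext x
    simpa using congrFun h2 (-x)
  · obtain ⟨u, v, hu, hm, h0⟩ := h.eig z hz
    refine ⟨_, _, hu.comp_neg, hmem hm, fun hc => h0 ?_⟩
    ext x
    simpa using congrFun hc (-x)

/-! ### Existence of square-integrable solutions -/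

/-- At a point of the spectrum an eigenfunction serves. For z in ρ, if no nonzero solution were
square-integrable at +∞, all solutions would be square-integrable at -∞, contradicting
`plusSol_unique` for the reflected potential, since two solutions with Wronskian 1 exist. -/
theorem exists_plusSol (h : HasResolvent volume V ρ R) (hV : LocallyIntegrable V volume) (z : ℂ) :
    ∃ u v, PlusSol V z u v ∧ u ≠ 0 := by
  by_cases hz : z ∈ ρ
  swap
  · obtain ⟨u, v, hu, hm, h0⟩ := h.eig z hz
    exact ⟨u, v, ⟨hu, fun c => hm.restrict _⟩, h0⟩
  by_contra! hno
  obtain ⟨R', h'⟩ := h.comp_neg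
  have hV' := locallyIntegrable_comp_neg hV
  obtain ⟨χ, χ₁, χ₂, d1, d2, hc2, hl, hr, hχ0, hb⟩ := exists_cutoff (α := 0) (β := 1) one_pos
  have hcχ : Continuous χ := continuous_iff_continuousAt.2 fun x => (d1 x).continuousAt
  have hcχ₁ : Continuous χ₁ := continuous_iff_continuousAt.2 fun x => (d2 x).continuousAt
  -- With f = (𝒜 - z)(χθ), compactly supported, R(z)f - χθ is a solution that is square-integrable
  -- at +∞, hence zero by assumption. So θ coincides with R(z)f on the left half-line, where χ = 1.
  have key : ∀ θ θ' : ℝ → ℂ, IsRep V θ θ' (fun x => z * θ x) →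
      PlusSol (fun x => V (-x)) z (fun x => θ (-x)) (fun x => -θ' (-x)) := by
    intro θ θ' hθ
    have mf : MemLp (fun x => -2 * χ₁ x * θ' x - χ₂ x * θ x) 2 volume :=
      memLp_of_continuous_of_eq_zero (α := 0) (β := 1)
        (by have := hθ.continuous; have := hθ.continuous_deriv; fun_prop)
        fun x hx => by rw [(hχ0 x hx).1, (hχ0 x hx).2]; ring
    obtain ⟨u, v, hu, he⟩ := h.solve z hz (mf.toLp _)
    have hm : MemLp u 2 volume := (memLp_congr_ae he).1 (Lp.memLp _)
    have hy : IsRep V (u - fun x => χ x * θ x) (v - fun x => χ₁ x * θ x + χ x * θ' x)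
        (fun x => z * (u - fun x => χ x * θ x) x) := by
      refine (hu.sub (hθ.cutoff d1 d2 hc2)).congr_ae ?_
      filter_upwards [mf.coeFn_toLp] with x hx
      simp only [Pi.sub_apply, hx]; ring
    have h0 := hno _ _ (hy.plusSol (b := 1) (by
      refine (memLp_congr_ae ?_).1 (hm.restrict (Ici 1))
      filter_upwards [ae_restrict_mem measurableSet_Ici] with x hx
      simp [hr x hx]))
    refine hθ.comp_neg.plusSol (b := 0) ?_
    refine (memLp_congr_ae ?_).1 ((hm.comp_measurePreserving
      (Measure.measurePreserving_neg (volume : Measure ℝ))).restrict (Ici 0))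
    filter_upwards [ae_restrict_mem measurableSet_Ici] with x hx
    have h1 := congrFun h0 (-x)
    have hx' : -x ≤ 0 := neg_nonpos.2 hx
    simp only [Pi.sub_apply, hl (-x) hx', one_mul, Pi.zero_apply] at h1
    exact sub_eq_zero.1 h1
  obtain ⟨c, c', hc, hc0, hc0'⟩ := exists_solution hV z 0 1 0
  obtain ⟨s, s', hs, hs0, hs0'⟩ := exists_solution hV z 0 0 1
  have := h'.plusSol_unique hV' (key c c' hc) (key s s' hs) 0
  simp [hc0, hc0', hs0, hs0'] at this

/-! ### Real spectrum and the resolvent bound -/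

/-- Symmetry applied to u and ū gives (z - z̄) ∫ |u|² = 0. -/
theorem isRep_L2_eq_zero (h : HasResolvent volume V ρ R) (hV : LocallyIntegrable V volume)
    {z : ℂ} (hz : z.im ≠ 0) {u v : ℝ → ℂ} (hu : IsRep V u v (fun x => z * u x))
    (hm : MemLp u 2 volume) : u = 0 := by
  have h1 := h.integral_wronskian_eq_zero hV hu hu.conj hm (hm.const_mul z) (memLp_conj hm)
    (memLp_conj (hm.const_mul z))
  have h2 : ∀ x, z * u x * starRingEnd ℂ (u x) - u x * starRingEnd ℂ (z * u x) =
      (z - starRingEnd ℂ z) * ((‖u x‖ ^ 2 : ℝ) : ℂ) := fun x => by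
    rw [← Complex.normSq_eq_norm_sq, ← Complex.mul_conj, map_mul]; ring
  simp only [h2] at h1
  have hz' : z - starRingEnd ℂ z ≠ 0 := fun hc => hz (by
    have := congrArg Complex.im hc
    simp only [Complex.sub_im, Complex.conj_im, Complex.zero_im] at this
    linarith)
  rw [integral_const_mul, mul_eq_zero, or_iff_right hz', integral_complex_ofReal,
    Complex.ofReal_eq_zero, integral_eq_zero_iff_of_nonneg (fun x => by positivity)
      (hm.integrable_norm_pow (by norm_num))] at h1
  refine (Continuous.ae_eq_iff_eq volume hu.continuous (g := 0) continuous_const).1 ?_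
  filter_upwards [h1] with x hx
  simpa using hx

theorem mem_of_im_ne_zero (h : HasResolvent volume V ρ R) (hV : LocallyIntegrable V volume)
    {z : ℂ} (hz : z.im ≠ 0) : z ∈ ρ := by
  by_contra hc
  obtain ⟨u, v, hu, hm, h0⟩ := h.eig z hc
  exact h0 (h.isRep_L2_eq_zero hV hz hu hm)

/-- Symmetry applied to u = R(z)f and ū gives Im z ‖u‖² = -Im⟨u, f⟩, and Cauchy–Schwarz finishes. -/
theorem abs_im_mul_norm_le (h : HasResolvent volume V ρ R) (hV : LocallyIntegrable V volume)
    {z : ℂ} (hz : z ∈ ρ) (f : Lp ℂ 2 (volume : Measure ℝ)) : |z.im| * ‖R z f‖ ≤ ‖f‖ := by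
  obtain ⟨u, v, hu, he⟩ := h.solve z hz f
  have hm : MemLp u 2 volume := (memLp_congr_ae he).1 (Lp.memLp _)
  have mg : MemLp (fun x => z * u x + f x) 2 volume := (hm.const_mul z).add (Lp.memLp f)
  have h1 := h.integral_wronskian_eq_zero hV hu hu.conj hm mg (memLp_conj hm) (memLp_conj mg)
  have h2 : ∫ x, starRingEnd ℂ (u x) * u x = inner ℂ (R z f) (R z f) := by
    rw [L2.inner_def]
    refine integral_congr_ae ?_
    filter_upwards [he] with x hx
    rw [hx, RCLike.inner_apply, mul_comm]
  have h3 : ∫ x, starRingEnd ℂ (u x) * f x = inner ℂ (R z f) f := by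
    rw [L2.inner_def]
    refine integral_congr_ae ?_
    filter_upwards [he] with x hx
    rw [hx, RCLike.inner_apply, mul_comm]
  have h4 : ∫ x, starRingEnd ℂ (f x) * u x = inner ℂ f (R z f) := by
    rw [L2.inner_def]
    refine integral_congr_ae ?_
    filter_upwards [he] with x hx
    rw [hx, RCLike.inner_apply, mul_comm]
  have i2 := integrable_mul_of_memLp (memLp_conj hm) hm
  have i3 := integrable_mul_of_memLp (memLp_conj hm) (Lp.memLp f)
  have i4 := integrable_mul_of_memLp (memLp_conj (Lp.memLp f)) hm
  have h5 : ∀ x, (z * u x + f x) * starRingEnd ℂ (u x) - u x * starRingEnd ℂ (z * u x + f x) =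
      (z - starRingEnd ℂ z) * (starRingEnd ℂ (u x) * u x) + starRingEnd ℂ (u x) * f x
        - starRingEnd ℂ (f x) * u x := fun x => by
    rw [map_add, map_mul]; ring
  simp only [h5] at h1
  have i5 : Integrable (fun x => (z - starRingEnd ℂ z) * (starRingEnd ℂ (u x) * u x) +
    starRingEnd ℂ (u x) * f x) volume := (i2.const_mul _).add i3
  rw [integral_sub i5 i4, integral_add (i2.const_mul _) i3,
    integral_const_mul, h2, h3, h4, ← inner_conj_symm f (R z f),
    inner_self_eq_norm_sq_to_K] at h1
  have h6 := congrArg Complex.im h1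
  simp only [Complex.sub_im, Complex.add_im, Complex.mul_im, Complex.conj_im, Complex.sub_re,
    Complex.conj_re, Complex.zero_im, sub_self, zero_mul] at h6
  have h7 : ((‖R z f‖ : ℂ) ^ 2).re = ‖R z f‖ ^ 2 := by norm_cast
  have h8 : |(inner ℂ (R z f) f).im| ≤ ‖R z f‖ * ‖f‖ :=
    (Complex.abs_im_le_norm _).trans (norm_inner_le_norm _ _)
  have h9 : z.im * ‖R z f‖ ^ 2 = -(inner ℂ (R z f) f).im := by
    have : (((‖R z f‖ : ℝ) : ℂ) ^ 2).re = ‖R z f‖ ^ 2 := h7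
    simp only [Complex.coe_algebraMap] at h6
    rw [this] at h6
    linarith
  rcases (norm_nonneg (R z f)).eq_or_lt with h0 | h0
  · rw [← h0, mul_zero]; exact norm_nonneg _
  · have h10 : |z.im| * ‖R z f‖ ^ 2 ≤ ‖R z f‖ * ‖f‖ := by
      rw [← abs_of_nonneg (sq_nonneg ‖R z f‖), ← abs_mul, h9, abs_neg]; exact h8
    have h11 : ‖R z f‖ * (|z.im| * ‖R z f‖) ≤ ‖R z f‖ * ‖f‖ := by linarith
    exact le_of_mul_le_mul_left h11 h0

end HasResolvent

/-! ### An isolated singularity on the real line -/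

/-- The hypothesis degenerates only near the real axis. There g is multiplied by a quadratic
polynomial vanishing at the two real points of a circle that avoids E, and the maximum principle
carries the bound inside. -/
theorem norm_mul_le_of_abs_im_mul_le {g : ℂ → ℂ} {E r C : ℝ} (hC0 : 0 ≤ C)
    (hd : DifferentiableOn ℂ g (Metric.ball (E : ℂ) r \ {(E : ℂ)}))
    (hC : ∀ z ∈ Metric.ball (E : ℂ) r \ {(E : ℂ)}, |z.im| * ‖g z‖ ≤ C) {w : ℂ}
    (hw : w ∈ Metric.ball (E : ℂ) (r / 4) \ {(E : ℂ)}) : ‖w - E‖ * ‖g w‖ ≤ 6 * C := by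
  have hwr : ‖w - E‖ < r / 4 := by simpa [dist_eq_norm] using hw.1
  have hwE : w ≠ E := hw.2
  have hr : 0 < r := by linarith [norm_nonneg (w - E)]
  set x := w.re - E with hx
  have hn : ‖w - E‖ ≤ |x| + |w.im| := by
    have := Complex.norm_le_abs_re_add_abs_im (w - E)
    simpa [hx] using this
  have hxn : |x| ≤ ‖w - E‖ := by
    have := Complex.abs_re_le_norm (w - E)
    simpa [hx] using this
  have hwmem : w ∈ Metric.ball (E : ℂ) r \ {(E : ℂ)} :=
    ⟨Metric.ball_subset_ball (by linarith) hw.1, hw.2⟩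
  -- Away from the axis, ‖w - E‖ ≤ 3|Im w| and the hypothesis suffices. Otherwise the circle has its
  -- centre at Re w and radius half the distance from Re w to E.
  rcases le_or_gt (|x| / 2) |w.im| with hcase | hcase
  · have h1 := hC w hwmem
    have h2 : ‖w - E‖ * ‖g w‖ ≤ (3 * |w.im|) * ‖g w‖ := by
      gcongr; linarith
    nlinarith
  · set σ := |x| / 2 with hσ
    have hσ0 : 0 < σ := lt_of_le_of_lt (abs_nonneg _) hcase
    set c : ℂ := (w.re : ℂ) with hc
    have hcE : ‖c - E‖ = 2 * σ := by
      rw [hc, ← Complex.ofReal_sub, Complex.norm_real, Real.norm_eq_abs, hσ]; ring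
    have hsub : Metric.closedBall c σ ⊆ Metric.ball (E : ℂ) r \ {(E : ℂ)} := by
      intro z hz
      rw [Metric.mem_closedBall, dist_eq_norm] at hz
      refine ⟨?_, fun hzE => ?_⟩
      · rw [Metric.mem_ball, dist_eq_norm]
        calc ‖z - E‖ ≤ ‖z - c‖ + ‖c - E‖ := norm_sub_le_norm_sub_add_norm_sub _ _ _
          _ < r := by rw [hcE]; linarith
      · rw [mem_singleton_iff.1 hzE, norm_sub_rev, hcE] at hz
        linarith
    -- On the circle |(z - c)² - σ²| = 2σ|Im z|, which compensates the bound on g exactly; at w the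
    -- factor has modulus at least σ².
    have hdiff : DiffContOnCl ℂ (fun z => g z * ((z - c) ^ 2 - (σ : ℂ) ^ 2)) (Metric.ball c σ) := by
      refine DifferentiableOn.diffContOnCl ?_
      rw [closure_ball c hσ0.ne']
      exact (hd.mono hsub).mul (by fun_prop)
    have hfr : ∀ z ∈ frontier (Metric.ball c σ),
        ‖g z * ((z - c) ^ 2 - (σ : ℂ) ^ 2)‖ ≤ 2 * σ * C := by
      intro z hz
      rw [frontier_ball c hσ0.ne', mem_sphere_iff_norm] at hz
      have hzC := hC z (hsub (by rw [Metric.mem_closedBall, dist_eq_norm, hz]))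
      have e1 : (σ : ℂ) ^ 2 = (z - c) * starRingEnd ℂ (z - c) := by
        rw [Complex.mul_conj, Complex.normSq_eq_norm_sq, hz]; push_cast; ring
      have e2 : (z - c) ^ 2 - (σ : ℂ) ^ 2 = (z - c) * (2 * z.im * Complex.I) := by
        rw [e1, pow_two, ← mul_sub, Complex.sub_conj]
        simp [hc]
      rw [e2, norm_mul, norm_mul, hz]
      have e3 : ‖(2 * z.im * Complex.I : ℂ)‖ = 2 * |z.im| := by simp
      rw [e3]
      nlinarith [norm_nonneg (g z), abs_nonneg z.im]
    have hwc : w - c = w.im * Complex.I := by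
      apply Complex.ext <;> simp [hc]
    have hwcl : w ∈ closure (Metric.ball c σ) := by
      rw [closure_ball c hσ0.ne', Metric.mem_closedBall, dist_eq_norm, hwc]
      simpa using hcase.le
    have hmax := Complex.norm_le_of_forall_mem_frontier_norm_le Metric.isBounded_ball hdiff hfr hwcl
    have e4 : (w - c) ^ 2 - (σ : ℂ) ^ 2 = ((-(w.im ^ 2 + σ ^ 2) : ℝ) : ℂ) := by
      rw [hwc, mul_pow, Complex.I_sq]; push_cast; ring
    rw [norm_mul, e4, Complex.norm_real, Real.norm_eq_abs, abs_neg,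
      abs_of_nonneg (by positivity)] at hmax
    have h1 : ‖g w‖ * σ ≤ 2 * C := by
      have h2 : σ * (‖g w‖ * σ) ≤ σ * (2 * C) := by
        nlinarith [norm_nonneg (g w), mul_nonneg (norm_nonneg (g w)) (sq_nonneg w.im)]
      exact le_of_mul_le_mul_left h2 hσ0
    have h3 : ‖w - E‖ ≤ 3 * σ := by linarith
    calc ‖w - E‖ * ‖g w‖ ≤ 3 * σ * ‖g w‖ := by gcongr
      _ ≤ 6 * C := by linarith

/-- Since (z - E)g is bounded near E, (z - E)²g tends to 0 and has a removable singularity. The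
exponent 2 also makes the value of g at E irrelevant. -/
theorem meromorphicAt_of_abs_im_mul_le {g : ℂ → ℂ} {E C : ℝ}
    (hd : ∀ᶠ z in 𝓝[≠] (E : ℂ), DifferentiableAt ℂ g z)
    (hC : ∀ᶠ z in 𝓝[≠] (E : ℂ), |z.im| * ‖g z‖ ≤ C) : MeromorphicAt g E := by
  obtain ⟨r, hr, hsub⟩ := Metric.mem_nhdsWithin_iff.1 (hd.and hC)
  have hmem : ∀ z ∈ Metric.ball (E : ℂ) r \ {(E : ℂ)},
      DifferentiableAt ℂ g z ∧ |z.im| * ‖g z‖ ≤ C := fun z hz => hsub ⟨hz.1, hz.2⟩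
  have hb : ∀ w ∈ Metric.ball (E : ℂ) (r / 4) \ {(E : ℂ)}, ‖w - E‖ * ‖g w‖ ≤ 6 * |C| :=
    fun w hw => norm_mul_le_of_abs_im_mul_le (abs_nonneg C)
      (fun z hz => (hmem z hz).1.differentiableWithinAt)
      (fun z hz => (hmem z hz).2.trans (le_abs_self C)) hw
  refine ⟨2, ?_⟩
  refine Complex.analyticAt_of_differentiable_on_punctured_nhds_of_continuousAt ?_ ?_
  · filter_upwards [hd] with z hz
    exact ((differentiableAt_id.sub_const _).pow 2).smul hz
  · have hlim : Tendsto (fun z : ℂ => ‖z - E‖ * (6 * |C|)) (𝓝 (E : ℂ)) (𝓝 0) := by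
      have : Continuous fun z : ℂ => ‖z - E‖ * (6 * |C|) := by fun_prop
      simpa using this.tendsto (E : ℂ)
    rw [ContinuousAt, sub_self, zero_pow two_ne_zero, zero_smul]
    refine squeeze_zero_norm' ?_ hlim
    filter_upwards [Metric.ball_mem_nhds (E : ℂ) (show 0 < r / 4 by linarith)] with z hz
    rw [norm_smul, norm_pow, pow_two, mul_assoc]
    by_cases hzE : z = E
    · simp [hzE]
    · exact mul_le_mul_of_nonneg_left (hb z ⟨hz, hzE⟩) (norm_nonneg _)

namespace HasResolvent

variable {ρ : Set ℂ} {R : ℂ → Lp ℂ 2 (volume : Measure ℝ) →L[ℂ] Lp ℂ 2 (volume : Measure ℝ)}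

/-! ### Analytic families of solutions that are square-integrable at `+∞` -/

/-- The Cauchy data at `b` of a solution to the right of `b`, as functionals on `L²(ℝ)`. -/
theorem exists_data_functional (h : HasResolvent volume V ρ R) (hV : LocallyIntegrable V volume)
    (b : ℝ) (p r : ℂ) : ∃ L₁ L₂ : Lp ℂ 2 (volume : Measure ℝ) →L[ℂ] ℂ,
      ∀ (z : ℂ) (w v f : ℝ → ℂ) (W : Lp ℂ 2 (volume : Measure ℝ)),
        IsRep V w v (fun x => z * w x + f x) → MemLp f 2 volume → W =ᵐ[volume] w →
        (∀ x ∈ Ioi b, f x = 0) → v b * p - w b * r = z * L₁ W + L₂ W := by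
  -- Point values are not continuous on L². Green's formula against η = χθ, where 𝒜θ = 0 has Cauchy
  -- data (p, r) at b, rewrites them as integrals of w against the fixed functions η and k = 𝒜η,
  -- with z only as an explicit factor.
  obtain ⟨θ, θ', hθ, hp, hr⟩ := exists_solution hV 0 b p r
  obtain ⟨χ, χ₁, χ₂, d1, d2, hc2, hl, hr0, hχ0, -⟩ := exists_cutoff (α := b + 1) (β := b + 2)
    (by linarith)
  have hcχ : Continuous χ := continuous_iff_continuousAt.2 fun x => (d1 x).continuousAt
  have hcχ₁ : Continuous χ₁ := continuous_iff_continuousAt.2 fun x => (d2 x).continuousAt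
  have hcθ := hθ.continuous
  have hcθ' := hθ.continuous_deriv
  set η : ℝ → ℂ := fun x => χ x * θ x with hη
  set k : ℝ → ℂ := fun x => -2 * χ₁ x * θ' x - χ₂ x * θ x with hk
  have hrep : IsRep V η (fun x => χ₁ x * θ x + χ x * θ' x) k :=
    (hθ.cutoff d1 d2 hc2).congr_ae (Eventually.of_forall fun x => by simp only [hk]; ring)
  have mk : MemLp k 2 volume := memLp_of_continuous_of_eq_zero (α := b + 1) (β := b + 2)
    (by fun_prop) fun x hx => by simp only [hk, (hχ0 x hx).1, (hχ0 x hx).2]; ring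
  have mη : ∀ c, MemLp η 2 (volume.restrict (Ici c)) :=
    memLp_restrict_Ici (b := b + 2) hrep.continuous (by
      refine (memLp_congr_ae (f := fun _ => (0 : ℂ)) ?_).1 MemLp.zero
      filter_upwards [ae_restrict_mem measurableSet_Ici] with x hx
      simp [hη, hr0 x hx])
  have mη1 : MemLp ((Ioi b).indicator η) 2 volume :=
    (memLp_indicator_iff_restrict measurableSet_Ioi).2
      ((mη b).mono_measure (Measure.restrict_mono Ioi_subset_Ici_self le_rfl))
  have mk1 : MemLp ((Ioi b).indicator k) 2 volume := mk.indicator measurableSet_Ioi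
  refine ⟨innerSL ℂ ((memLp_conj mη1).toLp _), -innerSL ℂ ((memLp_conj mk1).toLp _), ?_⟩
  intro z w v f W hw mf hWw hf
  have mw : MemLp w 2 volume := (memLp_congr_ae hWw).1 (Lp.memLp W)
  have hg := h.green hV hw hrep (c := b - 1) (by linarith) (mw.restrict _)
    (((mw.const_mul z).add mf).restrict _) (mη _) (mk.restrict _)
  have hχb : χ b = 1 := hl b (by linarith)
  have hχ₁b : χ₁ b = 0 := (hχ0 b fun hm => by linarith [hm.1]).1
  simp only [hη, hχb, hχ₁b, hp, hr, one_mul, zero_mul, zero_add] at hg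
  have hW : W = mw.toLp w := Lp.ext (hWw.trans mw.coeFn_toLp.symm)
  have hval : ∀ {q : ℝ → ℂ} (mq : MemLp ((Ioi b).indicator q) 2 volume),
      innerSL ℂ ((memLp_conj mq).toLp _) W = ∫ x in Ioi b, q x * w x := by
    intro q mq
    rw [innerSL_apply_apply, hW, integral_inner_toLp (memLp_conj mq) mw,
      ← integral_indicator measurableSet_Ioi]
    refine integral_congr_ae (Eventually.of_forall fun x => ?_)
    by_cases hx : x ∈ Ioi b
    · simp only [indicator_of_mem hx, Complex.conj_conj]
    · simp only [indicator_of_notMem hx, map_zero, zero_mul]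
  have i1 : IntegrableOn (fun x => η x * w x) (Ioi b) :=
    integrable_mul_of_memLp ((memLp_indicator_iff_restrict measurableSet_Ioi).1 mη1)
      (mw.restrict _)
  have i2 : IntegrableOn (fun x => k x * w x) (Ioi b) :=
    integrable_mul_of_memLp (mk.restrict _) (mw.restrict _)
  rw [hg, neg_apply, hval mη1, hval mk1, ← integral_const_mul,
    ← sub_eq_add_neg, ← integral_sub (i1.const_mul z) i2]
  refine setIntegral_congr_fun measurableSet_Ioi fun x hx => ?_
  simp only [hf x hx, hη]; ring

/-- A solution for z₁ square-integrable at +∞ is cut off to the left of b, and f₀ is the image of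
the result under 𝒜 - z₁. Then f₀ = 0 to the right of b, so R(z)f₀ solves the homogeneous equation
there for every z in ρ; P and Q are its Cauchy data at b. They may vanish together at other z, which
is why the point z₁ is prescribed. -/
theorem exists_data (h : HasResolvent volume V ρ R) (hV : LocallyIntegrable V volume)
    (b : ℝ) {z₁ : ℂ} (hz₁ : z₁ ∈ ρ) : ∃ (P Q : ℂ → ℂ) (C : ℝ),
      DifferentiableOn ℂ P ρ ∧ DifferentiableOn ℂ Q ρ ∧
      (∀ z ∈ ρ, |z.im| * ‖P z‖ ≤ C * (1 + ‖z‖)) ∧ (∀ z ∈ ρ, |z.im| * ‖Q z‖ ≤ C * (1 + ‖z‖)) ∧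
      (∀ z ∈ ρ, ∃ u v, PlusSol V z u v ∧ u b = P z ∧ v b = Q z) ∧ (P z₁ ≠ 0 ∨ Q z₁ ≠ 0) := by
  obtain ⟨y, y', hy, hy0⟩ := h.exists_plusSol hV z₁
  obtain ⟨w₁, w₁', g₁, hw₁, mw₁, mg₁, e1, -⟩ := hy.isRep.exists_cutoff_left (c := b - 1) (b := b)
    (by linarith) (hy.memLp _) ((hy.memLp _).const_mul z₁)
  have mf0 : MemLp (fun x => g₁ x - z₁ * w₁ x) 2 volume := mg₁.sub (mw₁.const_mul z₁)
  set f₀ : Lp ℂ 2 (volume : Measure ℝ) := mf0.toLp _ with hf₀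
  have hR₁ : R z₁ f₀ =ᵐ[volume] w₁ := h.eq_of_isRep hz₁ hw₁ (by
    filter_upwards [mf0.coeFn_toLp] with x hx
    rw [hx]; ring) mw₁
  have hf0 : ∀ x ∈ Ioi b, g₁ x - z₁ * w₁ x = 0 := fun x hx => by
    rw [(e1 x (le_of_lt hx)).1, (e1 x (le_of_lt hx)).2.2]; ring
  -- The choice (p, r) = (0, -1) extracts w(b), and (1, 0) extracts w'(b).
  obtain ⟨L₁, L₂, hL⟩ := h.exists_data_functional hV b 0 (-1)
  obtain ⟨M₁, M₂, hM⟩ := h.exists_data_functional hV b 1 0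
  have hdiff : ∀ L : Lp ℂ 2 (volume : Measure ℝ) →L[ℂ] ℂ,
      DifferentiableOn ℂ (fun z => L (R z f₀)) ρ := fun L =>
    L.differentiable.comp_differentiableOn (h.diff.clm_apply (differentiableOn_const f₀))
  have hbound : ∀ K₁ K₂ : Lp ℂ 2 (volume : Measure ℝ) →L[ℂ] ℂ, ∀ z ∈ ρ,
      |z.im| * ‖z * K₁ (R z f₀) + K₂ (R z f₀)‖ ≤ ((‖K₁‖ + ‖K₂‖) * ‖f₀‖) * (1 + ‖z‖) := by
    intro K₁ K₂ z hz
    have h1 : ‖z * K₁ (R z f₀) + K₂ (R z f₀)‖ ≤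
        ((‖K₁‖ + ‖K₂‖) * (1 + ‖z‖)) * ‖R z f₀‖ := by
      refine (norm_add_le _ _).trans ?_
      rw [norm_mul]
      have h2 := mul_le_mul_of_nonneg_left (K₁.le_opNorm (R z f₀)) (norm_nonneg z)
      have h3 := K₂.le_opNorm (R z f₀)
      have h4 : 0 ≤ ‖K₁‖ * ‖R z f₀‖ := by positivity
      have h5 : 0 ≤ ‖K₂‖ * ‖z‖ * ‖R z f₀‖ := by positivity
      nlinarith
    calc |z.im| * ‖z * K₁ (R z f₀) + K₂ (R z f₀)‖
        ≤ |z.im| * (((‖K₁‖ + ‖K₂‖) * (1 + ‖z‖)) * ‖R z f₀‖) := by gcongr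
      _ = ((‖K₁‖ + ‖K₂‖) * (1 + ‖z‖)) * (|z.im| * ‖R z f₀‖) := by ring
      _ ≤ ((‖K₁‖ + ‖K₂‖) * (1 + ‖z‖)) * ‖f₀‖ := by
        gcongr; exact h.abs_im_mul_norm_le hV hz f₀
      _ = _ := by ring
  have hP1 := hL z₁ w₁ w₁' _ (R z₁ f₀) (hw₁.congr_ae (Eventually.of_forall fun x => by ring)) mf0
    hR₁ hf0
  have hQ1 := hM z₁ w₁ w₁' _ (R z₁ f₀) (hw₁.congr_ae (Eventually.of_forall fun x => by ring)) mf0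
    hR₁ hf0
  refine ⟨fun z => z * L₁ (R z f₀) + L₂ (R z f₀), fun z => z * M₁ (R z f₀) + M₂ (R z f₀),
    max ((‖L₁‖ + ‖L₂‖) * ‖f₀‖) ((‖M₁‖ + ‖M₂‖) * ‖f₀‖),
    (differentiableOn_id.mul (hdiff L₁)).add (hdiff L₂),
    (differentiableOn_id.mul (hdiff M₁)).add (hdiff M₂),
    fun z hz => (hbound L₁ L₂ z hz).trans ?_, fun z hz => (hbound M₁ M₂ z hz).trans ?_,
    fun z hz => ?_, ?_⟩
  · gcongr; exact le_max_left _ _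
  · gcongr; exact le_max_right _ _
  · obtain ⟨w, v, hw, hRw⟩ := h.solve z hz f₀
    have mw : MemLp w 2 volume := (memLp_congr_ae hRw).1 (Lp.memLp _)
    have hw' : IsRep V w v (fun x => z * w x + (g₁ x - z₁ * w₁ x)) := hw.congr_ae (by
      filter_upwards [mf0.coeFn_toLp] with x hx
      rw [hx])
    have e2 := hL z w v _ _ hw' mf0 hRw hf0
    have e3 := hM z w v _ _ hw' mf0 hRw hf0
    -- U continues R(z)f₀ from [b, ∞) to a homogeneous solution on ℝ.
    obtain ⟨U, W, hU, hU0, hU1⟩ := exists_solution hV z b (w b) (v b)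
    have hne : ∀ᵐ t : ℝ, t ≠ b := by simp [ae_iff]
    have hEq : ∀ x, b ≤ x → w x = U x := fun x hx => by
      have h3 := (hw'.sub hU).eq_zero_of_ae hV (z := z) (x₀ := b) (y := x) (by simp [hU0])
        (by simp [hU1]) (by
          filter_upwards [hne] with t ht htm
          rw [uIcc_of_le hx] at htm
          simp only [Pi.sub_apply, hf0 t (lt_of_le_of_ne htm.1 (Ne.symm ht))]; ring)
      exact sub_eq_zero.1 h3.1
    refine ⟨U, W, hU.plusSol (b := b) ?_, ?_, ?_⟩
    · refine (memLp_congr_ae ?_).1 (mw.restrict (Ici b))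
      filter_upwards [ae_restrict_mem measurableSet_Ici] with x hx using hEq x hx
    · rw [hU0]; exact (by ring : w b = v b * 0 - w b * -1).trans e2
    · rw [hU1]; exact (by ring : v b = v b * 1 - w b * 0).trans e3
  · rw [(e1 b le_rfl).1, (e1 b le_rfl).2.1] at hP1 hQ1
    simp only [← hP1, ← hQ1]
    simpa using hy.isRep.data_ne_zero hV hy0 b

end HasResolvent

/-! ### The Weyl–Titchmarsh coefficient -/

/-- The Weyl–Titchmarsh coefficient at `+∞` with base point `b`, in terms of solutions on `ℝ`. -/
structure WeylFn (V : ℝ → ℝ) (b : ℝ) (m : ℂ → ℂ) : Prop where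
  nf : MeromorphicNFOn m univ
  weyl : ∀ z : ℂ, z.im ≠ 0 → ∃ u v, PlusSol V z u v ∧ u b = 1 ∧ v b = m z

variable {ρ : Set ℂ} {R : ℂ → Lp ℂ 2 (volume : Measure ℝ) →L[ℂ] Lp ℂ 2 (volume : Measure ℝ)}

/-- A punctured neighbourhood of E meets the upper half-plane, which is connected and contained in
ρ, so the identity theorem applies. This prevents the denominator of m from vanishing identically
near a real point. -/
theorem HasResolvent.eq_zero_of_eventually_eq_zero (h : HasResolvent volume V ρ R)
    (hV : LocallyIntegrable V volume) {P : ℂ → ℂ} (hP : DifferentiableOn ℂ P ρ) {E : ℝ}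
    (h0 : ∀ᶠ z in 𝓝[≠] (E : ℂ), P z = 0) : P Complex.I = 0 := by
  set U : Set ℂ := {z | 0 < z.im}
  have hUo : IsOpen U := isOpen_lt continuous_const Complex.continuous_im
  have hUρ : U ⊆ ρ := fun z hz => h.mem_of_im_ne_zero hV (ne_of_gt hz)
  have hA : AnalyticOnNhd ℂ P U := (hP.mono hUρ).analyticOnNhd hUo
  have hUc : IsPreconnected U := (convex_halfSpace_im_gt 0).isPreconnected
  obtain ⟨r, hr, hsub⟩ := Metric.mem_nhdsWithin_iff.1 h0
  set z₀ : ℂ := E + (r / 2 : ℝ) * Complex.I with hz₀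
  have him : z₀.im = r / 2 := by simp [hz₀]
  have hz₀U : z₀ ∈ U := by simp only [U, mem_ofPred_eq, him]; linarith
  have hz₀b : z₀ ∈ Metric.ball (E : ℂ) r := by
    rw [Metric.mem_ball, dist_eq_norm, hz₀, add_sub_cancel_left, norm_mul, Complex.norm_I, mul_one,
      Complex.norm_real, Real.norm_eq_abs, abs_of_pos (by linarith)]
    linarith
  have hev : P =ᶠ[𝓝 z₀] 0 := by
    filter_upwards [hUo.mem_nhds hz₀U, Metric.isOpen_ball.mem_nhds hz₀b] with z h1 h2
    refine hsub ⟨h2, fun hc => ?_⟩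
    rw [mem_singleton_iff.1 hc] at h1
    simp [U] at h1
  exact hA.eqOn_zero_of_preconnected_of_eventuallyEq_zero hUc hz₀U hev
    (show Complex.I ∈ U by simp [U])

/-- The quotient u'(b)/u(b) does not depend on the chosen solution, so near each point it equals Q/P
for whichever data are convenient: data nonzero at the point itself off the real axis, data nonzero
at i near a real point. -/
theorem HasResolvent.exists_weylFn (h : HasResolvent volume V ρ R)
    (hV : LocallyIntegrable V volume) (b : ℝ) :
    ∃ m, WeylFn V b m ∧ DifferentiableOn ℂ m {z | z.im ≠ 0} := by
  choose u v hu hne using fun z => h.exists_plusSol hV z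
  set M : ℂ → ℂ := fun z => v z b / u z b with hM
  have key : ∀ z (w w' : ℝ → ℂ), PlusSol V z w w' → w b ≠ 0 → M z = w' b / w b := by
    intro z w w' hw hwb
    have h1 := h.plusSol_unique hV (hu z) hw b
    have hub : u z b ≠ 0 := fun hc => by
      rw [hc, zero_mul, mul_eq_zero, or_iff_left hwb] at h1
      exact ((hu z).isRep.data_ne_zero hV (hne z) b).elim (fun h => h hc) fun h => h h1
    simp only [hM]
    rw [div_eq_div_iff hub hwb, h1, mul_comm]
  have hana : ∀ z : ℂ, z.im ≠ 0 → AnalyticAt ℂ M z := by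
    intro z₀ hz₀
    have hρ := h.mem_of_im_ne_zero hV hz₀
    obtain ⟨P, Q, C, hP, hQ, -, -, hsol, h0⟩ := h.exists_data hV b hρ
    have hP0 : P z₀ ≠ 0 := by
      obtain ⟨w, w', hw, e1, e2⟩ := hsol z₀ hρ
      rw [← e1, ← e2] at h0
      rw [← e1]
      refine h.plusSol_data_ne_zero hV hz₀ hw (fun hc => ?_) b
      have h3 := hw.isRep.hasDerivAt b
      rw [hc] at h3
      have h4 : w' b = 0 := h3.unique (hasDerivAt_const b (0 : ℂ))
      rcases h0 with h0 | h0
      · exact h0 (by rw [hc]; rfl)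
      · exact h0 h4
    have hPa := (hP.analyticOnNhd h.isOpen) z₀ hρ
    have hQa := (hQ.analyticOnNhd h.isOpen) z₀ hρ
    refine (hQa.div hPa hP0).congr ?_
    filter_upwards [h.isOpen.mem_nhds hρ, hPa.continuousAt.eventually_ne hP0] with z h1 h2
    obtain ⟨w, w', hw, e1, e2⟩ := hsol z h1
    rw [key z w w' hw (e1 ▸ h2), e1, e2]
    rfl
  have hmer : ∀ z : ℂ, MeromorphicAt M z := by
    intro z
    by_cases hz : z.im ≠ 0
    · exact (hana z hz).meromorphicAt
    obtain ⟨E, rfl⟩ : ∃ E : ℝ, (E : ℂ) = z := ⟨z.re, by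
      apply Complex.ext
      · simp
      · simp [not_not.1 hz]⟩
    obtain ⟨P, Q, C, hP, hQ, hPC, hQC, hsol, h0⟩ := h.exists_data hV b
      (h.mem_of_im_ne_zero hV (z := Complex.I) (by simp))
    have hmero : ∀ P : ℂ → ℂ, DifferentiableOn ℂ P ρ →
        (∀ z ∈ ρ, |z.im| * ‖P z‖ ≤ C * (1 + ‖z‖)) → MeromorphicAt P E := by
      intro P hP hPC
      refine meromorphicAt_of_abs_im_mul_le (C := |C| * (1 + (|E| + 1))) ?_ ?_
      · filter_upwards [h.punctured E] with z hz
        exact (hP z hz).differentiableAt (h.isOpen.mem_nhds hz)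
      · filter_upwards [h.punctured E, mem_nhdsWithin_of_mem_nhds
          (Metric.ball_mem_nhds (E : ℂ) one_pos)] with z hz hz1
        have h2 : ‖z‖ ≤ |E| + 1 := by
          rw [Metric.mem_ball, dist_eq_norm] at hz1
          have := norm_le_norm_add_norm_sub' z (E : ℂ)
          rw [Complex.norm_real, Real.norm_eq_abs] at this
          linarith
        refine (hPC z hz).trans ?_
        gcongr
        exact le_abs_self C
    have hPm := hmero P hP hPC
    have hQm := hmero Q hQ hQC
    have hPI : P Complex.I ≠ 0 := by
      obtain ⟨w, w', hw, e1, e2⟩ := hsol Complex.I (h.mem_of_im_ne_zero hV (by simp))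
      rw [← e1, ← e2] at h0
      rw [← e1]
      refine h.plusSol_data_ne_zero hV (by simp) hw (fun hc => ?_) b
      have h3 := hw.isRep.hasDerivAt b
      rw [hc] at h3
      have h4 : w' b = 0 := h3.unique (hasDerivAt_const b (0 : ℂ))
      rcases h0 with h0 | h0
      · exact h0 (by rw [hc]; rfl)
      · exact h0 h4
    rcases hPm.eventually_eq_zero_or_eventually_ne_zero with hz | hz
    · exact absurd (h.eq_zero_of_eventually_eq_zero hV hP hz) hPI
    · refine (hQm.div hPm).congr ?_
      filter_upwards [hz, h.punctured E] with z h1 h2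
      obtain ⟨w, w', hw, e1, e2⟩ := hsol z h2
      rw [key z w w' hw (e1 ▸ h1), e1, e2]
      rfl
  have hMm : MeromorphicOn M univ := fun z _ => hmer z
  -- M is analytic off the real axis, so passing to normal form changes no value there.
  have heq : ∀ z : ℂ, z.im ≠ 0 → toMeromorphicNFOn M univ z = M z := by
    intro z hz
    rw [toMeromorphicNFOn_eq_toMeromorphicNFAt hMm (mem_univ z),
      toMeromorphicNFAt_eq_self.2 (hana z hz).meromorphicNFAt]
  refine ⟨toMeromorphicNFOn M univ, ⟨meromorphicNFOn_toMeromorphicNFOn M univ, fun z hz => ?_⟩,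
    ?_⟩
  · have hub := h.plusSol_data_ne_zero hV hz (hu z) (hne z) b
    refine ⟨_, _, (hu z).const_smul (u z b)⁻¹, ?_, ?_⟩
    · simp [hub]
    · rw [heq z hz]
      simp only [hM, Pi.smul_apply, smul_eq_mul]
      field_simp
  · intro z hz
    exact ((hana z hz).differentiableAt.differentiableWithinAt).congr
      (fun w hw => heq w hw) (heq z hz)

/-- The Weyl–Titchmarsh coefficient is determined by any normalized square-integrable solution. -/
theorem WeylFn.eq_of_plusSol (h : HasResolvent volume V ρ R) (hV : LocallyIntegrable V volume)
    {b : ℝ} {m : ℂ → ℂ} (hm : WeylFn V b m) {z : ℂ} (hz : z.im ≠ 0) {u v : ℝ → ℂ}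
    (hu : PlusSol V z u v) (hub : u b = 1) : m z = v b := by
  obtain ⟨w, w', hw, e1, e2⟩ := hm.weyl z hz
  have := h.plusSol_unique hV hu hw b
  rw [hub, e1, e2, mul_one, one_mul] at this
  exact this.symm

theorem WeylFn.isHerglotz (h : HasResolvent volume V ρ R) (hV : LocallyIntegrable V volume)
    {b : ℝ} {m : ℂ → ℂ} (hm : WeylFn V b m) : IsHerglotz m where
  holomorphic := by
    obtain ⟨m₁, hm₁, hd⟩ := h.exists_weylFn hV b
    refine hd.congr fun z hz => ?_
    obtain ⟨w, w', hw, e1, e2⟩ := hm₁.weyl z hz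
    rw [hm.eq_of_plusSol h hV hz hw e1, e2]
  symm := fun z hz => by
    obtain ⟨w, w', hw, e1, e2⟩ := hm.weyl z hz
    rw [hm.eq_of_plusSol h hV (by simpa using hz) hw.conj (by simp [e1]), e2]
  im_nonneg := fun z hz => by
    obtain ⟨w, w', hw, e1, e2⟩ := hm.weyl z hz.ne'
    have h1 := h.im_data hV hw b
    rw [e1, e2, map_one, mul_one] at h1
    rw [h1]
    exact mul_nonneg hz.le (integral_nonneg fun x => by positivity)

/-! ### Boundary conditions at real energies -/

theorem norm_integral_mul_sq_le {μ : Measure ℝ} {f g : ℝ → ℂ} (hf : MemLp f 2 μ)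
    (hg : MemLp g 2 μ) :
    ‖∫ x, f x * g x ∂μ‖ ^ 2 ≤ (∫ x, ‖f x‖ ^ 2 ∂μ) * ∫ x, ‖g x‖ ^ 2 ∂μ := by
  have hnorm : ∀ {q : ℝ → ℂ} (hq : MemLp q 2 μ), ‖hq.toLp q‖ ^ 2 = ∫ x, ‖q x‖ ^ 2 ∂μ := by
    intro q hq
    have h1 := inner_self_eq_norm_sq_to_K (𝕜 := ℂ) (hq.toLp q)
    rw [integral_inner_toLp hq hq] at h1
    have h2 : ∀ x, starRingEnd ℂ (q x) * q x = ((‖q x‖ ^ 2 : ℝ) : ℂ) := fun x => by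
      rw [mul_comm, Complex.mul_conj, Complex.normSq_eq_norm_sq]
    simp only [h2] at h1
    rw [integral_complex_ofReal] at h1
    refine Complex.ofReal_injective ?_
    rw [h1, Complex.ofReal_pow]
    rfl
  have h1 : ∫ x, f x * g x ∂μ = inner ℂ ((memLp_conj hf).toLp _) (hg.toLp g) := by
    rw [integral_inner_toLp (memLp_conj hf) hg]
    simp only [Complex.conj_conj]
  have h2 := norm_inner_le_norm (𝕜 := ℂ) ((memLp_conj hf).toLp _) (hg.toLp g)
  rw [h1, ← hnorm hg]
  have h3 : ∫ x, ‖f x‖ ^ 2 ∂μ = ‖(memLp_conj hf).toLp _‖ ^ 2 := by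
    rw [hnorm (memLp_conj hf)]; simp
  rw [h3, ← mul_pow]
  gcongr

/-- The boundary condition satisfied by real-energy solutions that are square-integrable at
`+∞`. -/
theorem WeylFn.boundary (h : HasResolvent volume V ρ R) (hV : LocallyIntegrable V volume)
    {b : ℝ} {m : ℂ → ℂ} (hm : WeylFn V b m) {E : ℝ} {u v : ℝ → ℂ} (hu : PlusSol V E u v) :
    (¬ IsPole m E → v b = m E * u b) ∧ (IsPole m E → u b = 0) := by
  set A := ∫ x in Ioi b, ‖u x‖ ^ 2 with hA
  have hA0 : 0 ≤ A := integral_nonneg fun x => by positivity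
  -- Green's formula reads v(b) - u(b)m(z) = (E - z) ∫ u w with |E - z| = ε. After Cauchy–Schwarz,
  -- one of the two factors ε turns ∫ |w|² into Im m(z); the other survives.
  have hest : ∀ ε : ℝ, 0 < ε → ‖v b - u b * m (E + ε * Complex.I)‖ ^ 2 ≤
      ε * (A * ‖m (E + ε * Complex.I)‖) := by
    intro ε hε
    set z : ℂ := E + ε * Complex.I with hz
    have him : z.im = ε := by simp [hz]
    obtain ⟨w, w', hw, e1, e2⟩ := hm.weyl z (by rw [him]; exact hε.ne')
    have h1 := h.green_plusSol hV hu hw b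
    have h2 := h.im_data hV hw b
    rw [e1, e2, mul_one] at h1
    rw [e1, e2, map_one, mul_one, him] at h2
    have hEz : ‖(E : ℂ) - z‖ = ε := by simp [hz, abs_of_pos hε]
    have hr : volume.restrict (Ioi b) ≤ volume.restrict (Ici b) :=
      Measure.restrict_mono Ioi_subset_Ici_self le_rfl
    have h3 := norm_integral_mul_sq_le ((hu.memLp b).mono_measure hr) ((hw.memLp b).mono_measure hr)
    rw [h1, norm_mul, hEz, mul_pow]
    have h4 : ε * ∫ x in Ioi b, ‖w x‖ ^ 2 ≤ ‖m z‖ := h2 ▸ (Complex.im_le_norm _)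
    calc ε ^ 2 * ‖∫ x in Ioi b, u x * w x‖ ^ 2 ≤ ε ^ 2 * (A * ∫ x in Ioi b, ‖w x‖ ^ 2) := by
          gcongr
      _ = ε * (A * (ε * ∫ x in Ioi b, ‖w x‖ ^ 2)) := by ring
      _ ≤ ε * (A * ‖m z‖) := by gcongr
  have hε : Tendsto (fun ε : ℝ => ε) (𝓝[>] 0) (𝓝 0) := tendsto_nhdsWithin_of_tendsto_nhds tendsto_id
  have hpath : Tendsto (fun ε : ℝ => (E : ℂ) + ε * Complex.I) (𝓝[>] 0) (𝓝 (E : ℂ)) := by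
    have : Continuous fun ε : ℝ => (E : ℂ) + ε * Complex.I := by fun_prop
    refine tendsto_nhdsWithin_of_tendsto_nhds ?_
    simpa using this.tendsto 0
  have hnf := hm.nf (mem_univ (E : ℂ))
  constructor
  · intro hpole
    have hana := hnf.meromorphicOrderAt_nonneg_iff_analyticAt.1 (not_lt.1 hpole)
    have hlim := hana.continuousAt.tendsto.comp hpath
    have h1 : Tendsto (fun ε : ℝ => ‖v b - u b * m (E + ε * Complex.I)‖ ^ 2) (𝓝[>] 0)
        (𝓝 (‖v b - u b * m E‖ ^ 2)) :=
      ((tendsto_const_nhds.sub (hlim.const_mul (u b))).norm.pow 2)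
    have h2 : Tendsto (fun ε : ℝ => ε * (A * ‖m (E + ε * Complex.I)‖)) (𝓝[>] 0)
        (𝓝 (0 * (A * ‖m E‖))) := hε.mul (hlim.norm.const_mul A)
    have h3 := le_of_tendsto_of_tendsto h1 h2 (by
      filter_upwards [self_mem_nhdsWithin] with ε hε using hest ε hε)
    rw [zero_mul] at h3
    have h4 : ‖v b - u b * m E‖ = 0 := by
      have := le_antisymm h3 (sq_nonneg _)
      exact pow_eq_zero_iff (two_ne_zero) |>.1 this
    rw [norm_eq_zero, sub_eq_zero] at h4
    rw [h4, mul_comm]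
  · intro hpole
    -- At a pole the estimate is divided by ‖m‖²: the left side tends to ‖u(b)‖², the right side
    -- εA/‖m‖ to 0.
    have hcob := (tendsto_cobounded_iff_meromorphicOrderAt_neg hnf.meromorphicAt).2 hpole
    have hpath' : Tendsto (fun ε : ℝ => (E : ℂ) + ε * Complex.I) (𝓝[>] 0) (𝓝[≠] (E : ℂ)) := by
      refine tendsto_nhdsWithin_iff.2 ⟨hpath, ?_⟩
      filter_upwards [self_mem_nhdsWithin] with ε hε
      simpa using ne_of_gt hε
    have hcob' := hcob.comp hpath'
    have hinv : Tendsto (fun ε : ℝ => (m (E + ε * Complex.I))⁻¹) (𝓝[>] 0) (𝓝 0) :=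
      tendsto_inv₀_cobounded.comp hcob'
    have h1 : Tendsto (fun ε : ℝ => ‖v b * (m (E + ε * Complex.I))⁻¹ - u b‖ ^ 2) (𝓝[>] 0)
        (𝓝 (‖v b * 0 - u b‖ ^ 2)) := (((hinv.const_mul (v b)).sub tendsto_const_nhds).norm.pow 2)
    have h2 : Tendsto (fun ε : ℝ => ε * (A * ‖(m (E + ε * Complex.I))⁻¹‖)) (𝓝[>] 0)
        (𝓝 (0 * (A * ‖(0 : ℂ)‖))) := hε.mul (hinv.norm.const_mul A)
    have hne : ∀ᶠ ε : ℝ in 𝓝[>] 0, m (E + ε * Complex.I) ≠ 0 :=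
      hcob'.eventually_ne_cobounded 0
    have h3 := le_of_tendsto_of_tendsto h1 h2 (by
      filter_upwards [self_mem_nhdsWithin, hne] with ε hε hm0
      have h5 := hest ε hε
      set y := m (E + ε * Complex.I)
      have hy : 0 < ‖y‖ := norm_pos_iff.2 hm0
      have h6 : ‖v b * y⁻¹ - u b‖ = ‖v b - u b * y‖ * ‖y‖⁻¹ := by
        rw [← norm_inv, ← norm_mul]
        congr 1
        field_simp
      rw [h6, mul_pow, norm_inv]
      calc ‖v b - u b * y‖ ^ 2 * ‖y‖⁻¹ ^ 2 ≤ (ε * (A * ‖y‖)) * ‖y‖⁻¹ ^ 2 := by gcongr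
        _ = ε * (A * ‖y‖⁻¹) := by field_simp)
    rw [zero_mul, mul_zero, zero_sub, norm_neg] at h3
    have := le_antisymm h3 (sq_nonneg _)
    exact norm_eq_zero.1 (pow_eq_zero_iff (two_ne_zero) |>.1 this)

/-- Conversely, real-energy solutions satisfying the boundary condition are square-integrable at
`+∞`. -/
theorem WeylFn.plusSol_of_boundary (h : HasResolvent volume V ρ R)
    (hV : LocallyIntegrable V volume) {b : ℝ} {m : ℂ → ℂ} (hm : WeylFn V b m) {E : ℝ}
    {u v : ℝ → ℂ} (hu : IsRep V u v (fun x => E * u x)) (h1 : ¬ IsPole m E → v b = m E * u b)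
    (h2 : IsPole m E → u b = 0) : PlusSol V E u v := by
  obtain ⟨w, w', hw, hw0⟩ := h.exists_plusSol hV E
  obtain ⟨b1, b2⟩ := hm.boundary h hV hw
  have hdata := hw.isRep.data_ne_zero hV hw0 b
  -- The boundary condition describes a line of Cauchy data. The nonzero data of w lie on it, so
  -- those of u are a multiple of them.
  obtain ⟨c, hc1, hc2⟩ : ∃ c : ℂ, u b = c * w b ∧ v b = c * w' b := by
    by_cases hp : IsPole m E
    · have hw' : w' b ≠ 0 := hdata.resolve_left (not_not.2 (b2 hp))
      exact ⟨v b / w' b, by rw [h2 hp, b2 hp, mul_zero], by field_simp⟩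
    · have hwb : w b ≠ 0 := fun hc => by
        rcases hdata with hd | hd
        · exact hd hc
        · exact hd (by rw [b1 hp, hc, mul_zero])
      exact ⟨u b / w b, by field_simp, by rw [h1 hp, b1 hp]; field_simp⟩
  obtain ⟨e1, e2⟩ := hu.unique hV (hw.const_smul c).isRep (x₀ := b) hc1 hc2
  rw [e1, e2]
  exact hw.const_smul c

/-! ### Resolvents of unbounded operators -/

section Resolvent

variable {X : Type*} [NormedAddCommGroup X] [NormedSpace ℂ X]

/-- `S` is the bounded inverse of `T - z`. -/
def IsResolventAt (T : X →ₗ.[ℂ] X) (z : ℂ) (S : X →L[ℂ] X) : Prop :=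
  (∀ f : T.domain, S (T f - z • (f : X)) = f) ∧
    ∀ g : X, ∃ f : T.domain, (f : X) = S g ∧ T f - z • (f : X) = g

theorem IsResolventAt.unique {T : X →ₗ.[ℂ] X} {z : ℂ} {S S' : X →L[ℂ] X}
    (h : IsResolventAt T z S) (h' : IsResolventAt T z S') : S = S' := by
  ext g
  obtain ⟨f, hf, hfg⟩ := h.2 g
  have := h'.1 f
  rw [hfg] at this
  rw [this, hf]

/-- On the domain, T - z = (1 - (z - z₀)S)(T - z₀), so only the bounded left factor has to be
inverted. -/
theorem IsResolventAt.shift {T : X →ₗ.[ℂ] X} {z₀ z : ℂ} {S : X →L[ℂ] X}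
    (h : IsResolventAt T z₀ S) (hu : IsUnit (1 - (z - z₀) • S)) :
    IsResolventAt T z (S * Ring.inverse (1 - (z - z₀) • S)) := by
  set A := 1 - (z - z₀) • S with hA
  have hA1 : ∀ k, A (Ring.inverse A k) = k := fun k =>
    DFunLike.congr_fun (Ring.mul_inverse_cancel A hu) k
  have hA2 : ∀ k, Ring.inverse A (A k) = k := fun k =>
    DFunLike.congr_fun (Ring.inverse_mul_cancel A hu) k
  have hAk : ∀ k, A k = k - (z - z₀) • S k := fun k => by simp [hA]
  refine ⟨fun f => ?_, fun g => ?_⟩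
  · have h1 : T f - z • (f : X) = A (T f - z₀ • (f : X)) := by
      rw [hAk, h.1 f, sub_smul]; abel
    rw [h1, mul_apply_eq_comp, hA2, h.1 f]
  · obtain ⟨f, hf, hfg⟩ := h.2 (Ring.inverse A g)
    refine ⟨f, hf, ?_⟩
    have h1 : T f - z • (f : X) = (T f - z₀ • (f : X)) - (z - z₀) • (f : X) := by
      rw [sub_smul]; abel
    rw [h1, hfg, hf, ← hAk, hA1]

open Classical in
/-- The resolvent of `T`, extended by zero to the spectrum. -/
noncomputable def resolvent (T : X →ₗ.[ℂ] X) (z : ℂ) : X →L[ℂ] X :=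
  if h : ∃ S, IsResolventAt T z S then h.choose else 0

theorem isResolventAt_resolvent {T : X →ₗ.[ℂ] X} {z : ℂ} (hz : z ∈ resolventSet T) :
    IsResolventAt T z (resolvent T z) := by
  have h : ∃ S, IsResolventAt T z S := hz
  rw [resolvent, dif_pos h]
  exact h.choose_spec

variable [CompleteSpace X]

/-- The factor 1 - (z - z₀)R(z₀) is the identity at z₀ and units are open. The formula gives
openness of the resolvent set and holomorphy of the resolvent. -/
theorem eventually_resolvent_eq {T : X →ₗ.[ℂ] X} {z₀ : ℂ} (hz₀ : z₀ ∈ resolventSet T) :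
    ∀ᶠ z in 𝓝 z₀, z ∈ resolventSet T ∧
      resolvent T z = resolvent T z₀ * Ring.inverse (1 - (z - z₀) • resolvent T z₀) := by
  have hc : Continuous fun z : ℂ => 1 - (z - z₀) • resolvent T z₀ := by fun_prop
  have h1 : ∀ᶠ z in 𝓝 z₀, IsUnit (1 - (z - z₀) • resolvent T z₀) :=
    hc.continuousAt.eventually (Units.isOpen.mem_nhds (by simp))
  filter_upwards [h1] with z hz
  have h2 := (isResolventAt_resolvent hz₀).shift hz
  have hmem : z ∈ resolventSet T := ⟨_, h2⟩
  exact ⟨hmem, (isResolventAt_resolvent hmem).unique h2⟩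

theorem isOpen_resolventSet (T : X →ₗ.[ℂ] X) : IsOpen (resolventSet T) :=
  isOpen_iff_mem_nhds.2 fun _ hz => (eventually_resolvent_eq hz).mono fun _ h => h.1

theorem differentiableOn_resolvent (T : X →ₗ.[ℂ] X) :
    DifferentiableOn ℂ (resolvent T) (resolventSet T) := by
  intro z₀ hz₀
  refine DifferentiableAt.differentiableWithinAt ?_
  have hd : DifferentiableAt ℂ
      (fun z => resolvent T z₀ * Ring.inverse (1 - (z - z₀) • resolvent T z₀)) z₀ := by
    refine (differentiableAt_const _).mul ?_
    refine DifferentiableAt.comp z₀ (g := Ring.inverse) ?_ (by fun_prop)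
    exact differentiableAt_inverse (by simp)
  exact hd.congr_of_eventuallyEq ((eventually_resolvent_eq hz₀).mono fun _ h => h.2)

end Resolvent

/-! ### From the operator H to a family of resolvents -/

variable {V : ℝ → ℝ}

theorem ae_of_ae_restrict_univ {p : ℝ → Prop} (h : ∀ᵐ x ∂(volume.restrict univ), p x) :
    ∀ᵐ x, p x := by
  rwa [Measure.restrict_univ] at h

theorem mem_graph_maxOp_iff {f g : L2 univ} : (f, g) ∈ (maxOp V univ).graph ↔
    ∃ u v w, IsRep V u v w ∧ f =ᵐ[volume.restrict univ] u ∧ g =ᵐ[volume.restrict univ] w := by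
  rw [maxOp_graph V univ (by simp)]
  constructor
  · rintro ⟨u, hu, h1, h2⟩
    exact ⟨u, deriv u, expr V univ u, hu.isRep (Filter.EventuallyEq.refl _ _), h1, h2⟩
  · rintro ⟨u, v, w, hu, h1, h2⟩
    exact ⟨u, hu.isRegular uniqueDiffOn_univ, h1, h2.trans (hu.expr_ae uniqueDiffOn_univ).symm⟩

theorem exists_isRep_of_domain (f : (maxOp V univ).domain) : ∃ u v w, IsRep V u v w ∧
    (f : L2 univ) =ᵐ[volume.restrict univ] u ∧ maxOp V univ f =ᵐ[volume.restrict univ] w :=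
  mem_graph_maxOp_iff.1 ((maxOp V univ).mem_graph f)

/-- Membership in the graph of H is read as an equation 𝒜u = w for functions. Discreteness enters
twice: spectral points are isolated, and each carries an eigenfunction. -/
theorem hasResolvent_maxOp (H : HasDiscreteSpectrum (maxOp V univ)) :
    HasResolvent (volume.restrict univ) V (resolventSet (maxOp V univ))
      (resolvent (maxOp V univ)) where
  isOpen := isOpen_resolventSet _
  punctured := fun z => by
    by_cases hz : z ∈ resolventSet (maxOp V univ)
    · exact mem_nhdsWithin_of_mem_nhds ((isOpen_resolventSet _).mem_nhds hz)
    · exact (H z hz).1.mono fun w hw => not_not.1 hw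
  diff := differentiableOn_resolvent _
  solve := fun z hz f => by
    obtain ⟨x, hx, hxf⟩ := (isResolventAt_resolvent hz).2 f
    obtain ⟨u, v, w, hu, h1, h2⟩ := exists_isRep_of_domain x
    refine ⟨u, v, hu.congr_ae ?_, hx ▸ h1⟩
    rw [sub_eq_iff_eq_add] at hxf
    rw [hxf] at h2
    have h3 := (Lp.coeFn_add f (z • (x : L2 univ))).symm.trans h2
    have h4 := Lp.coeFn_smul z (x : L2 univ)
    filter_upwards [ae_of_ae_restrict_univ h1, ae_of_ae_restrict_univ h3,
      ae_of_ae_restrict_univ h4] with t e1 e3 e4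
    rw [← e3, Pi.add_apply, e4, Pi.smul_apply, e1, smul_eq_mul, add_comm]
  inj := fun z hz u v hu hm => by
    have hmem : (hm.toLp u, z • hm.toLp u) ∈ (maxOp V univ).graph := by
      refine mem_graph_maxOp_iff.2 ⟨u, v, _, hu, hm.coeFn_toLp, ?_⟩
      filter_upwards [Lp.coeFn_smul z (hm.toLp u), hm.coeFn_toLp] with t e1 e2
      rw [e1, Pi.smul_apply, e2, smul_eq_mul]
    obtain ⟨x, hx1, hx2⟩ := LinearPMap.mem_graph_iff _ |>.1 hmem
    dsimp only at hx1 hx2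
    have h1 := (isResolventAt_resolvent hz).1 x
    rw [hx2, ← hx1, sub_self, map_zero] at h1
    have h2 : hm.toLp u = 0 := by rw [← hx1, ← h1]
    have h3 := hm.coeFn_toLp
    rw [h2] at h3
    have h4 := h3.symm.trans (Lp.coeFn_zero ℂ 2 _)
    rw [Measure.restrict_univ] at h4
    exact (Continuous.ae_eq_iff_eq volume hu.continuous (g := 0) continuous_const).1 h4
  eig := fun z hz => by
    obtain ⟨x, hx, hx0⟩ := (Submodule.ne_bot_iff _).1 (H z hz).2.1
    have hx' : maxOp V univ x = z • (x : L2 univ) := by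
      have := LinearMap.mem_ker.1 hx
      simpa [sub_eq_zero] using this
    obtain ⟨u, v, w, hu, h1, h2⟩ := exists_isRep_of_domain x
    have hm : MemLp u 2 (volume.restrict univ) := (memLp_congr_ae h1).1 (Lp.memLp _)
    refine ⟨u, v, hu.congr_ae ?_, hm, fun h0 => hx0 ?_⟩
    · rw [hx'] at h2
      have h4 := Lp.coeFn_smul z (x : L2 univ)
      filter_upwards [ae_of_ae_restrict_univ h1, ae_of_ae_restrict_univ h2,
        ae_of_ae_restrict_univ h4] with t e1 e2 e4
      rw [← e2, e4, Pi.smul_apply, e1, smul_eq_mul]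
    · refine Subtype.ext (Lp.ext ?_)
      rw [h0] at h1
      exact h1.trans (Lp.coeFn_zero ℂ 2 _).symm

/-- The measure is a parameter of `HasResolvent` so that `volume.restrict univ`, which occurs in the
type of the operator, can be rewritten to `volume`. -/
theorem exists_hasResolvent (H : HasDiscreteSpectrum (maxOp V univ)) :
    ∃ ρ : Set ℂ, spec (maxOp V univ) = ρᶜ ∧ ∃ R, HasResolvent volume V ρ R := by
  have h : ∃ ρ : Set ℂ, spec (maxOp V univ) = ρᶜ ∧
      ∃ R, HasResolvent (volume.restrict univ) V ρ R := ⟨_, rfl, _, hasResolvent_maxOp H⟩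
  obtain ⟨ρ, h1, h2⟩ := h
  rw [Measure.restrict_univ] at h2
  exact ⟨ρ, h1, h2⟩

/-! ### Weyl–Titchmarsh coefficients on half-lines -/

theorem memLp_comp_neg_Ici {f : ℝ → ℂ} {a : ℝ} (hf : MemLp f 2 (volume.restrict (Iic a))) :
    MemLp (fun x => f (-x)) 2 (volume.restrict (Ici (-a))) := by
  have h := hf.comp_measurePreserving ((Measure.measurePreserving_neg volume).restrict_preimage
    (measurableSet_Iic (a := a)))
  have : Neg.neg ⁻¹' Iic a = Ici (-a) := by
    ext x; simp
  rwa [this] at h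

theorem memLp_comp_neg_Iic {f : ℝ → ℂ} {a : ℝ} (hf : MemLp f 2 (volume.restrict (Ici (-a)))) :
    MemLp (fun x => f (-x)) 2 (volume.restrict (Iic a)) := by
  have h := hf.comp_measurePreserving ((Measure.measurePreserving_neg volume).restrict_preimage
    (measurableSet_Ici (a := -a)))
  have : Neg.neg ⁻¹' Ici (-a) = Iic a := by
    ext x; simp
  rwa [this] at h

/-- A value of the Weyl–Titchmarsh coefficient in terms of a single global solution. -/
theorem isWeylValue_iff (hV : LocallyIntegrable V volume) {S : Set ℝ} [hS : S.OrdConnected]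
    (hu : UniqueDiffOn ℝ S) {a : ℝ} (ha : a ∈ S) (σ l m : ℂ) : IsWeylValue V S a σ l m ↔
      ∃ u v, IsRep V u v (fun x => l * u x) ∧ u a = 1 ∧ v a = σ * m ∧
        MemLp u 2 (volume.restrict S) := by
  constructor
  · rintro ⟨c, s, hc, hs, c0, c1, s0, s1, hm⟩
    obtain ⟨C, C', hC, eC, eC'⟩ := hc.exists_isRep hV ha
    obtain ⟨D, D', hD, eD, eD'⟩ := hs.exists_isRep hV ha
    refine ⟨_, _, hC.lin_comb hD 1 (σ * m), ?_, ?_, (memLp_congr_ae ?_).1 hm⟩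
    · rw [← eC ha, ← eD ha, c0, s0]; ring
    · rw [← eC' ha, ← eD' ha, c1, s1]; ring
    · filter_upwards [ae_restrict_mem hS.measurableSet] with x hx
      rw [eC hx, eD hx, one_mul]
  · rintro ⟨u, v, hr, u0, v0, hm⟩
    obtain ⟨C, C', hC, eC, eC'⟩ := exists_solution hV l a 1 0
    obtain ⟨D, D', hD, eD, eD'⟩ := exists_solution hV l a 0 1
    refine ⟨C, D, hC.isSolution hu, hD.isSolution hu, eC, by rw [hC.eqOn_derivWithin hu ha, eC'],
      eD, by rw [hD.eqOn_derivWithin hu ha, eD'], ?_⟩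
    have := (hr.unique hV (hC.lin_comb hD 1 (σ * m)) (x₀ := a) (by rw [u0, eC, eD]; ring)
      (by rw [v0, eC', eD']; ring)).1
    rw [this] at hm
    simpa [SqInt] using hm

theorem isWeylPlus_iff (hV : LocallyIntegrable V volume) {b : ℝ} {m : ℂ → ℂ} :
    IsWeylPlus V b m ↔ WeylFn V b m := by
  have key : ∀ l : ℂ, IsWeylValue V (Ici b) b 1 l (m l) ↔
      ∃ u v, PlusSol V l u v ∧ u b = 1 ∧ v b = m l := fun l => by
    rw [isWeylValue_iff hV (uniqueDiffOn_Ici b) (mem_Ici.2 le_rfl)]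
    constructor
    · rintro ⟨u, v, h1, h2, h3, h4⟩
      exact ⟨u, v, h1.plusSol h4, h2, by rw [h3, one_mul]⟩
    · rintro ⟨u, v, h1, h2, h3⟩
      exact ⟨u, v, h1.isRep, h2, by rw [h3, one_mul], h1.memLp b⟩
  exact ⟨fun h => ⟨h.meromorphic, fun z hz => (key z).1 (h.weyl z hz)⟩,
    fun h => ⟨h.nf, fun z hz => (key z).2 (h.weyl z hz)⟩⟩

/-- Reflection reverses the sign of the derivative at the endpoint, which absorbs the sign -1 in the
definition of m₋. -/
theorem isWeylMinus_iff (hV : LocallyIntegrable V volume) {a : ℝ} {m : ℂ → ℂ} :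
    IsWeylMinus V a m ↔ WeylFn (fun x => V (-x)) (-a) m := by
  have key : ∀ l : ℂ, IsWeylValue V (Iic a) a (-1) l (m l) ↔
      ∃ u v, PlusSol (fun x => V (-x)) l u v ∧ u (-a) = 1 ∧ v (-a) = m l := fun l => by
    rw [isWeylValue_iff hV (uniqueDiffOn_Iic a) (mem_Iic.2 le_rfl)]
    constructor
    · rintro ⟨u, v, h1, h2, h3, h4⟩
      exact ⟨_, _, h1.comp_neg.plusSol (memLp_comp_neg_Ici h4), by simp [h2], by simp [h3]⟩
    · rintro ⟨u, v, h1, h2, h3⟩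
      have h4 := h1.isRep.comp_neg
      simp only [neg_neg] at h4
      exact ⟨_, _, h4, h2, by simp [h3], memLp_comp_neg_Iic (h1.memLp (-a))⟩
  exact ⟨fun h => ⟨h.meromorphic, fun z hz => (key z).1 (h.weyl z hz)⟩,
    fun h => ⟨h.nf, fun z hz => (key z).2 (h.weyl z hz)⟩⟩

/-! ### Transparency -/

theorem memLp_of_Iic_of_Ici {f : ℝ → ℂ} {b : ℝ} (h1 : MemLp f 2 (volume.restrict (Iic b)))
    (h2 : MemLp f 2 (volume.restrict (Ici b))) : MemLp f 2 volume := by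
  have h3 := (memLp_indicator_iff_restrict measurableSet_Iic).2 h1
  have h4 := (memLp_indicator_iff_restrict measurableSet_Ioi).2
    (h2.mono_measure (Measure.restrict_mono Ioi_subset_Ici_self le_rfl))
  have h5 := h3.add h4
  rwa [← compl_Iic, indicator_self_add_compl] at h5

theorem isTransparent_of_weylFn {ρ : Set ℂ}
    {R R' : ℂ → Lp ℂ 2 (volume : Measure ℝ) →L[ℂ] Lp ℂ 2 (volume : Measure ℝ)}
    (hV : LocallyIntegrable V volume) (h : HasResolvent volume V ρ R)
    (h' : HasResolvent volume (fun x => V (-x)) ρ R') (hspec : spec (maxOp V univ) = ρᶜ)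
    {a b : ℝ} (hab : a < b) {mm mp : ℂ → ℂ} (hm : WeylFn (fun x => V (-x)) (-a) mm)
    (hp : WeylFn V b mp) : IsTransparent V a b mm mp := by
  have hV' := locallyIntegrable_comp_neg hV
  set c := (a + b) / 2 with hc
  have hcm : c ∈ Ioo a b := ⟨by linarith, by linarith⟩
  have hrestrict : ∀ (E : ℝ) (ψ : ℝ → ℂ), IsLineSolution V E ψ →
      IsEigenfunction V a b mm mp E ψ := by
    intro E ψ hψ
    have hr := hψ.sol.isRep_univ
    have hmem : MemLp ψ 2 volume := by simpa [SqInt] using hψ.sqInt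
    have hplus : PlusSol V E ψ (deriv ψ) := hr.plusSol (hmem.restrict (Ici b))
    have hminus := hr.comp_neg.plusSol (memLp_comp_neg_Ici (hmem.restrict (Iic a)))
    have bp := hp.boundary h hV hplus
    -- The reflected function has derivative -ψ'(a) at -a; this is the source of the plus sign in
    -- the left condition.
    have bm := hm.boundary h' hV' hminus
    simp only [neg_neg] at bm
    have hd : EqOn (derivWithin ψ (Ioo a b)) (deriv ψ) (Ioo a b) :=
      hr.eqOn_derivWithin (uniqueDiffOn_Ioo a b)
    refine ⟨hr.isSolution (uniqueDiffOn_Ioo a b), hmem.restrict _, ?_, fun hE => ?_, fun hE => ?_,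
      fun hE => ?_, fun hE => ?_⟩
    · by_contra! h0
      have h1 : deriv ψ c = 0 := by
        have : ψ =ᶠ[𝓝 c] fun _ => 0 := by
          filter_upwards [isOpen_Ioo.mem_nhds hcm] with x hx using h0 x hx
        rw [this.deriv_eq]; simp
      obtain ⟨x, hx⟩ := hψ.nontrivial
      exact hx (congrFun (hr.eq_zero hV (h0 c hcm) h1).1 x)
    · have hcont : Continuous fun x => deriv ψ x + mm E * ψ x := by
        have := hr.continuous; have := hr.continuous_deriv; fun_prop
      have h1 := hcont.tendsto a
      rw [show deriv ψ a + mm E * ψ a = 0 by linear_combination -(bm.1 hE)] at h1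
      refine (tendsto_nhdsWithin_of_tendsto_nhds h1).congr' ?_
      filter_upwards [Ioo_mem_nhdsGT hab] with x hx
      rw [hd hx]
    · have h1 := hr.continuous.tendsto a
      rw [bm.2 hE] at h1
      exact tendsto_nhdsWithin_of_tendsto_nhds h1
    · have hcont : Continuous fun x => deriv ψ x - mp E * ψ x := by
        have := hr.continuous; have := hr.continuous_deriv; fun_prop
      have h1 := hcont.tendsto b
      rw [show deriv ψ b - mp E * ψ b = 0 by linear_combination bp.1 hE] at h1
      refine (tendsto_nhdsWithin_of_tendsto_nhds h1).congr' ?_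
      filter_upwards [Ioo_mem_nhdsLT hab] with x hx
      rw [hd hx]
    · have h1 := hr.continuous.tendsto b
      rw [bp.2 hE] at h1
      exact tendsto_nhdsWithin_of_tendsto_nhds h1
  have hextend : ∀ (E : ℝ) (φ : ℝ → ℂ), IsEigenfunction V a b mm mp E φ →
      ∃ ψ : ℝ → ℂ, IsLineSolution V E ψ ∧ EqOn ψ φ (Ioo a b) := by
    intro E φ hφ
    -- The global continuation U of φ is the candidate for ψ. Continuity of U and U' turns the
    -- one-sided limits into values at a and b, so each condition gives square-integrability at its
    -- own end.
    obtain ⟨U, W, hU, e1, e2⟩ := hφ.sol.exists_isRep hV hcm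
    have hcU := hU.continuous
    have hcW := hU.continuous_deriv
    have hplus : PlusSol V E U W := by
      refine hp.plusSol_of_boundary h hV hU (fun hE => ?_) (fun hE => ?_)
      · have h1 : Tendsto (fun x => W x - mp E * U x) (𝓝[<] b) (𝓝 0) := by
          refine (hφ.right hE).congr' ?_
          filter_upwards [Ioo_mem_nhdsLT hab] with x hx
          rw [e2 hx, e1 hx]
        have h2 : Tendsto (fun x => W x - mp E * U x) (𝓝[<] b) (𝓝 (W b - mp E * U b)) :=
          tendsto_nhdsWithin_of_tendsto_nhds
            ((hcW.sub (continuous_const.mul hcU)).tendsto b)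
        exact sub_eq_zero.1 (tendsto_nhds_unique h2 h1)
      · have h1 : Tendsto U (𝓝[<] b) (𝓝 0) := by
          refine (hφ.right_pole hE).congr' ?_
          filter_upwards [Ioo_mem_nhdsLT hab] with x hx using e1 hx
        exact tendsto_nhds_unique (tendsto_nhdsWithin_of_tendsto_nhds (hcU.tendsto b)) h1
    have hminus : PlusSol (fun x => V (-x)) E (fun x => U (-x)) (fun x => -W (-x)) := by
      refine hm.plusSol_of_boundary h' hV' hU.comp_neg (fun hE => ?_) (fun hE => ?_)
      · have h1 : Tendsto (fun x => W x + mm E * U x) (𝓝[>] a) (𝓝 0) := by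
          refine (hφ.left hE).congr' ?_
          filter_upwards [Ioo_mem_nhdsGT hab] with x hx
          rw [e2 hx, e1 hx]
        have h2 : Tendsto (fun x => W x + mm E * U x) (𝓝[>] a) (𝓝 (W a + mm E * U a)) :=
          tendsto_nhdsWithin_of_tendsto_nhds
            ((hcW.add (continuous_const.mul hcU)).tendsto a)
        have h3 := tendsto_nhds_unique h2 h1
        simp only [neg_neg]
        linear_combination -h3
      · have h1 : Tendsto U (𝓝[>] a) (𝓝 0) := by
          refine (hφ.left_pole hE).congr' ?_
          filter_upwards [Ioo_mem_nhdsGT hab] with x hx using e1 hx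
        simp only [neg_neg]
        exact tendsto_nhds_unique (tendsto_nhdsWithin_of_tendsto_nhds (hcU.tendsto a)) h1
    have hmem : MemLp U 2 volume := by
      refine memLp_of_Iic_of_Ici (b := 0) ?_ (hplus.memLp 0)
      have := memLp_comp_neg_Iic (hminus.memLp (-0))
      simpa using this
    refine ⟨U, ⟨hU.isSolution uniqueDiffOn_univ, by simpa [SqInt] using hmem, ?_⟩, e1.symm⟩
    obtain ⟨x, hx, hx0⟩ := hφ.nontrivial
    exact ⟨x, by rwa [← e1 hx]⟩
  refine ⟨hrestrict, hextend, ?_⟩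
  rw [hspec]
  ext l
  constructor
  · rintro ⟨E, φ, rfl, hφ⟩ hmem
    obtain ⟨ψ, hψ, -⟩ := hextend E φ hφ
    have h0 := h.inj _ hmem _ _ hψ.sol.isRep_univ (by simpa [SqInt] using hψ.sqInt)
    obtain ⟨x, hx⟩ := hψ.nontrivial
    exact hx (by rw [h0]; rfl)
  · intro hl
    obtain ⟨u, v, hu, hmem, h0⟩ := h.eig l hl
    -- An L² solution for a non-real parameter vanishes, so every spectral point is a real E.
    have him : l.im = 0 := by
      by_contra hc
      exact h0 (h.isRep_L2_eq_zero hV hc hu hmem)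
    have hre : l = (l.re : ℂ) := Complex.ext (by simp) (by simp [him])
    rw [hre] at hu
    refine ⟨l.re, u, hre, hrestrict _ _ ⟨hu.isSolution uniqueDiffOn_univ,
      by simpa [SqInt] using hmem, ?_⟩⟩
    by_contra! hc
    exact h0 (funext hc)

end TBC

theorem mainTheorem2 (V : ℝ → ℝ) (hV : MeasureTheory.LocallyIntegrable V MeasureTheory.volume)
    (a b : ℝ) (hab : a < b)
    (H1_minus : TBC.IsLimitPoint V (Set.Iic a)) (H1_plus : TBC.IsLimitPoint V (Set.Ici b))
    (H2 : TBC.HasDiscreteSpectrum (TBC.maxOp V Set.univ)) :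
    (∃ mm mp : ℂ → ℂ, TBC.IsWeylMinus V a mm ∧ TBC.IsWeylPlus V b mp) ∧
    ∀ mm mp : ℂ → ℂ, TBC.IsWeylMinus V a mm → TBC.IsWeylPlus V b mp →
      TBC.IsHerglotz mm ∧ TBC.IsHerglotz mp ∧ TBC.IsTransparent V a b mm mp := by
  obtain ⟨ρ, hspec, R, h⟩ := TBC.exists_hasResolvent H2
  obtain ⟨R', h'⟩ := h.comp_neg
  have hV' := TBC.locallyIntegrable_comp_neg hV
  refine ⟨?_, fun mm mp hmm hmp => ?_⟩
  · obtain ⟨mp, hmp, -⟩ := h.exists_weylFn hV b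
    obtain ⟨mm, hmm, -⟩ := h'.exists_weylFn hV' (-a)
    exact ⟨mm, mp, (TBC.isWeylMinus_iff hV).2 hmm, (TBC.isWeylPlus_iff hV).2 hmp⟩
  · have h1 := (TBC.isWeylMinus_iff hV).1 hmm
    have h2 := (TBC.isWeylPlus_iff hV).1 hmp
    exact ⟨h1.isHerglotz h' hV', h2.isHerglotz h hV,
      TBC.isTransparent_of_weylFn hV h h' hspec hab h1 h2⟩
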